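/- **Conventions.** A forest is a partial order $(F,\le)$ such that for every $p\in F$ the set $\{a\in F : p<a\}$ is finite and linearly ordered; its roots are its maximal elements; a tree is a forest with a greatest element. The level of a node $p$ is the number of $a$ with $p<a$, and the height of a forest is the supremum of the levels of its nodes. For a node $u$ of a forest $\mathfrak F$, $\mathfrak F(u)$ is the restriction of $\mathfrak F$ to $\{v : v\le u\}$. A finite binary tree is a nonempty finite prefix-closed set $T\subseteq\{0,1\}^*$; a finite $\Sigma$-labeled binary tree is such a $T$ with a map $\lambda:T\to\Sigma$, where $\Sigma$ is a finite alphabet. Fix a letter $\sharp$; an unlabeled tree is identified with the tree all of whose nodes are labeled $\sharp$. Let $\mathcal T_{\mathsf{bin}}$ be the set of (unlabeled) finite full binary trees, i.e. those $T$ with $u0\in T\Leftrightarrow u1\in T$ for all $u\in T$, and let $\mathcal T_{\mathsf{lef}}=\{\{\varepsilon\}\cup 0u : u\in\mathcal T_{\mathsf{bin}}\}$. A (nondeterministic top-down) tree automaton over $\Sigma$ is a tuple $(Q,\Delta,I,G)$ with $Q$ finite, $I,G\subseteq Q$ and $\Delta\subseteq (Q\setminus G)\times\Sigma\times Q\times Q$.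 It accepts $(T,\lambda)$ if there is a map $\rho: T\cup T\{0,1\}\to Q$ with $\rho(\varepsilon)\in I$, $\rho(d)\in G$ for all $d\in T\{0,1\}\setminus T$, and $(\rho(d),\lambda(d),\rho(d0),\rho(d1))\in\Delta$ for all $d\in T$. The convolution $s\otimes t$ of two $\Sigma$-labeled trees has as node set the union of their node sets, each node being labeled by the pair of its labels in $s$ and $t$, with a padding symbol $\diamond\notin\Sigma$ where it is not a node. A tree-automatic forest is a forest whose domain is the set of trees accepted by a tree automaton over some finite $\Sigma\ni\sharp$ and whose order $\le$ is such that $\{s\otimes t : s\le t\}$ is the set of trees accepted by a tree automaton over $(\Sigma\cup\{\diamond\})^2$; such a pair of automata is a presentation of the forest. Fix a computable bijective coding of the unlabeled trees (together with the empty tree) by natural numbers. A number $e$ is an index of the $\Sigma^0_2$ set $B\subseteq\mathcal T_{\mathsf{lef}}$ if the set of codes of the elements of $B$ is the $e$-th set that is recursively enumerable in $\emptyset'$. **Statement.** There are two trees $\mathfrak U_0\not\cong\mathfrak U_1$ of height $3$ and a computable function which maps every index $e$ of a $\Sigma^0_2$ set $B\subseteq\mathcal T_{\mathsf{lef}}$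 to a presentation of a tree-automatic forest $\mathfrak F_B$ of height $3$ such that * the set of roots of $\mathfrak F_B$ is $\mathcal T_{\mathsf{lef}}$; * for every $t\in\mathcal T_{\mathsf{lef}}$, $\mathfrak F_B(t)\cong\mathfrak U_0$ if $t\in B$, and $\mathfrak F_B(t)\cong\mathfrak U_1$ if $t\notin B$. -/

import Mathlib

/-! ### Order forests and order trees

A relational structure with one binary relation is a type `V` with `r : V → V → Prop`;
`r x y` is read `x ≤ y`, so roots are the maximal elements. -/

namespace OrderForest

variable {V W : Type}

/-- The strict upward closure `↑p = {a | p < a}`. -/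
def above (r : V → V → Prop) (p : V) : Set V := {a | r p a ∧ a ≠ p}

/-- A forest: a partial order in which every `↑p` is finite and linearly ordered. -/
def IsForest (r : V → V → Prop) : Prop :=
  IsPartialOrder V r ∧
    ∀ p, (above r p).Finite ∧ ∀ a ∈ above r p, ∀ b ∈ above r p, r a b ∨ r b a

/-- A tree: a forest with a greatest element. -/
def IsTree (r : V → V → Prop) : Prop :=
  IsForest r ∧ ∃ g, ∀ x, r x g

/-- The roots of a forest: its maximal elements. -/
def IsRoot (r : V → V → Prop) (x : V) : Prop := ∀ y, r x y → y = x

/-- The level of a node: the number of its proper ancestors. -/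
noncomputable def level (r : V → V → Prop) (p : V) : ℕ := (above r p).ncard

/-- The height of a forest is the supremum of the levels of its nodes, so roots have level `0`
and height `n` means that a longest branch has `n` edges. -/
def HasHeight (r : V → V → Prop) (n : ℕ) : Prop := IsGreatest (Set.range (level r)) n

/-- Isomorphism of structures. -/
def Iso (r : V → V → Prop) (s : W → W → Prop) : Prop := Nonempty (r ≃r s)

/-- The order of the subtree at `u`, on its domain `{v | v ≤ u}`. -/
def subtree (r : V → V → Prop) (u : V) : {v // r v u} → {v // r v u} → Prop :=
  fun x y => r x y

end OrderForest

/-! ### Finite labeled binary trees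

`BinaryTree α` with `nil` as the absent tree: `node a l r` is the tree with root label `a`, whose
root has a left child (word `0`) iff `l ≠ nil` and a right child (word `1`) iff `r ≠ nil`.  The
finite (nonempty) `α`-labeled binary trees are the elements other than `nil`; the occurrences of
`nil` in a tree are exactly its frontier positions. -/

namespace TreeAutomatic

open BinaryTree

/-- Convolution of two labeled trees; `none` is the padding symbol `⋄`. -/
def conv {α β : Type} : BinaryTree α → BinaryTree β → BinaryTree (Option α × Option β)
  | nil, t => t.map fun b => (none, some b)
  | node a l r, nil => (node a l r).map fun a => (some a, none)
  | node a l r, node b l' r' => node (some a, some b) (conv l l') (conv r r')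

/-- A top-down tree automaton over `α`: the list of transitions `(q, a, q₀, q₁)`, the list of
initial states and the list of final states.  States are natural numbers; only the finitely many
ones that occur in the lists matter, and likewise only the finitely many letters that occur in
transitions, so this is an automaton with a finite state set over a finite subalphabet of `α`. -/
abbrev Automaton (α : Type) : Type := List (ℕ × α × ℕ × ℕ) × List ℕ × List ℕ

namespace Automaton

variable {α : Type}

def transitions (A : Automaton α) : List (ℕ × α × ℕ × ℕ) := A.1

def initial (A : Automaton α) : List ℕ := A.2.1

def final (A : Automaton α) : List ℕ := A.2.2

/-- No transition starts in a final state. -/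
def WellFormed (A : Automaton α) : Prop := ∀ τ ∈ A.transitions, τ.1 ∉ A.final

/-- `A.RunFrom t q`: there is an assignment of states to the nodes and the frontier positions of
`t` which is `q` at the root, final on the frontier, and respects the transitions at the nodes. -/
def RunFrom (A : Automaton α) : BinaryTree α → ℕ → Prop
  | nil, q => q ∈ A.final
  | node a l r, q =>
      ∃ q₀ q₁, (q, a, q₀, q₁) ∈ A.transitions ∧ A.RunFrom l q₀ ∧ A.RunFrom r q₁

/-- The set of (nonempty) trees that admit a successful run. -/
def language (A : Automaton α) : Set (BinaryTree α) :=
  {t | t ≠ nil ∧ ∃ q ∈ A.initial, A.RunFrom t q}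

end Automaton

/-- A pair of automata meant to present a structure with one binary relation, whose domain is a
set of labeled trees.  The alphabet is the finite set of natural numbers that occur as letters. -/
abbrev Presentation : Type := Automaton ℕ × Automaton (Option ℕ × Option ℕ)

namespace Presentation

/-- The domain of the presented structure. -/
def domain (P : Presentation) : Set (BinaryTree ℕ) := P.1.language

/-- The binary relation of the presented structure. -/
def rel (P : Presentation) : P.domain → P.domain → Prop :=
  fun s t => conv s.1 t.1 ∈ P.2.language

/-- `P` is a tree-automatic presentation of `(P.domain, P.rel)`: the second automaton accepts
exactly the convolutions of the pairs in a binary relation on the domain. -/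
def IsPresentation (P : Presentation) : Prop :=
  P.1.WellFormed ∧ P.2.WellFormed ∧
    ∀ u ∈ P.2.language, ∃ s ∈ P.domain, ∃ t ∈ P.domain, u = conv s t

end Presentation

/-! ### Unlabeled trees -/

/-- Every node has either both children or none. -/
def IsFull : BinaryTree Unit → Prop
  | nil => True
  | node _ l r => (l = nil ↔ r = nil) ∧ IsFull l ∧ IsFull r

/-- The finite full binary trees. -/
def Tbin : Set (BinaryTree Unit) := {t | t ≠ nil ∧ IsFull t}

/-- The trees whose root has no right child and whose left subtree is a full binary tree. -/
def Tlef : Set (BinaryTree Unit) := {t | ∃ u ∈ Tbin, t = node () u nil}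

/-- An unlabeled tree is identified with the tree all of whose nodes carry the letter `♯`;
the letter `♯` is the number `0`. -/
def labelSharp (t : BinaryTree Unit) : BinaryTree ℕ := t.map fun _ => 0

/-- A computable bijective coding of unlabeled trees by natural numbers. -/
def treeCode : BinaryTree Unit → ℕ
  | nil => 0
  | node _ l r => Nat.pair (treeCode l) (treeCode r) + 1

/-! ### Sets that are recursively enumerable in an oracle -/

/-- `σ` is a finite initial segment of the characteristic function of `X`. -/
def IsInitialSegment (σ : List Bool) (X : Set ℕ) : Prop :=
  ∀ (i : ℕ) (h : i < σ.length), σ[i] = true ↔ i ∈ X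

/-- The `e`-th set that is recursively enumerable in `X`: `x` is enumerated iff the `e`-th partial
recursive function halts on `(x, σ)` for some finite initial segment `σ` of `X`. -/
def REIn (X : Set ℕ) (e : ℕ) : Set ℕ :=
  {x | ∃ σ : List Bool, IsInitialSegment σ X ∧
    ((Denumerable.ofNat Nat.Partrec.Code e).eval (Encodable.encode (x, σ))).Dom}

/-- The Turing jump `X'`. -/
def jump (X : Set ℕ) : Set ℕ := {e | e ∈ REIn X e}

/-- The `Σ⁰₂` set with index `e`: the `e`-th set that is recursively enumerable in `∅'`. -/
def sigmaTwo (e : ℕ) : Set ℕ := REIn (jump ∅) e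

end TreeAutomatic

/-! ### Recognizable tree series

A series is a function `ℕ → BinaryTree Unit → ℕ`; the first argument is a parameter on which the
coefficients of the defining system may depend primitive recursively. -/

namespace TreeAutomatic

open BinaryTree

/-! Write t = node () u nil. Membership of t in a Σ⁰₂ set with index e means that some ξ makes ψ(e,
u, ξ) diverge, for one fixed partial recursive ψ (`exists_partrec_sigmaTwo`). Below the root t the
forest has a child for every tree x, which proposes a ξ, below it a node for every tree w, and below
that finitely many leaves. Only the number of leaves carries information.

Counting. The leaves over (u, x, w) are the runs of a weighted automaton on that triple, written
into the labels. Their number is the value of a recognizable series (`card_runs`). The index e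
enters only as a multiplicity of transitions, so the presentation is computable from e.

Arithmetic. Recognizable series are closed under sums, pointwise products and sums along the right
spine. Hence one equation A v = B v can say that the spine of v lists a correct computation: each
local condition is a vanishing square, and a sum of squares vanishes iff all its terms do. So the
graph of every partial recursive function is a projection of such an equation
(`TreeDefinable.of_partrec`). This resembles the Diophantine representation of r.e. sets, but trees
code the sequences, and no number theory is needed.

Comparison. Now ψ(e, u, ξ) halts iff an equation L(v) = R(v) is solvable. The trees w below x
realize the counts `quadPair (c + L v) (c + R v) + 1` for all shifts c and all v, and also `quadPair
a b + 1` for all a ≠ b. So the set of counts consists of all off-diagonal codes and of the diagonal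
codes from a threshold on, the least common value of L and R; without a solution the threshold is
`none` and no diagonal code occurs. Every count occurs infinitely often, so the isomorphism type
below x depends on the threshold alone. Dummy trees x realize every finite threshold infinitely
often for every u. What remains of the type below t is whether `none` occurs, and it occurs exactly
if t is in the set. The two trees of the theorem have all thresholds and all finite thresholds;
`eq_none_of_iso_heightTwoTree` tells them apart.

Order. An ancestor arises from a node by relabeling and deleting subtrees. The graph of such a map
is a relabeling of the language of its domain (`conv_prune`), so the order is regular. -/

/-- The semiring of primitive recursive functions `ℕ → ℕ`. -/
def primrecSubsemiring : Subsemiring (ℕ → ℕ) where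
  carrier := {f | Primrec f}
  mul_mem' := fun ha hb => Primrec.nat_mul.comp ha hb
  one_mem' := Primrec.const 1
  add_mem' := fun ha hb => Primrec.nat_add.comp ha hb
  zero_mem' := Primrec.const 0

theorem primrec_finset_sum {ι : Type} (s : Finset ι) {f : ι → ℕ → ℕ} (hf : ∀ i, Primrec (f i)) :
    Primrec fun e => ∑ i ∈ s, f i e := by
  have h : (∑ i ∈ s, f i) ∈ primrecSubsemiring := sum_mem fun i _ => hf i
  exact Primrec.of_eq h fun e => by simp

/-- `F` is the behaviour of a weighted tree automaton with state set `Q`, transition weights `c`,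
initial weights `ι` and unweighted final states. -/
def Recognizable (F : ℕ → BinaryTree Unit → ℕ) : Prop :=
  ∃ (Q : Type) (_ : Fintype Q) (X : ℕ → Q → BinaryTree Unit → ℕ) (ι : Q → ℕ → ℕ)
    (c : Q → Q → Q → ℕ → ℕ) (fin : Q → Bool),
    (∀ q, Primrec (ι q)) ∧ (∀ q i j, Primrec (c q i j)) ∧
    (∀ e q, X e q nil = (fin q).toNat) ∧
    (∀ e q l r, X e q (node () l r) = ∑ i, ∑ j, c q i j e * (X e i l * X e j r)) ∧
    ∀ e t, F e t = ∑ q, ι q e * X e q t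

namespace Recognizable

variable {F G : ℕ → BinaryTree Unit → ℕ}

theorem of_eq (hF : Recognizable F) (h : ∀ e t, F e t = G e t) : Recognizable G := by
  have : F = G := by funext e t; exact h e t
  exact this ▸ hF

/-- With one state and all transition weights 1, every tree has exactly one run, so the initial
weight is the value. This is how the index enters a series without changing the state set. -/
theorem param {k : ℕ → ℕ} (hk : Primrec k) : Recognizable fun e _ => k e :=
  ⟨Unit, inferInstance, fun _ _ _ => 1, fun _ => k, fun _ _ _ _ => 1, fun _ => true,
    fun _ => hk, fun _ _ _ => Primrec.const 1, by simp, by simp, by simp⟩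

theorem const (n : ℕ) : Recognizable fun _ _ => n := param (Primrec.const n)

theorem fixParam (hF : Recognizable F) (e : ℕ) : Recognizable fun _ => F e := by
  obtain ⟨Q, _, X, ι, c, fin, hι, hc, hn, hs, hF⟩ := hF
  exact ⟨Q, _, fun _ => X e, fun q _ => ι q e, fun q i j _ => c q i j e, fin,
    fun _ => Primrec.const _, fun _ _ _ => Primrec.const _, fun _ => hn e, fun _ => hs e,
    fun _ => hF e⟩

theorem add (hF : Recognizable F) (hG : Recognizable G) :
    Recognizable fun e t => F e t + G e t := by
  obtain ⟨Q, _, X, ι, c, fin, hι, hc, hn, hs, hF⟩ := hF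
  obtain ⟨Q', _, X', ι', c', fin', hι', hc', hn', hs', hG⟩ := hG
  refine ⟨Q ⊕ Q', inferInstance, fun e => Sum.elim (X e) (X' e), Sum.elim ι ι',
    fun q i j => match q, i, j with
      | .inl q, .inl i, .inl j => c q i j
      | .inr q, .inr i, .inr j => c' q i j
      | _, _, _ => fun _ => 0, Sum.elim fin fin', ?_, ?_, ?_, ?_, ?_⟩
  · rintro (q | q)
    exacts [hι q, hι' q]
  · rintro (q | q) (i | i) (j | j)
    all_goals first
      | exact hc q i j
      | exact hc' q i j
      | exact Primrec.const 0
  · rintro e (q | q)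
    exacts [hn e q, hn' e q]
  · rintro e (q | q) l r
    · simp [hs]
    · simp [hs']
  · intro e t
    simp [hF, hG]

theorem mul (hF : Recognizable F) (hG : Recognizable G) :
    Recognizable fun e t => F e t * G e t := by
  obtain ⟨Q, _, X, ι, c, fin, hι, hc, hn, hs, hF⟩ := hF
  obtain ⟨Q', _, X', ι', c', fin', hι', hc', hn', hs', hG⟩ := hG
  refine ⟨Q × Q', inferInstance, fun e q t => X e q.1 t * X' e q.2 t,
    fun q e => ι q.1 e * ι' q.2 e,
    fun q i j e => c q.1 i.1 j.1 e * c' q.2 i.2 j.2 e, fun q => fin q.1 && fin' q.2,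
    fun q => Primrec.nat_mul.comp (hι _) (hι' _),
    fun q i j => Primrec.nat_mul.comp (hc _ _ _) (hc' _ _ _), ?_, ?_, ?_⟩
  · intro e q
    simp only [hn, hn']
    cases fin q.1 <;> cases fin' q.2 <;> rfl
  · intro e q l r
    simp only [hs, hs', Fintype.sum_prod_type, Finset.sum_mul_sum]
    refine Finset.sum_congr rfl fun i _ => ?_
    refine Finset.sum_congr rfl fun j _ => ?_
    refine Finset.sum_congr rfl fun i' _ => ?_
    refine Finset.sum_congr rfl fun j' _ => ?_
    ring
  · intro e t
    simp only [hF, hG, Fintype.sum_prod_type, Finset.sum_mul_sum]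
    refine Finset.sum_congr rfl fun i _ => ?_
    refine Finset.sum_congr rfl fun j _ => ?_
    ring

/-- The series with value `b` at the empty tree and `F(l) · G(r)` at the tree with principal
subtrees `l` and `r`. -/
theorem nodeMul (hF : Recognizable F) (hG : Recognizable G) (b : Bool)
    {K : ℕ → BinaryTree Unit → ℕ} (hK₀ : ∀ e, K e nil = b.toNat)
    (hK₁ : ∀ e l r, K e (node () l r) = F e l * G e r) : Recognizable K := by
  obtain ⟨Q, _, X, ι, c, fin, hι, hc, hn, hs, hF⟩ := hF
  obtain ⟨Q', _, X', ι', c', fin', hι', hc', hn', hs', hG⟩ := hG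
  refine ⟨Option (Q ⊕ Q'), inferInstance,
    fun e q => match q with
      | none => K e
      | some q => Sum.elim (X e) (X' e) q,
    fun q => match q with
      | none => fun _ => 1
      | some _ => fun _ => 0,
    fun q i j => match q, i, j with
      -- The new root state `none` is never re-entered; the initial weights of both systems move
      -- into its coefficients.
      | none, some (.inl i), some (.inr j) => fun e => ι i e * ι' j e
      | some (.inl q), some (.inl i), some (.inl j) => c q i j
      | some (.inr q), some (.inr i), some (.inr j) => c' q i j
      | _, _, _ => fun _ => 0,
    fun q => match q with
      | none => b
      | some q => Sum.elim fin fin' q, ?_, ?_, ?_, ?_, ?_⟩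
  · rintro (_ | q)
    exacts [Primrec.const 1, Primrec.const 0]
  · rintro (_ | q | q) (_ | i | i) (_ | j | j)
    all_goals first
      | exact hc q i j
      | exact hc' q i j
      | exact Primrec.const 0
      | exact Primrec.nat_mul.comp (hι _) (hι' _)
  · rintro e (_ | q | q)
    exacts [hK₀ e, hn e q, hn' e q]
  · rintro e (_ | q | q) l r
    · simp only [hK₁, hF, hG, Finset.sum_mul_sum, Fintype.sum_option, Fintype.sum_sum_type,
        zero_mul, Finset.sum_const_zero, zero_add, add_zero, Sum.elim_inl, Sum.elim_inr]
      refine Finset.sum_congr rfl fun i _ => ?_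
      refine Finset.sum_congr rfl fun j _ => ?_
      ring
    · simp [hs]
    · simp [hs']
  · intro e t
    simp

/-- The indicator series of the empty tree. -/
theorem isNil : Recognizable fun _ t => if t = nil then 1 else 0 :=
  nodeMul (const 0) (const 0) true (by simp) (by simp)

/-- The indicator series of the nonempty trees. -/
theorem isNode : Recognizable fun _ t => if t = nil then 0 else 1 :=
  nodeMul (const 1) (const 1) false (by simp) (by simp)

theorem value_nil (hF : Recognizable F) : Primrec fun e => F e nil := by
  obtain ⟨Q, _, X, ι, c, fin, hι, hc, hn, hs, hF⟩ := hF
  simp only [hF, hn]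
  exact primrec_finset_sum _ fun q => Primrec.nat_mul.comp (hι q) (Primrec.const _)

/-- Since `nil.left = nil`, the value at the empty tree must be `F e nil`. A final state contributes
only 0 or 1 there, hence the separate summand supported at `nil`. -/
theorem left (hF : Recognizable F) : Recognizable fun e t => F e t.left := by
  refine ((nodeMul (K := fun e t => if t = nil then 0 else F e t.left) hF (const 1) false
    (by simp) (by simp [BinaryTree.left])).add ((param hF.value_nil).mul isNil)).of_eq ?_
  rintro e (_ | ⟨_, l, r⟩) <;> simp [BinaryTree.left]

theorem right (hF : Recognizable F) : Recognizable fun e t => F e t.right := by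
  refine ((nodeMul (K := fun e t => if t = nil then 0 else F e t.right) (const 1) hF false
    (by simp) (by simp [BinaryTree.right])).add ((param hF.value_nil).mul isNil)).of_eq ?_
  rintro e (_ | ⟨_, l, r⟩) <;> simp [BinaryTree.right]

/-- The sum of the values of `G` over the nonempty subtrees on the right spine of a tree. -/
theorem spineSum (hG : Recognizable G) {S : ℕ → BinaryTree Unit → ℕ} (hS₀ : ∀ e, S e nil = 0)
    (hS₁ : ∀ e l r, S e (node () l r) = G e (node () l r) + S e r) : Recognizable S := by
  classical
  obtain ⟨Q, _, X, ι, c, fin, hι, hc, hn, hs, hG⟩ := hG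
  refine ⟨Option (Option Q), inferInstance,
    fun e q => match q with
      | none => S e
      | some none => fun _ => 1
      | some (some q) => X e q,
    fun q => match q with
      | none => fun _ => 1
      | some _ => fun _ => 0,
    fun q i j => match q, i, j with
      -- A run from `none` walks down the right spine and must switch at some node to a run for `G`,
      -- because `none` is not final. Adding up over the place of the switch gives `S`. The state
      -- `some none` has value 1 on every tree and absorbs the left subtrees that are passed.
      | none, some none, none => fun _ => 1
      | none, some (some i), some (some j) => fun e => ∑ q, ι q e * c q i j e
      | some none, some none, some none => fun _ => 1
      | some (some q), some (some i), some (some j) => c q i j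
      | _, _, _ => fun _ => 0,
    fun q => match q with
      | none => false
      | some none => true
      | some (some q) => fin q, ?_, ?_, ?_, ?_, ?_⟩
  · rintro (_ | q)
    exacts [Primrec.const 1, Primrec.const 0]
  · rintro (_ | _ | q) (_ | _ | i) (_ | _ | j)
    all_goals first
      | exact hc q i j
      | exact Primrec.const 0
      | exact Primrec.const 1
      | exact primrec_finset_sum _ fun q => Primrec.nat_mul.comp (hι q) (hc q _ _)
  · rintro e (_ | _ | q)
    exacts [hS₀ e, rfl, hn e q]
  · rintro e (_ | _ | q) l r
    · simp only [hS₁, hG, hs, Fintype.sum_option, zero_mul, Finset.sum_const_zero, zero_add,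
        add_zero, one_mul, Finset.mul_sum, Finset.sum_mul]
      rw [add_comm, Finset.sum_comm]
      congr 1
      refine Finset.sum_congr rfl fun i _ => ?_
      rw [Finset.sum_comm]
      refine Finset.sum_congr rfl fun j _ => ?_
      refine Finset.sum_congr rfl fun q _ => ?_
      ring
    · simp
    · simp [hs]
  · intro e t
    simp

end Recognizable

/-! ### Unary numbers on spines, and an injective recognizable hash of trees. -/

/-- The length of the right spine. -/
def spineLength : BinaryTree Unit → ℕ
  | nil => 0
  | node _ _ r => spineLength r + 1

theorem recognizable_spineLength : Recognizable fun _ t => spineLength t :=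
  Recognizable.spineSum (Recognizable.const 1) (by simp [spineLength])
    (by simp [spineLength, add_comm])

/-- The tree with all nodes on the right spine, which has length `n`. -/
def spine : ℕ → BinaryTree Unit
  | 0 => nil
  | n + 1 => node () nil (spine n)

@[simp] theorem spineLength_spine (n : ℕ) : spineLength (spine n) = n := by
  induction n with
  | zero => rfl
  | succ n ih => simp [spine, spineLength, ih]

/-- `4 ^ n`, where `n` is the number of nodes. -/
def treeBase : BinaryTree Unit → ℕ
  | nil => 1
  | node _ l r => 4 * treeBase l * treeBase r

/-- The number whose binary expansion is the preorder bit string of a tree, in which the bit `1`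
stands for a node and the bit `0` for an empty subtree. -/
def treeHash : BinaryTree Unit → ℕ
  | nil => 0
  | node _ l r => 4 * treeBase l * treeBase r + 2 * treeHash l * treeBase r + treeHash r

/-- The recursions for the constant 1, `treeBase` and `treeHash` form a closed system; these are the
three states. -/
theorem recognizable_treeHash : Recognizable fun _ t => treeHash t := by
  refine ⟨Fin 3, inferInstance, fun _ q => ![fun _ => 1, treeBase, treeHash] q,
    ![fun _ => 0, fun _ => 0, fun _ => 1],
    fun q i j _ => (![![![1, 0, 0], ![0, 0, 0], ![0, 0, 0]], ![![0, 0, 0], ![0, 4, 0], ![0, 0, 0]],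
      ![![0, 0, 1], ![0, 4, 0], ![0, 2, 0]]] q i j : ℕ), ![true, true, false], ?_, ?_, ?_, ?_, ?_⟩
  · intro q
    fin_cases q
    exacts [Primrec.const 0, Primrec.const 0, Primrec.const 1]
  · intro q i j
    exact Primrec.const _
  · intro e q
    fin_cases q <;> simp [treeBase, treeHash]
  · intro e q l r
    fin_cases q <;> simp [treeBase, treeHash, Fin.sum_univ_three] <;> ring
  · intro e t
    simp [Fin.sum_univ_three]

theorem treeBase_pos (t : BinaryTree Unit) : 0 < treeBase t := by
  induction t with
  | nil => simp [treeBase]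
  | node _ l r hl hr => simp only [treeBase]; positivity

/-- A tree with n nodes has a preorder string of 2n + 1 bits, and `treeBase` is 4 ^ n. -/
theorem treeHash_lt (t : BinaryTree Unit) : treeHash t + 1 ≤ 2 * treeBase t := by
  induction t with
  | nil => simp [treeBase, treeHash]
  | node _ l r hl hr =>
    simp only [treeBase, treeHash]
    have := treeBase_pos r
    nlinarith [Nat.mul_le_mul_right (2 * treeBase r) hl]

/-- The binary fractions that extend the bit strings of different trees lie in disjoint
intervals. -/
theorem treeHash_separated (s t : BinaryTree Unit) (h : s ≠ t) :
    (treeHash s + 1) * treeBase t ≤ treeHash t * treeBase s ∨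
      (treeHash t + 1) * treeBase s ≤ treeHash s * treeBase t := by
  induction s generalizing t with
  | nil =>
    cases t with
    | nil => exact absurd rfl h
    | node _ l r =>
      left
      simp only [treeHash, treeBase]
      nlinarith [Nat.zero_le (2 * treeHash l * treeBase r)]
  | node _ l r hl hr =>
    cases t with
    | nil =>
      right
      simp only [treeHash, treeBase]
      nlinarith [Nat.zero_le (2 * treeHash l * treeBase r)]
    | node _ l' r' =>
      simp only [treeHash, treeBase]
      have hbl := treeBase_pos l
      have hbl' := treeBase_pos l'
      have hbr := treeBase_pos r
      have hbr' := treeBase_pos r'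
      -- The preorder code is prefix-free, and the first difference decides. If the left subtrees
      -- differ, the right ones contribute too little to matter, by `treeHash_lt`.
      by_cases hll : l = l'
      · subst hll
        have hrr : r ≠ r' := by
          rintro rfl
          exact h rfl
        rcases hr r' hrr with h1 | h1
        · left
          nlinarith [Nat.mul_le_mul_left (4 * treeBase l) h1]
        · right
          nlinarith [Nat.mul_le_mul_left (4 * treeBase l) h1]
      · have h1' := treeHash_lt r
        have h2' := treeHash_lt r'
        rcases hl l' hll with h1 | h1
        · left
          have h3 := Nat.mul_le_mul_left (8 * (treeBase r * treeBase r')) h1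
          have h4 := Nat.mul_le_mul_left (4 * treeBase l' * treeBase r') h1'
          nlinarith [Nat.zero_le (4 * treeBase l * treeBase r * treeHash r')]
        · right
          have h3 := Nat.mul_le_mul_left (8 * (treeBase r * treeBase r')) h1
          have h4 := Nat.mul_le_mul_left (4 * treeBase l * treeBase r) h2'
          nlinarith [Nat.zero_le (4 * treeBase l' * treeBase r' * treeHash r)]

theorem treeBase_eq (t : BinaryTree Unit) : treeBase t = 4 ^ t.numNodes := by
  induction t with
  | nil => rfl
  | node _ l r hl hr => simp only [treeBase, numNodes, hl, hr]; ring

/-- The hypothesis says that the tree is nonempty, and then its leading bit is 1. -/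
theorem treeBase_le_treeHash {t : BinaryTree Unit} (h : 1 < treeBase t) :
    treeBase t ≤ treeHash t := by
  cases t with
  | nil => simp [treeBase] at h
  | node _ l r => simp only [treeBase, treeHash]; omega

/-- Separation compares fractions, not values. If two different trees had the same value h,
separation would force `treeBase t < treeBase s` for one ordering of the two. As both are powers of
4, this gives 4 · `treeBase t` ≤ `treeBase s` ≤ h < 2 · `treeBase t`. -/
theorem treeHash_injective : Function.Injective treeHash := by
  have key : ∀ s t : BinaryTree Unit, treeHash s = treeHash t →
      ¬ (treeHash s + 1) * treeBase t ≤ treeHash t * treeBase s := by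
    intro s t h hle
    have hs := treeBase_pos t
    have hlt : treeBase t < treeBase s := by
      rw [← h] at hle
      by_contra hcon
      have := Nat.mul_le_mul_left (treeHash s) (not_lt.1 hcon)
      nlinarith
    have h1 := treeBase_le_treeHash (lt_of_le_of_lt hs hlt)
    have h2 := treeHash_lt t
    rw [treeBase_eq, treeBase_eq] at hlt
    have h3 := (Nat.pow_lt_pow_iff_right (by norm_num)).1 hlt
    have h4 : 4 ^ (t.numNodes + 1) ≤ 4 ^ s.numNodes := Nat.pow_le_pow_right (by norm_num) h3
    rw [pow_succ, ← treeBase_eq, ← treeBase_eq] at h4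
    omega
  intro s t h
  by_contra hne
  rcases treeHash_separated s t hne with h1 | h1
  · exact key s t h h1
  · exact key t s h.symm h1

end TreeAutomatic

/-! ### Relations on `ℕ` defined by equations between recognizable series -/

namespace TreeAutomatic

open BinaryTree

/-- The equation is (a − b)² + (c − d)² = 0 with the negative terms moved across, since the series
take natural values. It merges two equations into one. -/
theorem sq_add_sq_eq_iff (a b c d : ℕ) :
    (a * a + b * b) + (c * c + d * d) = 2 * (a * b) + 2 * (c * d) ↔ a = b ∧ c = d := by
  constructor
  · intro h
    zify at h ⊢
    have h1 : ((a : ℤ) - b) ^ 2 + ((c : ℤ) - d) ^ 2 = 0 := by linarith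
    have h2 : ((a : ℤ) - b) ^ 2 = 0 := by nlinarith [sq_nonneg ((a : ℤ) - b), sq_nonneg ((c : ℤ) - d)]
    have h3 : ((c : ℤ) - d) ^ 2 = 0 := by nlinarith [sq_nonneg ((a : ℤ) - b), sq_nonneg ((c : ℤ) - d)]
    rw [sq_eq_zero_iff] at h2 h3
    exact ⟨by linarith, by linarith⟩
  · rintro ⟨rfl, rfl⟩
    ring

/-- A predicate on trees that is given by an equation between recognizable series. -/
def Equational (Q : ℕ → BinaryTree Unit → Prop) : Prop :=
  ∃ A B, Recognizable A ∧ Recognizable B ∧ ∀ e t, Q e t ↔ A e t = B e t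

namespace Equational

variable {P Q : ℕ → BinaryTree Unit → Prop}

theorem eq {A B : ℕ → BinaryTree Unit → ℕ} (hA : Recognizable A) (hB : Recognizable B) :
    Equational fun e t => A e t = B e t := ⟨A, B, hA, hB, fun _ _ => Iff.rfl⟩

theorem true : Equational fun _ _ => True :=
  ⟨_, _, Recognizable.const 0, Recognizable.const 0, by simp⟩

theorem and (hP : Equational P) (hQ : Equational Q) : Equational fun e t => P e t ∧ Q e t := by
  obtain ⟨A, B, hA, hB, hP⟩ := hP
  obtain ⟨C, D, hC, hD, hQ⟩ := hQ
  refine ⟨_, _, ((hA.mul hA).add (hB.mul hB)).add ((hC.mul hC).add (hD.mul hD)),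
    ((Recognizable.const 2).mul (hA.mul hB)).add ((Recognizable.const 2).mul (hC.mul hD)), ?_⟩
  intro e t
  exact (and_congr (hP e t) (hQ e t)).trans (sq_add_sq_eq_iff _ _ _ _).symm

theorem left (hP : Equational P) : Equational fun e t => P e t.left := by
  obtain ⟨A, B, hA, hB, hP⟩ := hP
  exact ⟨_, _, hA.left, hB.left, fun e t => hP e t.left⟩

theorem right (hP : Equational P) : Equational fun e t => P e t.right := by
  obtain ⟨A, B, hA, hB, hP⟩ := hP
  exact ⟨_, _, hA.right, hB.right, fun e t => hP e t.right⟩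

theorem exists_const {Q : BinaryTree Unit → Prop} (hQ : Equational fun _ => Q) :
    ∃ A B : BinaryTree Unit → ℕ, Recognizable (fun _ => A) ∧ Recognizable (fun _ => B) ∧
      ∀ t, Q t ↔ A t = B t := by
  obtain ⟨A, B, hA, hB, hQ⟩ := hQ
  exact ⟨A 0, B 0, hA.fixParam 0, hB.fixParam 0, fun t => hQ 0 t⟩

end Equational

/-! ### The pairing function as a series -/

/-- The first component of the pair coded by a tree. -/
def pairFst (v : BinaryTree Unit) : ℕ :=
  spineLength v.left + (if v.right.right = nil then 0 else 1) * spineLength v.right.left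

/-- The second component of the pair coded by a tree. -/
def pairSnd (v : BinaryTree Unit) : ℕ :=
  spineLength v.left + (if v.right.right = nil then 1 else 0) * (spineLength v.right.left + 1)

/-- The code of the pair coded by a tree. -/
def pairCode (v : BinaryTree Unit) : ℕ :=
  (if v.right.right = nil then 1 else 0) * (pairSnd v * pairSnd v + pairFst v) +
    (if v.right.right = nil then 0 else 1) * (pairFst v * pairFst v + pairFst v + pairSnd v)

theorem recognizable_pairFst : Recognizable fun _ => pairFst :=
  recognizable_spineLength.left.add
    (Recognizable.isNode.right.right.mul recognizable_spineLength.left.right)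

theorem recognizable_pairSnd : Recognizable fun _ => pairSnd :=
  recognizable_spineLength.left.add (Recognizable.isNil.right.right.mul
    (recognizable_spineLength.left.right.add (Recognizable.const 1)))

theorem recognizable_pairCode : Recognizable fun _ => pairCode :=
  (Recognizable.isNil.right.right.mul ((recognizable_pairSnd.mul recognizable_pairSnd).add
    recognizable_pairFst)).add (Recognizable.isNode.right.right.mul
      (((recognizable_pairFst.mul recognizable_pairFst).add recognizable_pairFst).add
        recognizable_pairSnd))

/-- `Nat.pair` branches on a < b, which is not directly a condition on series, so the tree carries
the answer: `v.right.right = nil` announces a < b. The left subtree gives the minimum and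
`v.right.left` the difference, reduced by one in the strict case; the announcement is therefore
always correct. -/
theorem pairCode_eq (v : BinaryTree Unit) : pairCode v = Nat.pair (pairFst v) (pairSnd v) := by
  by_cases h : v.right.right = nil
  · have : pairFst v < pairSnd v := by
      simp only [pairFst, pairSnd, if_pos h]
      omega
    simp only [pairCode, Nat.pair, if_pos h, if_pos this, one_mul, zero_mul, add_zero]
  · have : ¬ pairFst v < pairSnd v := by
      simp only [pairFst, pairSnd, if_neg h]
      omega
    simp only [pairCode, Nat.pair, if_neg h, if_neg this, one_mul, zero_mul, zero_add]

theorem exists_pair (a b : ℕ) : ∃ v, pairFst v = a ∧ pairSnd v = b := by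
  by_cases h : a < b
  · refine ⟨node () (spine a) (node () (spine (b - a - 1)) nil), ?_⟩
    simp only [pairFst, pairSnd, BinaryTree.left, BinaryTree.right, spineLength_spine, if_true]
    omega
  · refine ⟨node () (spine b) (node () (spine (a - b)) (node () nil nil)), ?_⟩
    simp only [pairFst, pairSnd, BinaryTree.left, BinaryTree.right, spineLength_spine, reduceCtorEq,
      if_false]
    omega

/-! ### Definable relations -/

/-- `R` is the projection of an equational set of trees along two recognizable series. -/
def TreeDefinable (R : ℕ → ℕ → Prop) : Prop :=
  ∃ (x y : BinaryTree Unit → ℕ) (Q : BinaryTree Unit → Prop),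
    Recognizable (fun _ => x) ∧ Recognizable (fun _ => y) ∧ Equational (fun _ => Q) ∧
      ∀ n m, R n m ↔ ∃ v, Q v ∧ x v = n ∧ y v = m

namespace TreeDefinable

variable {R S : ℕ → ℕ → Prop}

theorem of_iff (hR : TreeDefinable R) (h : ∀ n m, R n m ↔ S n m) : TreeDefinable S := by
  have : R = S := by funext n m; exact propext (h n m)
  exact this ▸ hR

theorem top : TreeDefinable fun _ _ => True :=
  ⟨_, _, _, recognizable_spineLength.left, recognizable_spineLength.right, Equational.true,
    fun n m => ⟨fun _ => ⟨node () (spine n) (spine m), trivial, spineLength_spine n,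
      spineLength_spine m⟩, fun _ => trivial⟩⟩

theorem id : TreeDefinable fun n m => m = n :=
  ⟨_, _, _, recognizable_spineLength, recognizable_spineLength, Equational.true,
    fun n m => ⟨fun h => ⟨spine n, trivial, spineLength_spine n, by rw [h, spineLength_spine]⟩,
      fun ⟨v, _, hn, hm⟩ => by rw [← hn, ← hm]⟩⟩

theorem zero : TreeDefinable fun _ m => m = 0 :=
  ⟨_, _, _, recognizable_spineLength, Recognizable.const 0, Equational.true,
    fun n _ => ⟨fun h => ⟨spine n, trivial, spineLength_spine n, h.symm⟩,
      fun ⟨_, _, _, hm⟩ => hm.symm⟩⟩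

theorem succ : TreeDefinable fun n m => m = n + 1 :=
  ⟨_, _, _, recognizable_spineLength, recognizable_spineLength.add (Recognizable.const 1),
    Equational.true,
    fun n m => ⟨fun h => ⟨spine n, trivial, spineLength_spine n, by rw [h, spineLength_spine]⟩,
      fun ⟨v, _, hn, hm⟩ => by rw [← hn, ← hm]⟩⟩

theorem fst : TreeDefinable fun n m => m = n.unpair.1 :=
  ⟨_, _, _, recognizable_pairCode, recognizable_pairFst, Equational.true, fun n m => ⟨fun h => by
      obtain ⟨v, h1, h2⟩ := exists_pair n.unpair.1 n.unpair.2
      exact ⟨v, trivial, by rw [pairCode_eq, h1, h2, Nat.pair_unpair], by rw [h1, h]⟩,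
    fun ⟨v, _, hn, hm⟩ => by simp only [← hn, ← hm, pairCode_eq, Nat.unpair_pair]⟩⟩

theorem snd : TreeDefinable fun n m => m = n.unpair.2 :=
  ⟨_, _, _, recognizable_pairCode, recognizable_pairSnd, Equational.true, fun n m => ⟨fun h => by
      obtain ⟨v, h1, h2⟩ := exists_pair n.unpair.1 n.unpair.2
      exact ⟨v, trivial, by rw [pairCode_eq, h1, h2, Nat.pair_unpair], by rw [h2, h]⟩,
    fun ⟨v, _, hn, hm⟩ => by simp only [← hn, ← hm, pairCode_eq, Nat.unpair_pair]⟩⟩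

theorem converse (hR : TreeDefinable R) : TreeDefinable fun n m => R m n := by
  obtain ⟨x, y, Q, hx, hy, hQ, h⟩ := hR
  refine ⟨y, x, Q, hy, hx, hQ, fun n m => (h m n).trans ?_⟩
  exact exists_congr fun v => and_congr_right fun _ => and_comm

/-- The two witnesses become the principal subtrees of one tree, and agreement of the intermediate
value is one more equation. -/
theorem comp (hR : TreeDefinable R) (hS : TreeDefinable S) :
    TreeDefinable fun n m => ∃ k, R n k ∧ S k m := by
  obtain ⟨x, y, Q, hx, hy, hQ, hR⟩ := hR
  obtain ⟨x', y', Q', hx', hy', hQ', hS⟩ := hS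
  refine ⟨_, _, fun v => (Q v.left ∧ Q' v.right) ∧ y v.left = x' v.right, hx.left, hy'.right,
    (hQ.left.and hQ'.right).and (Equational.eq hy.left hx'.right), fun n m => ⟨?_, ?_⟩⟩
  · rintro ⟨k, h1, h2⟩
    obtain ⟨v, hv, rfl, rfl⟩ := (hR _ _).1 h1
    obtain ⟨v', hv', hk, rfl⟩ := (hS _ _).1 h2
    exact ⟨node () v v', ⟨⟨hv, hv'⟩, hk.symm⟩, rfl, rfl⟩
  · rintro ⟨v, ⟨⟨h1, h2⟩, h3⟩, rfl, rfl⟩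
    exact ⟨_, (hR _ _).2 ⟨_, h1, rfl, rfl⟩, (hS _ _).2 ⟨_, h2, h3.symm, rfl⟩⟩

theorem inter (hR : TreeDefinable R) (hS : TreeDefinable S) :
    TreeDefinable fun n m => R n m ∧ S n m := by
  obtain ⟨x, y, Q, hx, hy, hQ, hR⟩ := hR
  obtain ⟨x', y', Q', hx', hy', hQ', hS⟩ := hS
  refine ⟨_, _, fun v => (Q v.left ∧ Q' v.right) ∧ x v.left = x' v.right ∧ y v.left = y' v.right,
    hx.left, hy.left, (hQ.left.and hQ'.right).and
    ((Equational.eq hx.left hx'.right).and (Equational.eq hy.left hy'.right)), fun n m => ⟨?_, ?_⟩⟩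
  · rintro ⟨h1, h2⟩
    obtain ⟨v, hv, rfl, rfl⟩ := (hR _ _).1 h1
    obtain ⟨v', hv', hk, hk'⟩ := (hS _ _).1 h2
    exact ⟨node () v v', ⟨⟨hv, hv'⟩, hk.symm, hk'.symm⟩, rfl, rfl⟩
  · rintro ⟨v, ⟨⟨h1, h2⟩, h3, h4⟩, rfl, rfl⟩
    exact ⟨(hR _ _).2 ⟨_, h1, rfl, rfl⟩, (hS _ _).2 ⟨_, h2, h3.symm, h4.symm⟩⟩

theorem fork (hR : TreeDefinable R) (hS : TreeDefinable S) :
    TreeDefinable fun n m => R n m.unpair.1 ∧ S n m.unpair.2 := by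
  refine ((hR.comp fst.converse).inter (hS.comp snd.converse)).of_iff fun n m => ?_
  simp

/-! #### Iteration -/

section Star

variable (x y A B : BinaryTree Unit → ℕ)

/-- The first state of a computation coded by the list of trees along the right spine: the last
member of the list is a number, the others are steps. -/
def firstState (v : BinaryTree Unit) : ℕ :=
  (if v.right = nil then 1 else 0) * spineLength v.left +
    (if v.right = nil then 0 else 1) * x v.left

/-- The last state of a computation. -/
def lastState : BinaryTree Unit → ℕ
  | nil => 0
  | node _ w r => (if r = nil then 1 else 0) * spineLength w + lastState r

/-- The left-hand side of the equation that expresses that all steps are correct. -/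
def stepSumLeft : BinaryTree Unit → ℕ
  | nil => 0
  | node _ w r => (if r = nil then 0 else 1) * ((A w * A w + B w * B w) +
      (y w * y w + firstState x r * firstState x r)) + stepSumLeft r

/-- The right-hand side of the equation that expresses that all steps are correct. -/
def stepSumRight : BinaryTree Unit → ℕ
  | nil => 0
  | node _ w r => (if r = nil then 0 else 1) * (2 * (A w * B w) +
      2 * (y w * firstState x r)) + stepSumRight r

variable {x y A B}

theorem recognizable_firstState (hx : Recognizable fun _ => x) :
    Recognizable fun _ => firstState x :=
  (Recognizable.isNil.right.mul recognizable_spineLength.left).add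
    (Recognizable.isNode.right.mul hx.left)

theorem recognizable_lastState : Recognizable fun _ => lastState :=
  Recognizable.spineSum (Recognizable.isNil.right.mul recognizable_spineLength.left)
    (fun _ => rfl) (fun _ _ _ => rfl)

theorem recognizable_stepSumLeft (hx : Recognizable fun _ => x) (hy : Recognizable fun _ => y)
    (hA : Recognizable fun _ => A) (hB : Recognizable fun _ => B) :
    Recognizable fun _ => stepSumLeft x y A B :=
  Recognizable.spineSum (Recognizable.isNode.right.mul
    (((hA.left.mul hA.left).add (hB.left.mul hB.left)).add ((hy.left.mul hy.left).add
      ((recognizable_firstState hx).right.mul (recognizable_firstState hx).right))))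
    (fun _ => rfl) (fun _ _ _ => rfl)

theorem recognizable_stepSumRight (hx : Recognizable fun _ => x) (hy : Recognizable fun _ => y)
    (hA : Recognizable fun _ => A) (hB : Recognizable fun _ => B) :
    Recognizable fun _ => stepSumRight x y A B :=
  Recognizable.spineSum (Recognizable.isNode.right.mul
    (((Recognizable.const 2).mul (hA.left.mul hB.left)).add ((Recognizable.const 2).mul
      (hy.left.mul (recognizable_firstState hx).right))))
    (fun _ => rfl) (fun _ _ _ => rfl)

theorem two_mul_add_le_sq_add_sq (a b c d : ℕ) :
    2 * (a * b) + 2 * (c * d) ≤ (a * a + b * b) + (c * c + d * d) := by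
  zify
  nlinarith [sq_nonneg ((a : ℤ) - b), sq_nonneg ((c : ℤ) - d)]

/-- 2ab ≤ a² + b² holds at every step separately. So equality of the two totals forces equality at
each step: one equation checks unboundedly many local conditions. -/
theorem stepSumRight_le (v : BinaryTree Unit) : stepSumRight x y A B v ≤ stepSumLeft x y A B v := by
  induction v with
  | nil => simp [stepSumRight, stepSumLeft]
  | node _ w r _ ih =>
    simp only [stepSumRight, stepSumLeft]
    exact Nat.add_le_add (Nat.mul_le_mul_left _ (two_mul_add_le_sq_add_sq _ _ _ _)) ih

theorem stepSum_node {w r : BinaryTree Unit} (hr : r ≠ nil) :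
    stepSumLeft x y A B (node () w r) = stepSumRight x y A B (node () w r) ↔
      (A w = B w ∧ y w = firstState x r) ∧ stepSumLeft x y A B r = stepSumRight x y A B r := by
  rw [← sq_add_sq_eq_iff]
  simp only [stepSumLeft, stepSumRight, hr, if_false, one_mul]
  have h1 := two_mul_add_le_sq_add_sq (A w) (B w) (y w) (firstState x r)
  have h2 := stepSumRight_le (x := x) (y := y) (A := A) (B := B) r
  omega

end Star

theorem reflTransGen (hR : TreeDefinable R) : TreeDefinable (Relation.ReflTransGen R) := by
  obtain ⟨x, y, Q, hx, hy, hQ, hR⟩ := hR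
  obtain ⟨A, B, hA, hB, hQ⟩ := hQ.exists_const
  refine ⟨_, _, fun v => stepSumLeft x y A B v = stepSumRight x y A B v,
    recognizable_firstState hx, recognizable_lastState,
    Equational.eq (recognizable_stepSumLeft hx hy hA hB)
      (recognizable_stepSumRight hx hy hA hB), fun n m => ⟨fun h => ?_, ?_⟩⟩
  · suffices ∃ v, v ≠ nil ∧ stepSumLeft x y A B v = stepSumRight x y A B v ∧
        firstState x v = n ∧ lastState v = m by
      obtain ⟨v, _, hv⟩ := this
      exact ⟨v, hv⟩
    induction h using Relation.ReflTransGen.head_induction_on with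
    | refl =>
      refine ⟨node () (spine m) nil, by simp, ?_, ?_, ?_⟩
      · simp [stepSumLeft, stepSumRight]
      · simp [firstState, BinaryTree.left, BinaryTree.right]
      · simp [lastState]
    | head h _ ih =>
      obtain ⟨r, hr, hE, rfl, rfl⟩ := ih
      obtain ⟨w, hw, rfl, hy⟩ := (hR _ _).1 h
      refine ⟨node () w r, by simp, (stepSum_node hr).2 ⟨⟨(hQ w).1 hw, hy⟩, hE⟩, ?_, ?_⟩
      · simp [firstState, BinaryTree.left, BinaryTree.right, hr]
      · simp [lastState, hr]
  · rintro ⟨v, hv, rfl, rfl⟩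
    induction v with
    | nil =>
      -- The empty tree reads as the computation of length zero from 0 to 0, which reflexivity
      -- covers.
      have : firstState x nil = lastState nil := by
        simp [firstState, lastState, BinaryTree.left, BinaryTree.right, spineLength]
      rw [this]
    | node _ w r _ ih =>
      by_cases hr : r = nil
      · subst hr
        simp only [firstState, lastState, BinaryTree.left, BinaryTree.right, if_true, one_mul,
          zero_mul, add_zero]
        exact Relation.ReflTransGen.refl
      · obtain ⟨⟨h1, h2⟩, h3⟩ := (stepSum_node hr).1 hv
        refine Relation.ReflTransGen.head ?_ (by simpa [lastState, hr] using ih h3)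
        exact (hR _ _).2 ⟨w, (hQ w).2 h1, by simp [firstState, BinaryTree.left, BinaryTree.right, hr],
          h2⟩

/-! #### Partial recursive functions -/

theorem primitiveRecursion {f g : ℕ →. ℕ} (hf : TreeDefinable fun n m => m ∈ f n)
    (hg : TreeDefinable fun n m => m ∈ g n) :
    TreeDefinable fun n m => m ∈ (Nat.unpaired fun a n =>
      n.rec (f a) fun y IH => do let i ← IH; g (Nat.pair a (Nat.pair y i)) : ℕ →. ℕ) n := by
  -- A state ⟨a, ⟨y, i⟩⟩ is exactly the argument that `g` expects. A step keeps a, increments y and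
  -- replaces i by a value of `g`; the start is ⟨a, ⟨0, f a⟩⟩.
  have hstep := (fst.fork (((snd.comp fst).comp succ).fork hg)).reflTransGen
  have hinit := fst.fork (zero.fork (fst.comp hf))
  -- The factor `snd.fork top` stops the iteration where the counter equals the second component of
  -- the input.
  refine (((hinit.comp hstep).comp snd).inter (snd.fork top) |>.comp snd).of_iff fun n m => ?_
  simp only [exists_eq_left, Nat.unpaired, and_true]
  obtain ⟨a, k, rfl⟩ : ∃ a k, Nat.pair a k = n := ⟨_, _, Nat.pair_unpair n⟩
  simp only [Nat.unpair_pair]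
  constructor
  · rintro ⟨p, ⟨⟨s, ⟨s₀, ⟨h1, h2, h3⟩, hs⟩, rfl⟩, rfl⟩, rfl⟩
    suffices h : s.unpair.1 = a ∧ s.unpair.2.unpair.2 ∈ (s.unpair.2.unpair.1.rec (f a)
        fun y IH => do let i ← IH; g (Nat.pair a (Nat.pair y i)) : Part ℕ) from h.2
    induction hs with
    | refl => exact ⟨h1, by rw [h2]; exact h3⟩
    | @tail s s' _ h ih =>
      obtain ⟨h4, h5, h6⟩ := h
      refine ⟨h4.trans ih.1, ?_⟩
      rw [h5]
      refine Part.mem_bind_iff.2 ⟨_, ih.2, ?_⟩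
      rwa [Nat.pair_unpair, ← ih.1, Nat.pair_unpair]
  · intro hm
    suffices h : ∃ s₀ : ℕ, (s₀.unpair.1 = a ∧ s₀.unpair.2.unpair.1 = 0 ∧
        s₀.unpair.2.unpair.2 ∈ f a) ∧ Relation.ReflTransGen (fun n m : ℕ =>
          m.unpair.1 = n.unpair.1 ∧ m.unpair.2.unpair.1 = n.unpair.2.unpair.1 + 1 ∧
            m.unpair.2.unpair.2 ∈ g n) s₀ (Nat.pair a (Nat.pair k m)) by
      obtain ⟨s₀, h0, hs⟩ := h
      exact ⟨Nat.pair k m, ⟨⟨_, ⟨s₀, h0, hs⟩, by simp⟩, by simp⟩, by simp⟩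
    induction k generalizing m with
    | zero => exact ⟨Nat.pair a (Nat.pair 0 m), by simpa using hm, Relation.ReflTransGen.refl⟩
    | succ k ih =>
      obtain ⟨i, hi, hg'⟩ := Part.mem_bind_iff.1 hm
      obtain ⟨s₀, h0, hs⟩ := ih i hi
      exact ⟨s₀, h0, hs.tail (by simpa using hg')⟩

theorem rfind {f : ℕ →. ℕ} (hf : TreeDefinable fun n m => m ∈ f n) :
    TreeDefinable fun n m => m ∈ Nat.rfind fun k => (fun m => decide (m = 0)) <$> f (Nat.pair n k) := by
  -- The search moves from ⟨n, k⟩ to ⟨n, k + 1⟩ only if `f` has a successor as its value at ⟨n, k⟩.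
  -- It may end only where that value is 0.
  have hstep := ((fst.fork (snd.comp succ)).inter
    ((hf.comp succ.converse).comp top)).reflTransGen
  refine ((((id.fork zero).comp hstep).comp (id.inter ((hf.comp zero.converse).comp top))).comp
    snd).of_iff fun n m => ?_
  simp only [and_true, exists_eq_left]
  refine Iff.trans ?_ Nat.mem_rfind.symm
  constructor
  · rintro ⟨s, ⟨s', ⟨s₀, ⟨h1, h2⟩, hs⟩, rfl, ⟨_, ⟨_, hz, rfl⟩⟩⟩, rfl⟩
    have h : s.unpair.1 = n ∧ ∀ i < s.unpair.2, ∃ y, y + 1 ∈ f (Nat.pair n i) := by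
      clear hz
      induction hs with
      | refl => exact ⟨h1, by simp [h2]⟩
      | @tail s s' _ h ih =>
        obtain ⟨⟨h4, h5⟩, y, y', h6, rfl⟩ := h
        refine ⟨h4.trans ih.1, fun i hi => ?_⟩
        rw [h5, Nat.lt_succ_iff_lt_or_eq] at hi
        rcases hi with hi | rfl
        · exact ih.2 i hi
        · exact ⟨y, by rwa [← ih.1, Nat.pair_unpair]⟩
    refine ⟨?_, fun {i} hi => ?_⟩
    · refine (Part.mem_map_iff _).2 ⟨0, ?_, rfl⟩
      rwa [← h.1, Nat.pair_unpair]
    · obtain ⟨y, hy⟩ := h.2 i hi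
      exact (Part.mem_map_iff _).2 ⟨_, hy, rfl⟩
  · rintro ⟨h0, hlt⟩
    have hs : ∀ k ≤ m, Relation.ReflTransGen (fun n m : ℕ =>
        (m.unpair.1 = n.unpair.1 ∧ m.unpair.2 = n.unpair.2 + 1) ∧
          ∃ k, ∃ k_1, k_1 ∈ f n ∧ k_1 = k + 1) (Nat.pair n 0) (Nat.pair n k) := by
      intro k
      induction k with
      | zero => exact fun _ => Relation.ReflTransGen.refl
      | succ k ih =>
        intro hk
        refine (ih (Nat.le_of_succ_le hk)).tail ⟨by simp, ?_⟩
        obtain ⟨y, hy, hy'⟩ := (Part.mem_map_iff _).1 (hlt hk)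
        cases y with
        | zero => simp at hy'
        | succ y => exact ⟨y, _, hy, rfl⟩
    obtain ⟨y, hy, hy'⟩ := (Part.mem_map_iff _).1 h0
    obtain rfl : y = 0 := by simpa using hy'
    exact ⟨Nat.pair n m, ⟨_, ⟨Nat.pair n 0, by simp, hs m le_rfl⟩, rfl, 0, 0, hy, rfl⟩, by simp⟩

theorem of_partrec {f : ℕ →. ℕ} (hf : Nat.Partrec f) : TreeDefinable fun n m => m ∈ f n := by
  induction hf with
  | zero => exact zero.of_iff fun n m => by simp [pure, PFun.pure]
  | succ => exact succ.of_iff fun n m => by simp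
  | left => exact fst.of_iff fun n m => by simp
  | right => exact snd.of_iff fun n m => by simp
  | pair _ _ hf hg =>
    refine (hf.fork hg).of_iff fun n m => ?_
    simp only [Seq.seq, Part.mem_bind_iff, Part.map_eq_map, Part.mem_map_iff]
    constructor
    · rintro ⟨h1, h2⟩
      exact ⟨_, ⟨_, h1, rfl⟩, _, h2, Nat.pair_unpair m⟩
    · rintro ⟨_, ⟨a, h1, rfl⟩, b, h2, rfl⟩
      simpa using ⟨h1, h2⟩
  | comp _ _ hf hg => exact (hg.comp hf).of_iff fun n m => Part.mem_bind_iff.symm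
  | prec _ _ hf hg => exact primitiveRecursion hf hg
  | rfind _ hf => exact rfind hf

end TreeDefinable

end TreeAutomatic

/-! ### `Σ⁰₂` sets of trees in terms of the halting of a partial recursive function -/

namespace TreeAutomatic

open BinaryTree Nat.Partrec

/-- The inverse of `treeCode`. -/
def codeTree : ℕ → BinaryTree Unit
  | 0 => nil
  | n + 1 =>
    have : n.unpair.1 < n + 1 := Nat.lt_succ_of_le (Nat.unpair_left_le n)
    have : n.unpair.2 < n + 1 := Nat.lt_succ_of_le (Nat.unpair_right_le n)
    node () (codeTree n.unpair.1) (codeTree n.unpair.2)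

theorem codeTree_treeCode (t : BinaryTree Unit) : codeTree (treeCode t) = t := by
  induction t with
  | nil => simp [treeCode, codeTree]
  | node _ l r hl hr => simp [treeCode, codeTree, hl, hr]

theorem treeCode_codeTree (n : ℕ) : treeCode (codeTree n) = n := by
  induction n using Nat.strong_induction_on with
  | _ n ih =>
    cases n with
    | zero => simp [treeCode, codeTree]
    | succ n =>
      rw [codeTree, treeCode, ih _ (Nat.lt_succ_of_le (Nat.unpair_left_le n)),
        ih _ (Nat.lt_succ_of_le (Nat.unpair_right_le n)), Nat.pair_unpair]

theorem treeCode_injective : Function.Injective treeCode :=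
  Function.LeftInverse.injective codeTree_treeCode

/-- The hash of a node uses the base of its right subtree, so the course-of-values recursion carries
both numbers. -/
theorem primrec_treeHash_codeTree : Primrec fun n => treeHash (codeTree n) := by
  have h : Primrec₂ fun (_ : Unit) (n : ℕ) => (treeHash (codeTree n), treeBase (codeTree n)) := by
    refine Primrec.nat_strong_rec _ (g := fun _ L => Nat.casesOn L.length (some (0, 1)) fun n =>
      L[n.unpair.1]?.bind fun x => L[n.unpair.2]?.map fun y =>
        (4 * x.2 * y.2 + 2 * x.1 * y.2 + y.1, 4 * x.2 * y.2)) ?_ ?_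
    · have hx : Primrec fun p : (((Unit × List (ℕ × ℕ)) × ℕ) × ℕ × ℕ) × ℕ × ℕ => p.1.2 :=
        Primrec.snd.comp Primrec.fst
      have hy : Primrec fun p : (((Unit × List (ℕ × ℕ)) × ℕ) × ℕ × ℕ) × ℕ × ℕ => p.2 :=
        Primrec.snd
      have hm : Primrec fun p : (((Unit × List (ℕ × ℕ)) × ℕ) × ℕ × ℕ) × ℕ × ℕ =>
          4 * p.1.2.2 * p.2.2 :=
        Primrec.nat_mul.comp (Primrec.nat_mul.comp (Primrec.const 4) (Primrec.snd.comp hx))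
          (Primrec.snd.comp hy)
      have hn : Primrec fun p : (((Unit × List (ℕ × ℕ)) × ℕ) × ℕ × ℕ) × ℕ × ℕ =>
          2 * p.1.2.1 * p.2.2 :=
        Primrec.nat_mul.comp (Primrec.nat_mul.comp (Primrec.const 2) (Primrec.fst.comp hx))
          (Primrec.snd.comp hy)
      refine Primrec.nat_casesOn (Primrec.list_length.comp Primrec.snd) (Primrec.const _) ?_
      refine Primrec.option_bind (Primrec.list_getElem?.comp (Primrec.snd.comp Primrec.fst)
        (Primrec.fst.comp (Primrec.unpair.comp Primrec.snd))) ?_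
      refine Primrec.option_map (Primrec.list_getElem?.comp
        (Primrec.snd.comp (Primrec.fst.comp Primrec.fst))
        (Primrec.snd.comp (Primrec.unpair.comp (Primrec.snd.comp Primrec.fst)))) ?_
      exact (Primrec.nat_add.comp (Primrec.nat_add.comp hm hn) (Primrec.fst.comp hy)).pair hm
    · intro _ n
      cases n with
      | zero => simp [codeTree, treeHash, treeBase]
      | succ n =>
        have h1 : n.unpair.1 < n + 1 := Nat.lt_succ_of_le (Nat.unpair_left_le n)
        have h2 : n.unpair.2 < n + 1 := Nat.lt_succ_of_le (Nat.unpair_right_le n)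
        simp [h1, h2, codeTree, treeHash, treeBase]
  exact Primrec.fst.comp (h.comp (Primrec.const ()) Primrec.id)

/-! ### Stagewise approximation of `∅'`. -/

/-- The elements of `∅'` that are enumerated within `r` steps. -/
def jumpStage (r i : ℕ) : Prop :=
  ∃ k ∈ List.range r, (Code.evaln r (Denumerable.ofNat Code i)
    (Encodable.encode (i, (List.range k).map fun _ => false))).isSome

theorem jumpStage_mono {r s i : ℕ} (h : r ≤ s) (hr : jumpStage r i) : jumpStage s i := by
  obtain ⟨k, hk, hx⟩ := hr
  obtain ⟨x, hx⟩ := Option.isSome_iff_exists.1 hx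
  exact ⟨k, List.mem_range.2 ((List.mem_range.1 hk).trans_le h),
    Option.isSome_iff_exists.2 ⟨x, Code.evaln_mono h hx⟩⟩

theorem isInitialSegment_empty_iff (σ : List Bool) :
    IsInitialSegment σ ∅ ↔ σ = (List.range σ.length).map fun _ => false := by
  constructor
  · intro h
    refine List.ext_getElem (by simp) fun i h1 h2 => ?_
    simpa using h i h1
  · intro h i hi
    rw [List.getElem_of_eq h]
    simp

theorem mem_jump_empty_iff (i : ℕ) : i ∈ jump ∅ ↔ ∃ r, jumpStage r i := by
  constructor
  · rintro ⟨σ, hσ, hd⟩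
    rw [isInitialSegment_empty_iff] at hσ
    obtain ⟨x, hx⟩ := Part.dom_iff_mem.1 hd
    obtain ⟨k, hk⟩ := Code.evaln_complete.1 hx
    refine ⟨max k (σ.length + 1), σ.length, List.mem_range.2 (by omega), ?_⟩
    rw [← hσ]
    exact Option.isSome_iff_exists.2 ⟨x, Code.evaln_mono (le_max_left _ _) hk⟩
  · rintro ⟨r, k, _, hx⟩
    obtain ⟨x, hx⟩ := Option.isSome_iff_exists.1 hx
    refine ⟨(List.range k).map fun _ => false, ?_, Part.dom_iff_mem.2 ⟨x, Code.evaln_sound hx⟩⟩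
    rw [isInitialSegment_empty_iff]
    simp

theorem primrecRel_jumpStage : PrimrecRel jumpStage := by
  have hR : PrimrecRel fun (k : ℕ) (p : ℕ × ℕ) => ((Code.evaln p.1 (Denumerable.ofNat Code p.2)
      (Encodable.encode (p.2, (List.range k).map fun _ => false))).isSome = true) := by
    refine Primrec.eq.comp (Primrec.option_isSome.comp (Code.primrec_evaln.comp
      (((Primrec.fst.comp Primrec.snd).pair ((Primrec.ofNat Code).comp
        (Primrec.snd.comp Primrec.snd))).pair (Primrec.encode.comp
          ((Primrec.snd.comp Primrec.snd).pair (Primrec.list_map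
            (Primrec.list_range.comp Primrec.fst) (Primrec.const false).to₂))))))
      (Primrec.const true)
  exact hR.exists_mem_list.comp (Primrec.list_range.comp Primrec.fst) Primrec.id

open Classical in
/-- The approximation to the initial segment of `∅'` of length `n` after `r` steps. -/
noncomputable def jumpApprox (r n : ℕ) : List Bool :=
  (List.range n).map fun i => decide (jumpStage r i)

theorem primrec_jumpApprox : Primrec₂ jumpApprox := by
  classical
  exact Primrec.list_map (Primrec.list_range.comp Primrec.snd)
    (primrecRel_jumpStage.decide.comp (Primrec.fst.comp Primrec.fst) Primrec.snd)

/-- The computation with index `e` on input `n` with oracle `σ` halts within `r` steps, and `σ` is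
the approximation to `∅'` after `r` steps. -/
def ConvergesAt (e n : ℕ) (σ : List Bool) (r : ℕ) : Prop :=
  jumpApprox r σ.length = σ ∧
    (Code.evaln r (Denumerable.ofNat Code e) (Encodable.encode (n, σ))).isSome = true

theorem isInitialSegment_of_jumpApprox {σ : List Bool} {s : ℕ}
    (h : ∀ r, jumpApprox (s + r) σ.length = σ) : IsInitialSegment σ (jump ∅) := by
  intro i hi
  rw [mem_jump_empty_iff]
  have h' : ∀ r, σ[i] = true ↔ jumpStage (s + r) i := by
    intro r
    rw [← List.getElem_of_eq (h r) (by simpa [jumpApprox] using hi)]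
    simp [jumpApprox]
  constructor
  · exact fun hσ => ⟨_, (h' 0).1 hσ⟩
  · rintro ⟨r, hr⟩
    exact (h' r).2 (jumpStage_mono (Nat.le_add_left _ _) hr)

theorem exists_jumpApprox {σ : List Bool} (h : IsInitialSegment σ (jump ∅)) :
    ∃ s, ∀ r ≥ s, jumpApprox r σ.length = σ := by
  have h1 : ∀ i : ℕ, ∃ s, ∀ hi : i < σ.length, σ[i] = true → jumpStage s i := by
    intro i
    by_cases hi : i < σ.length ∧ i ∈ jump ∅
    · obtain ⟨s, hs⟩ := (mem_jump_empty_iff i).1 hi.2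
      exact ⟨s, fun _ _ => hs⟩
    · exact ⟨0, fun h1 h2 => absurd ⟨h1, (h i h1).1 h2⟩ hi⟩
  choose s hs using h1
  refine ⟨(Finset.range σ.length).sup s, fun r hr => ?_⟩
  refine List.ext_getElem (by simp [jumpApprox]) fun i h1 h2 => ?_
  rw [Bool.eq_iff_iff]
  simp only [jumpApprox, List.getElem_map, List.getElem_range, decide_eq_true_eq]
  constructor
  · intro hi
    exact (h i h2).2 ((mem_jump_empty_iff i).2 ⟨r, hi⟩)
  · intro hi
    exact jumpStage_mono ((Finset.le_sup (Finset.mem_range.2 h2)).trans hr) (hs i h2 hi)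

/-- The stages increase to `∅'`, so a string is a true initial segment iff the approximations of its
length eventually equal it. A halting computation with such an oracle string becomes an ∃∀ statement
over a decidable matrix. -/
theorem mem_sigmaTwo_iff (e n : ℕ) :
    n ∈ sigmaTwo e ↔ ∃ σ s, ∀ r, ConvergesAt e n σ (s + r) := by
  constructor
  · rintro ⟨σ, hσ, hd⟩
    obtain ⟨x, hx⟩ := Part.dom_iff_mem.1 hd
    obtain ⟨k, hk⟩ := Code.evaln_complete.1 hx
    obtain ⟨s, hs⟩ := exists_jumpApprox hσ
    refine ⟨σ, max k s, fun r => ⟨hs _ (by omega), ?_⟩⟩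
    exact Option.isSome_iff_exists.2 ⟨x, Code.evaln_mono (by omega) hk⟩
  · rintro ⟨σ, s, h⟩
    refine ⟨σ, isInitialSegment_of_jumpApprox fun r => (h r).1, ?_⟩
    obtain ⟨x, hx⟩ := Option.isSome_iff_exists.1 (h 0).2
    exact Part.dom_iff_mem.2 ⟨x, Code.evaln_sound hx⟩

/-! ### Membership as divergence of a partial recursive function. -/

/-- The initial segment and the time coded by a number. -/
def decodeOracle (ξ : ℕ) : List Bool × ℕ := (Encodable.decode ξ).getD ([], 0)

theorem primrec_decodeOracle : Primrec decodeOracle :=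
  Primrec.option_getD.comp Primrec.decode (Primrec.const _)

/-- `Refutes e h ξ k`: the number `k` codes a tree with hash value `h` and a time that show that
`ξ` does not witness membership in the `e`-th `Σ⁰₂` set. -/
def Refutes (e h ξ k : ℕ) : Prop :=
  treeHash (codeTree k.unpair.1) = h ∧
    ¬ ConvergesAt e (Nat.pair k.unpair.1 0 + 1) (decodeOracle ξ).1
      ((decodeOracle ξ).2 + k.unpair.2)

theorem primrecRel_refutes :
    PrimrecRel fun n k : ℕ => Refutes n.unpair.1 n.unpair.2.unpair.1 n.unpair.2.unpair.2 k := by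
  have hn : Primrec fun p : ℕ × ℕ => p.1.unpair := Primrec.unpair.comp Primrec.fst
  have hn2 : Primrec fun p : ℕ × ℕ => p.1.unpair.2.unpair :=
    Primrec.unpair.comp (Primrec.snd.comp hn)
  have hk : Primrec fun p : ℕ × ℕ => p.2.unpair := Primrec.unpair.comp Primrec.snd
  have hξ : Primrec fun p : ℕ × ℕ => decodeOracle p.1.unpair.2.unpair.2 :=
    primrec_decodeOracle.comp (Primrec.snd.comp hn2)
  have hr : Primrec fun p : ℕ × ℕ =>
      (decodeOracle p.1.unpair.2.unpair.2).2 + p.2.unpair.2 :=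
    Primrec.nat_add.comp (Primrec.snd.comp hξ) (Primrec.snd.comp hk)
  refine PrimrecPred.and (Primrec.eq.comp (primrec_treeHash_codeTree.comp (Primrec.fst.comp hk))
    (Primrec.fst.comp hn2)) (PrimrecPred.not (PrimrecPred.and ?_ ?_))
  · exact Primrec.eq.comp (primrec_jumpApprox.comp hr (Primrec.list_length.comp
      (Primrec.fst.comp hξ))) (Primrec.fst.comp hξ)
  · exact Primrec.eq.comp (Primrec.option_isSome.comp (Code.primrec_evaln.comp
      ((hr.pair ((Primrec.ofNat Code).comp (Primrec.fst.comp hn))).pair (Primrec.encode.comp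
        ((Primrec.succ.comp (Primrec₂.natPair.comp (Primrec.fst.comp hk) (Primrec.const 0))).pair
          (Primrec.fst.comp hξ)))))) (Primrec.const true)

/-- Membership in a `Σ⁰₂` set amounts to the existence of a number on which a fixed partial
recursive function diverges. -/
theorem exists_partrec_sigmaTwo : ∃ ψ : ℕ →. ℕ, Nat.Partrec ψ ∧ ∀ e u,
    treeCode (node () u nil) ∈ sigmaTwo e ↔
      ∃ ξ, ¬ (ψ (Nat.pair e (Nat.pair (treeHash u) ξ))).Dom := by
  classical
  refine ⟨fun n => Nat.rfind fun k =>
    (Part.some (decide (Refutes n.unpair.1 n.unpair.2.unpair.1 n.unpair.2.unpair.2 k)) : Part Bool),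
    ?_, ?_⟩
  · refine Partrec.nat_iff.1 ?_
    exact Partrec.rfind primrecRel_refutes.decide.to_comp.partrec
  · intro e u
    have hdom : ∀ ξ, (Nat.rfind fun k => Part.some (decide (Refutes
        (Nat.pair e (Nat.pair (treeHash u) ξ)).unpair.1
        (Nat.pair e (Nat.pair (treeHash u) ξ)).unpair.2.unpair.1
        (Nat.pair e (Nat.pair (treeHash u) ξ)).unpair.2.unpair.2 k))).Dom ↔
          ∃ k, Refutes e (treeHash u) ξ k := by
      intro ξ
      refine Nat.rfind_dom.trans ?_
      simp
    simp only [hdom]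
    rw [mem_sigmaTwo_iff]
    -- The search receives only the hash of u, since a series has to supply that argument.
    -- Injectivity of the hash ensures that the tree it finds is u itself.
    have hcode : ∀ c, treeHash (codeTree c) = treeHash u → c = treeCode u := by
      intro c hc
      rw [← treeHash_injective hc, treeCode_codeTree]
    constructor
    · rintro ⟨σ, s, h⟩
      refine ⟨Encodable.encode (σ, s), ?_⟩
      rintro ⟨k, hk, hk'⟩
      rw [hcode _ hk, decodeOracle, Encodable.encodek, Option.getD_some] at hk'
      exact hk' (h _)
    · rintro ⟨ξ, hξ⟩
      refine ⟨(decodeOracle ξ).1, (decodeOracle ξ).2, fun r => ?_⟩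
      by_contra hcon
      refine hξ ⟨Nat.pair (treeCode u) r, ?_, ?_⟩
      · simp [codeTree_treeCode]
      · simpa [treeCode] using hcon

end TreeAutomatic

/-! ### The series that counts the leaves below a node -/

namespace TreeAutomatic

open BinaryTree

/-- A quadratic injective pairing function. -/
def quadPair (a b : ℕ) : ℕ := (a + b) * (a + b) + 3 * a + b

/-- With s = a + b the value is s² + s + 2a, which lies between s² + s and s² + 3s; these intervals
are disjoint for different s. Unlike `Nat.pair`, the function is one polynomial, so series can be
substituted into it. -/
theorem quadPair_injective {a b a' b' : ℕ} (h : quadPair a b = quadPair a' b') :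
    a = a' ∧ b = b' := by
  simp only [quadPair] at h
  have h1 : ¬ a + b < a' + b' := by
    intro hlt
    nlinarith [Nat.mul_le_mul (Nat.succ_le_of_lt hlt) (Nat.succ_le_of_lt hlt)]
  have h2 : ¬ a' + b' < a + b := by
    intro hlt
    nlinarith [Nat.mul_le_mul (Nat.succ_le_of_lt hlt) (Nat.succ_le_of_lt hlt)]
  have h3 : a + b = a' + b' := by omega
  rw [h3] at h
  omega

/-- The numbers of leaves that occur: all codes of pairs of different numbers, and the codes of the
pairs `(a, a)` with `a` at least the threshold. -/
def countSet (μ : Option ℕ) : Set ℕ :=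
  {n | ∃ a b, n = quadPair a b + 1 ∧ (a ≠ b ∨ ∃ k ∈ μ, k ≤ a)}

instance : Infinite (BinaryTree Unit) :=
  Infinite.of_injective spine (Function.LeftInverse.injective spineLength_spine)

/-- The arguments are needed as three separate series, so the witness also contains two coded pairs
that unpack the input of ψ. -/
theorem exists_series_of_partrec {ψ : ℕ →. ℕ} (hψ : Nat.Partrec ψ) :
    ∃ A B p q r : BinaryTree Unit → ℕ, Recognizable (fun _ => A) ∧ Recognizable (fun _ => B) ∧
      Recognizable (fun _ => p) ∧ Recognizable (fun _ => q) ∧ Recognizable (fun _ => r) ∧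
      ∀ a b c, (ψ (Nat.pair a (Nat.pair b c))).Dom ↔
        ∃ v, A v = B v ∧ p v = a ∧ q v = b ∧ r v = c := by
  obtain ⟨x, y, Q, hx, hy, hQ, hR⟩ := TreeDefinable.of_partrec hψ
  have hE : Equational fun _ v => Q v.left ∧ x v.left = pairCode v.right.left ∧
      pairSnd v.right.left = pairCode v.right.right :=
    hQ.left.and ((Equational.eq hx.left recognizable_pairCode.left.right).and
      (Equational.eq recognizable_pairSnd.left.right recognizable_pairCode.right.right))
  obtain ⟨A, B, hA, hB, hAB⟩ := hE.exists_const
  refine ⟨A, B, _, _, _, hA, hB, recognizable_pairFst.left.right, recognizable_pairFst.right.right,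
    recognizable_pairSnd.right.right, fun a b c => ?_⟩
  simp only [← hAB]
  rw [Part.dom_iff_mem]
  constructor
  · rintro ⟨m, hm⟩
    obtain ⟨v, hv, hx, -⟩ := (hR _ _).1 hm
    obtain ⟨v₁, h1, h2⟩ := exists_pair a (Nat.pair b c)
    obtain ⟨v₂, h3, h4⟩ := exists_pair b c
    refine ⟨node () v (node () v₁ v₂), ⟨hv, ?_, ?_⟩, h1, h3, h4⟩
    · exact hx.trans (by rw [BinaryTree.right, BinaryTree.left, pairCode_eq, h1, h2])
    · exact h2.trans (by rw [BinaryTree.right, BinaryTree.right, pairCode_eq, h3, h4])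
  · rintro ⟨v, ⟨hv, h1, h2⟩, rfl, rfl, rfl⟩
    refine ⟨_, (hR _ _).2 ⟨_, hv, ?_, rfl⟩⟩
    rw [h1, pairCode_eq, h2, pairCode_eq]

/-! ### Leaf counts and thresholds attached to an equation. -/

section Count

variable (A B p q r : BinaryTree Unit → ℕ)

/-- The left-hand side of the equation that expresses that `v` is a witness for `(e, h, ξ)`. -/
def witnessLeft (e h ξ : ℕ) (v : BinaryTree Unit) : ℕ :=
  ((A v * A v + B v * B v) + (p v * p v + e * e)) + ((q v * q v + h * h) + (r v * r v + ξ * ξ))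

/-- The right-hand side of the equation that expresses that `v` is a witness for `(e, h, ξ)`. -/
def witnessRight (e h ξ : ℕ) (v : BinaryTree Unit) : ℕ :=
  (2 * (A v * B v) + 2 * (p v * e)) + (2 * (q v * h) + 2 * (r v * ξ))

theorem witness_eq_iff {e h ξ : ℕ} {v : BinaryTree Unit} :
    witnessLeft A B p q r e h ξ v = witnessRight A B p q r e h ξ v ↔
      A v = B v ∧ p v = e ∧ q v = h ∧ r v = ξ := by
  have h1 := TreeDefinable.two_mul_add_le_sq_add_sq (A v) (B v) (p v) e
  have h2 := TreeDefinable.two_mul_add_le_sq_add_sq (q v) h (r v) ξ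
  rw [← and_assoc, ← sq_add_sq_eq_iff, ← sq_add_sq_eq_iff, witnessLeft, witnessRight]
  omega

/-- The value `F` if the first tree is empty, and `G` otherwise. -/
def select (s : BinaryTree Unit) (m n : ℕ) : ℕ :=
  (if s = nil then 1 else 0) * m + (if s = nil then 0 else 1) * n

@[simp] theorem select_nil (m n : ℕ) : select nil m n = m := by simp [select]

@[simp] theorem select_node (l s : BinaryTree Unit) (m n : ℕ) : select (node () l s) m n = n := by
  simp [select]

/-- The equation attached to `x` and a potential witness: trivial if the left subtree of `x` is
empty, and the equation for the number coded by `x` otherwise. -/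
def sideLeft (e : ℕ) (u x v : BinaryTree Unit) : ℕ :=
  select x.left (spineLength x.right.left)
    (witnessLeft A B p q r e (treeHash u) (spineLength x.right.left) v)

/-- The right-hand side that belongs to `sideLeft`. -/
def sideRight (e : ℕ) (u x v : BinaryTree Unit) : ℕ :=
  select x.left (spineLength x.right.left)
    (witnessRight A B p q r e (treeHash u) (spineLength x.right.left) v)

/-- The first component of the pair attached to the tree `w`. -/
def countFst (e : ℕ) (u x w : BinaryTree Unit) : ℕ :=
  select w.left (spineLength w.right.left + spineLength w.right.right.left + 1)
    (select w.left.left (spineLength w.right.left)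
      (spineLength w.right.left + sideLeft A B p q r e u x w.right.right.left))

/-- The second component of the pair attached to the tree `w`. -/
def countSnd (e : ℕ) (u x w : BinaryTree Unit) : ℕ :=
  select w.left (spineLength w.right.left)
    (select w.left.left (spineLength w.right.left + spineLength w.right.right.left + 1)
      (spineLength w.right.left + sideRight A B p q r e u x w.right.right.left))

/-- The number of leaves below the node given by `u`, `x` and `w`. -/
def leafCount (e : ℕ) (u x w : BinaryTree Unit) : ℕ :=
  quadPair (countFst A B p q r e u x w) (countSnd A B p q r e u x w) + 1

/-- The least value of the two sides of a solvable equation attached to `x`. -/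
noncomputable def threshold (e : ℕ) (u x : BinaryTree Unit) : Option ℕ :=
  open Classical in
  if h : ∃ k v, sideLeft A B p q r e u x v = k ∧ sideRight A B p q r e u x v = k then
    some (Nat.find h) else none

variable {A B p q r}

theorem threshold_le_iff {e a : ℕ} {u x : BinaryTree Unit} :
    (∃ k ∈ threshold A B p q r e u x, k ≤ a) ↔
      ∃ v, sideLeft A B p q r e u x v = sideRight A B p q r e u x v ∧
        sideLeft A B p q r e u x v ≤ a := by
  classical
  unfold threshold
  split_ifs with h
  · simp only [Option.mem_def, Option.some.injEq, exists_eq_left']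
    constructor
    · intro hle
      obtain ⟨v, h1, h2⟩ := Nat.find_spec h
      exact ⟨v, h1.trans h2.symm, h1.trans_le hle⟩
    · rintro ⟨v, h1, h2⟩
      exact (Nat.find_min' h ⟨v, rfl, h1.symm⟩).trans h2
  · simp only [Option.mem_def, reduceCtorEq, false_and, exists_false, false_iff, not_exists]
    rintro v ⟨h1, h2⟩
    exact h ⟨_, v, rfl, h1.symm⟩

theorem threshold_eq_none_iff {e : ℕ} {u x : BinaryTree Unit} :
    threshold A B p q r e u x = none ↔
      ∀ v, sideLeft A B p q r e u x v ≠ sideRight A B p q r e u x v := by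
  unfold threshold
  split_ifs with h
  · obtain ⟨k, v, h1, h2⟩ := h
    simpa using ⟨v, h1.trans h2.symm⟩
  · simp only [true_iff]
    exact fun v hv => h ⟨_, v, rfl, hv.symm⟩

/-- These are the dummy trees: both sides are the constant k, whatever u is. They make all finite
thresholds occur, so that only `none` can depend on u. -/
theorem threshold_of_left_nil (e k : ℕ) (u j : BinaryTree Unit) :
    threshold A B p q r e u (node () nil (node () (spine k) j)) = some k := by
  classical
  unfold threshold
  have hs : ∀ v, sideLeft A B p q r e u (node () nil (node () (spine k) j)) v = k := fun v => by
    simp [sideLeft, BinaryTree.left, BinaryTree.right]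
  have hs' : ∀ v, sideRight A B p q r e u (node () nil (node () (spine k) j)) v = k := fun v => by
    simp [sideRight, BinaryTree.left, BinaryTree.right]
  have h : ∃ k' v, sideLeft A B p q r e u (node () nil (node () (spine k) j)) v = k' ∧
      sideRight A B p q r e u (node () nil (node () (spine k) j)) v = k' := ⟨k, nil, hs nil, hs' nil⟩
  rw [dif_pos h, Option.some.injEq]
  obtain ⟨v, hv, -⟩ := Nat.find_spec h
  exact hv.symm.trans (hs v)

theorem infinite_threshold_eq_some (e k : ℕ) (u : BinaryTree Unit) :
    {x | threshold A B p q r e u x = some k}.Infinite :=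
  Set.infinite_of_injective_forall_mem
    (f := fun j : BinaryTree Unit => node () nil (node () (spine k) j))
    -- The subtree j is read by neither side and only supplies infinitely many copies.
    (fun _ _ h => by simpa using h) fun j => threshold_of_left_nil e k u j

theorem threshold_of_left_node {e : ℕ} {u x : BinaryTree Unit} (hx : x.left ≠ nil) :
    threshold A B p q r e u x = none ↔ ¬ ∃ v, A v = B v ∧ p v = e ∧ q v = treeHash u ∧
      r v = spineLength x.right.left := by
  rw [threshold_eq_none_iff, not_exists]
  refine forall_congr' fun v => not_congr ?_
  rw [← witness_eq_iff]
  simp only [sideLeft, sideRight, select, if_neg hx, zero_mul, zero_add, one_mul]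

theorem infinite_threshold_eq_none {e : ℕ} {u : BinaryTree Unit} {ξ : ℕ}
    (h : ¬ ∃ v, A v = B v ∧ p v = e ∧ q v = treeHash u ∧ r v = ξ) :
    {x | threshold A B p q r e u x = none}.Infinite := by
  refine Set.infinite_of_injective_forall_mem
    (f := fun j : BinaryTree Unit => node () (node () nil nil) (node () (spine ξ) j))
    (fun _ _ h => by simpa using h) fun j => ?_
  refine (threshold_of_left_node (by simp [BinaryTree.left])).2 ?_
  simpa [BinaryTree.left, BinaryTree.right] using h

theorem threshold_ne_none {e : ℕ} {u x : BinaryTree Unit}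
    (h : ∀ ξ, ∃ v, A v = B v ∧ p v = e ∧ q v = treeHash u ∧ r v = ξ) :
    threshold A B p q r e u x ≠ none := by
  by_cases hx : x.left = nil
  · rw [Ne, threshold_eq_none_iff, not_forall]
    refine ⟨nil, not_not.2 ?_⟩
    simp only [sideLeft, sideRight, select, if_pos hx, zero_mul]
  · rw [Ne, threshold_of_left_node hx, not_not]
    exact h _

/-- The shape of `w.left` selects a pair with first component larger, a pair with second component
larger, or both sides of the equation shifted by a common number. In the last case a non-solution
gives an off-diagonal pair, which occurs anyway, and a solution gives a diagonal one at or above the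
threshold. So the trees v leave no trace beyond the threshold. -/
theorem leafCount_mem (e : ℕ) (u x w : BinaryTree Unit) :
    leafCount A B p q r e u x w ∈ countSet (threshold A B p q r e u x) := by
  refine ⟨_, _, rfl, ?_⟩
  rw [threshold_le_iff]
  by_cases h0 : w.left = nil
  · left
    simp only [countFst, countSnd, select, if_pos h0]
    omega
  · by_cases h1 : w.left.left = nil
    · left
      simp only [countFst, countSnd, select, if_neg h0, if_pos h1]
      omega
    · simp only [countFst, countSnd, select, if_neg h0, if_neg h1, zero_mul, one_mul, zero_add]
      by_cases h2 : sideLeft A B p q r e u x w.right.right.left =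
          sideRight A B p q r e u x w.right.right.left
      · exact Or.inr ⟨_, h2, Nat.le_add_left _ _⟩
      · exact Or.inl (by omega)

theorem infinite_leafCount_eq {e n : ℕ} {u x : BinaryTree Unit}
    (hn : n ∈ countSet (threshold A B p q r e u x)) :
    {w | leafCount A B p q r e u x w = n}.Infinite := by
  obtain ⟨a, b, rfl, hab⟩ := hn
  suffices h : ∃ k s v, ∀ j, countFst A B p q r e u x (node () k (node () s (node () v j))) = a ∧
      countSnd A B p q r e u x (node () k (node () s (node () v j))) = b by
    obtain ⟨k, s, v, h⟩ := h
    refine Set.infinite_of_injective_forall_mem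
      (f := fun j : BinaryTree Unit => node () k (node () s (node () v j)))
      (fun _ _ h => by simpa using h) fun j => ?_
    rw [Set.mem_ofPred_eq, leafCount, (h j).1, (h j).2]
  rw [threshold_le_iff] at hab
  by_cases hlt : b < a
  · refine ⟨nil, spine b, spine (a - b - 1), fun j => ?_⟩
    simp only [countFst, countSnd, BinaryTree.left, BinaryTree.right, select_nil, spineLength_spine,
      and_true]
    omega
  by_cases hlt' : a < b
  · refine ⟨node () nil nil, spine a, spine (b - a - 1), fun j => ?_⟩
    simp only [countFst, countSnd, BinaryTree.left, BinaryTree.right, select_nil, select_node,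
      spineLength_spine, true_and]
    omega
  obtain rfl : a = b := by omega
  obtain ⟨v, h1, h2⟩ := hab.resolve_left (by simp)
  -- The shift lifts the common value of the two sides at v to a.
  refine ⟨node () (node () nil nil) nil, spine (a - sideLeft A B p q r e u x v), v, fun j => ?_⟩
  simp only [countFst, countSnd, BinaryTree.left, BinaryTree.right, select_node, spineLength_spine]
  omega

theorem recognizable_leafCount (hA : Recognizable fun _ => A) (hB : Recognizable fun _ => B)
    (hp : Recognizable fun _ => p) (hq : Recognizable fun _ => q) (hr : Recognizable fun _ => r) :
    Recognizable fun e t => leafCount A B p q r e t.left t.right.left t.right.right := by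
  have select : ∀ {f : BinaryTree Unit → BinaryTree Unit} {F G : ℕ → BinaryTree Unit → ℕ},
      Recognizable (fun _ t => if f t = nil then 1 else 0) →
      Recognizable (fun _ t => if f t = nil then 0 else 1) → Recognizable F → Recognizable G →
      Recognizable fun e t => select (f t) (F e t) (G e t) :=
    fun h₀ h₁ hF hG => (h₀.mul hF).add (h₁.mul hG)
  have two := Recognizable.const 2
  -- In such a chain the last projection acts first. This one reads t.right.right.right.right.left,
  -- which is `w.right.right.left` for w = t.right.right, the place of the potential witness.
  have hv := fun {x : BinaryTree Unit → ℕ} (hx : Recognizable fun _ => x) =>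
    hx.left.right.right.right.right
  have he : Recognizable fun e _ => e := Recognizable.param Primrec.id
  have hh := recognizable_treeHash.left
  have hξ := recognizable_spineLength.left.right.left.right
  have hA := hv hA
  have hB := hv hB
  have hp := hv hp
  have hq := hv hq
  have hr := hv hr
  have hd := hv recognizable_spineLength
  have hα := recognizable_spineLength.left.right.right.right
  have hΦ := select Recognizable.isNil.left.left.right Recognizable.isNode.left.left.right hξ
    ((((hA.mul hA).add (hB.mul hB)).add ((hp.mul hp).add (he.mul he))).add
      (((hq.mul hq).add (hh.mul hh)).add ((hr.mul hr).add (hξ.mul hξ))))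
  have hΨ := select Recognizable.isNil.left.left.right Recognizable.isNode.left.left.right hξ
    (((two.mul (hA.mul hB)).add (two.mul (hp.mul he))).add
      ((two.mul (hq.mul hh)).add (two.mul (hr.mul hξ))))
  have hF := select Recognizable.isNil.left.right.right Recognizable.isNode.left.right.right
    ((hα.add hd).add (Recognizable.const 1))
    (select Recognizable.isNil.left.left.right.right Recognizable.isNode.left.left.right.right
      hα (hα.add hΦ))
  have hG := select Recognizable.isNil.left.right.right Recognizable.isNode.left.right.right hα
    (select Recognizable.isNil.left.left.right.right Recognizable.isNode.left.left.right.right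
      ((hα.add hd).add (Recognizable.const 1)) (hα.add hΨ))
  exact (((((hF.add hG).mul (hF.add hG)).add ((Recognizable.const 3).mul hF)).add hG).add
    (Recognizable.const 1)).of_eq fun e t => rfl

end Count

/-- A recognizable series that encodes membership in `Σ⁰₂` sets in its sets of values. -/
theorem exists_count_series : ∃ (N : ℕ → BinaryTree Unit → ℕ)
    (μ : ℕ → BinaryTree Unit → BinaryTree Unit → Option ℕ), Recognizable N ∧
      (∀ e u x w, N e (node () u (node () x w)) ∈ countSet (μ e u x)) ∧
      (∀ e u x, ∀ n ∈ countSet (μ e u x), {w | N e (node () u (node () x w)) = n}.Infinite) ∧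
      (∀ e u k, {x | μ e u x = some k}.Infinite) ∧
      (∀ e u, treeCode (node () u nil) ∈ sigmaTwo e → {x | μ e u x = none}.Infinite) ∧
      ∀ e u, treeCode (node () u nil) ∉ sigmaTwo e → ∀ x, μ e u x ≠ none := by
  obtain ⟨ψ, hψ, hS⟩ := exists_partrec_sigmaTwo
  obtain ⟨A, B, p, q, r, hA, hB, hp, hq, hr, hdom⟩ := exists_series_of_partrec hψ
  refine ⟨_, threshold A B p q r, recognizable_leafCount hA hB hp hq hr,
    fun e u x w => leafCount_mem e u x w, fun e u x n hn => infinite_leafCount_eq hn,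
    fun e u k => infinite_threshold_eq_some e k u, fun e u h => ?_, fun e u h x => ?_⟩
  · obtain ⟨ξ, hξ⟩ := (hS e u).1 h
    exact infinite_threshold_eq_none (ξ := ξ) (by rwa [← hdom])
  · refine threshold_ne_none fun ξ => ?_
    rw [← hdom]
    by_contra hcon
    exact h ((hS e u).2 ⟨ξ, hcon⟩)

end TreeAutomatic

/-! ### Constructions of forests and trees -/

namespace OrderForest

variable {V W : Type}

theorem level_eq_of_iso {r : V → V → Prop} {s : W → W → Prop} (f : r ≃r s) (p : V) :
    level s (f p) = level r p := by
  have : above s (f p) = f '' above r p := by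
    ext a
    constructor
    · rintro ⟨h1, h2⟩
      obtain ⟨b, rfl⟩ := f.surjective a
      exact ⟨b, ⟨f.map_rel_iff.1 h1, fun h => h2 (by rw [h])⟩, rfl⟩
    · rintro ⟨b, ⟨h1, h2⟩, rfl⟩
      exact ⟨f.map_rel_iff.2 h1, fun h => h2 (f.injective h)⟩
  rw [level, level, this, Set.ncard_image_of_injective _ f.injective]

theorem HasHeight.of_iso {r : V → V → Prop} {s : W → W → Prop} {n : ℕ} (h : HasHeight r n)
    (f : r ≃r s) : HasHeight s n := by
  have : Set.range (level s) = Set.range (level r) := by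
    rw [← f.surjective.range_comp]
    exact congrArg Set.range (funext fun p => level_eq_of_iso f p)
  rwa [HasHeight, this]

theorem IsForest.of_iso {r : V → V → Prop} {s : W → W → Prop} (h : IsForest r) (f : r ≃r s) :
    IsForest s := by
  obtain ⟨h1, h2⟩ := h
  refine ⟨?_, fun p => ?_⟩
  · have := f.symm.toRelEmbedding.isPartialOrder
    exact this
  · have hab : above s p = f '' above r (f.symm p) := by
      ext a
      constructor
      · rintro ⟨h1, h2⟩
        exact ⟨f.symm a, ⟨f.symm.map_rel_iff.2 h1, fun h => h2 (f.symm.injective h)⟩, by simp⟩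
      · rintro ⟨b, ⟨h1, h2⟩, rfl⟩
        refine ⟨?_, fun h => h2 (by rw [← h]; simp)⟩
        have := f.map_rel_iff.2 h1
        simpa using this
    rw [hab]
    refine ⟨(h2 _).1.image f, ?_⟩
    rintro _ ⟨a, ha, rfl⟩ _ ⟨b, hb, rfl⟩
    exact ((h2 _).2 a ha b hb).imp f.map_rel_iff.2 f.map_rel_iff.2

theorem Iso.symm {r : V → V → Prop} {s : W → W → Prop} (h : Iso r s) : Iso s r := h.map RelIso.symm

theorem Iso.trans {X : Type} {r : V → V → Prop} {s : W → W → Prop} {t : X → X → Prop}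
    (h : Iso r s) (h' : Iso s t) : Iso r t := by
  obtain ⟨f⟩ := h
  obtain ⟨g⟩ := h'
  exact ⟨f.trans g⟩

/-! #### Antichains -/

theorem isForest_eq : IsForest (@Eq V) := by
  have hab : ∀ p : V, above (@Eq V) p = ∅ := fun p => by
    ext a
    simp only [above, Set.mem_ofPred_eq, Set.mem_empty_iff_false, iff_false, not_and, not_not]
    exact Eq.symm
  refine ⟨{ refl := fun _ => rfl, trans := fun _ _ _ => Eq.trans, antisymm := fun _ _ h _ => h }, ?_⟩
  intro p
  simp [hab p]

theorem hasHeight_eq [Nonempty V] : HasHeight (@Eq V) 0 := by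
  have hab : ∀ p : V, level (@Eq V) p = 0 := fun p => by
    have : above (@Eq V) p = ∅ := by
      ext a
      simp only [above, Set.mem_ofPred_eq, Set.mem_empty_iff_false, iff_false, not_and, not_not]
      exact Eq.symm
    rw [level, this, Set.ncard_empty]
  refine ⟨⟨Classical.arbitrary V, hab _⟩, ?_⟩
  rintro _ ⟨p, rfl⟩
  exact (hab p).le

theorem iso_eq (f : V ≃ W) : Iso (@Eq V) (@Eq W) := ⟨⟨f, by simp⟩⟩

/-! #### Adding a greatest element -/

/-- The relation `r` with a new greatest element `none`. -/
inductive AddTop (r : V → V → Prop) : Option V → Option V → Prop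
  | top (x : Option V) : AddTop r x none
  | some {a b : V} (h : r a b) : AddTop r (some a) (some b)

namespace AddTop

variable {r : V → V → Prop} {s : W → W → Prop}

@[simp] theorem some_some {a b : V} : AddTop r (Option.some a) (Option.some b) ↔ r a b :=
  ⟨fun h => by cases h; assumption, AddTop.some⟩

@[simp] theorem none_some {b : V} : ¬ AddTop r none (Option.some b) := fun h => by cases h

@[simp] theorem right_none {x : Option V} : AddTop r x none := AddTop.top x

theorem above_some (a : V) :
    above (AddTop r) (Option.some a) = insert none (Option.some '' above r a) := by
  ext x
  cases x <;> simp [above]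

theorem above_none : above (AddTop r) none = ∅ := by
  ext x
  cases x <;> simp [above]

theorem isTree (hr : IsForest r) : IsTree (AddTop r) := by
  obtain ⟨hp, hr⟩ := hr
  refine ⟨⟨?_, ?_⟩, none, AddTop.top⟩
  · refine { refl := ?_, trans := ?_, antisymm := ?_ }
    · rintro (_ | a)
      · exact AddTop.top _
      · exact AddTop.some (hp.refl a)
    · rintro x y z h (_ | ⟨h'⟩)
      · exact AddTop.top _
      · cases h with
        | some h => exact AddTop.some (hp.trans _ _ _ h h')
    · rintro x y (_ | h) h'
      · cases h'
        rfl
      · cases h' with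
        | some h' => rw [hp.antisymm _ _ h h']
  · rintro (_ | a)
    · simp [above_none]
    · rw [above_some]
      refine ⟨((hr a).1.image _).insert _, ?_⟩
      rintro x (rfl | ⟨x, hx, rfl⟩) y (rfl | ⟨y, hy, rfl⟩)
      · simp
      · simp
      · simp
      · simpa using (hr a).2 x hx y hy

theorem level_none : level (AddTop r) none = 0 := by rw [level, above_none, Set.ncard_empty]

theorem level_some (hr : IsForest r) (a : V) :
    level (AddTop r) (Option.some a) = level r a + 1 := by
  rw [level, above_some, Set.ncard_insert_of_notMem (by simp) ((hr.2 a).1.image _),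
    Set.ncard_image_of_injective _ (Option.some_injective V), level]

theorem hasHeight (hr : IsForest r) {n : ℕ} (h : HasHeight r n) : HasHeight (AddTop r) (n + 1) := by
  obtain ⟨⟨p, hp⟩, hle⟩ := h
  refine ⟨⟨Option.some p, by rw [level_some hr, hp]⟩, ?_⟩
  rintro _ ⟨_ | a, rfl⟩
  · simp [level_none]
  · rw [level_some hr]
    exact Nat.succ_le_succ (hle ⟨a, rfl⟩)

theorem iso (h : Iso r s) : Iso (AddTop r) (AddTop s) := by
  obtain ⟨f⟩ := h
  refine ⟨⟨Equiv.optionCongr f.toEquiv, ?_⟩⟩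
  rintro (_ | a) (_ | b)
  · simp
  · simp
  · simp
  · simpa using f.map_rel_iff

/-- An isomorphism between the extensions preserves the new greatest elements. -/
theorem map_none (f : AddTop r ≃r AddTop s) : f none = none := by
  have h : AddTop s none (f none) := by
    have : AddTop s (f (f.symm none)) (f none) := f.map_rel_iff.2 (AddTop.top _)
    simpa using this
  cases hx : f none with
  | none => rfl
  | some y => rw [hx] at h; cases h

end AddTop

/-! #### Disjoint unions -/

section Sum

variable {I J : Type} {X : I → Type} {Y : J → Type}

/-- The disjoint union of a family of relations. -/
inductive DisjointUnion (r : ∀ i, X i → X i → Prop) : (Σ i, X i) → (Σ i, X i) → Prop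
  | mk {i : I} {a b : X i} (h : r i a b) : DisjointUnion r ⟨i, a⟩ ⟨i, b⟩

namespace DisjointUnion

variable {r : ∀ i, X i → X i → Prop} {s : ∀ j, Y j → Y j → Prop}

@[simp] theorem mk_mk {i : I} {a b : X i} : DisjointUnion r ⟨i, a⟩ ⟨i, b⟩ ↔ r i a b :=
  ⟨fun h => by cases h; assumption, DisjointUnion.mk⟩

theorem fst_eq {x y : Σ i, X i} (h : DisjointUnion r x y) : x.1 = y.1 := by
  cases h
  rfl

theorem above_mk (i : I) (a : X i) :
    above (DisjointUnion r) ⟨i, a⟩ = Sigma.mk i '' above (r i) a := by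
  ext x
  constructor
  · rintro ⟨h1, h2⟩
    cases h1 with
    | @mk _ _ b h => exact ⟨b, ⟨h, fun hb => h2 (by rw [hb])⟩, rfl⟩
  · rintro ⟨b, ⟨h1, h2⟩, rfl⟩
    exact ⟨DisjointUnion.mk h1, fun h => h2 (sigma_mk_injective h)⟩

theorem isForest (hr : ∀ i, IsForest (r i)) : IsForest (DisjointUnion r) := by
  refine ⟨{ refl := ?_, trans := ?_, antisymm := ?_ }, ?_⟩
  · rintro ⟨i, a⟩
    exact DisjointUnion.mk ((hr i).1.refl a)
  · rintro _ _ _ ⟨h⟩ h'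
    cases h' with
    | mk h' => exact DisjointUnion.mk ((hr _).1.trans _ _ _ h h')
  · rintro _ _ ⟨h⟩ h'
    rw [(hr _).1.antisymm _ _ h (mk_mk.1 h')]
  · rintro ⟨i, a⟩
    rw [above_mk]
    refine ⟨((hr i).2 a).1.image _, ?_⟩
    rintro _ ⟨x, hx, rfl⟩ _ ⟨y, hy, rfl⟩
    simpa using ((hr i).2 a).2 x hx y hy

theorem level_mk (i : I) (a : X i) : level (DisjointUnion r) ⟨i, a⟩ = level (r i) a := by
  rw [level, above_mk, Set.ncard_image_of_injective _ sigma_mk_injective, level]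

theorem hasHeight [Nonempty I] {n : ℕ} (h : ∀ i, HasHeight (r i) n) :
    HasHeight (DisjointUnion r) n := by
  constructor
  · obtain ⟨p, hp⟩ := (h (Classical.arbitrary I)).1
    exact ⟨⟨_, p⟩, by rw [level_mk, hp]⟩
  · rintro _ ⟨⟨i, a⟩, rfl⟩
    rw [level_mk]
    exact (h i).2 ⟨a, rfl⟩

theorem iso_of_equiv (f : I ≃ J) (h : ∀ i, Iso (r i) (s (f i))) :
    Iso (DisjointUnion r) (DisjointUnion s) := by
  have g := fun i => Classical.choice (h i)
  refine ⟨⟨Equiv.sigmaCongr f fun i => (g i).toEquiv, ?_⟩⟩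
  rintro ⟨i, a⟩ ⟨j, b⟩
  constructor
  · intro hab
    obtain rfl : i = j := f.injective hab.fst_eq
    exact DisjointUnion.mk ((g i).map_rel_iff.1 (mk_mk.1 hab))
  · rintro ⟨hab⟩
    exact DisjointUnion.mk ((g i).map_rel_iff.2 hab)

/-- A disjoint union of countably many relations in which every isomorphism type occurs infinitely
often is determined by the set of types that occur. -/
theorem iso_of_types {T : Type} [Countable I] {S : Set T} {Z : S × ℕ → Type}
    {s : ∀ p : S × ℕ, Z p → Z p → Prop} (τ : I → S)
    (hinf : ∀ t, {i | τ i = t}.Infinite) (h : ∀ i p, τ i = p.1 → Iso (r i) (s p)) :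
    Iso (DisjointUnion r) (DisjointUnion s) := by
  have hfib : ∀ t : S, Nonempty ({i // τ i = t} ≃ ℕ) := by
    intro t
    have : Infinite {i // τ i = t} := (hinf t).to_subtype
    obtain ⟨_⟩ := nonempty_denumerable {i // τ i = t}
    exact ⟨Denumerable.eqv _⟩
  have g := fun t => Classical.choice (hfib t)
  let f : I ≃ S × ℕ := ((Equiv.sigmaFiberEquiv τ).symm.trans (Equiv.sigmaCongrRight g)).trans
    (Equiv.sigmaEquivProd S ℕ)
  exact iso_of_equiv f fun i => h i _ rfl

/-- The subtree at the greatest element of a component. -/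
theorem iso_subtree {i : I} {g : X i} (hg : ∀ a, r i a g) :
    Iso (subtree (DisjointUnion r) ⟨i, g⟩) (r i) := by
  refine Iso.symm ⟨⟨Equiv.ofBijective (fun a => ⟨⟨i, a⟩, DisjointUnion.mk (hg a)⟩) ⟨?_, ?_⟩, ?_⟩⟩
  · intro a b h
    exact sigma_mk_injective (Subtype.ext_iff.1 h)
  · rintro ⟨_, ⟨_⟩⟩
    exact ⟨_, rfl⟩
  · intro a b
    exact mk_mk

/-- In isomorphic disjoint unions of relations with greatest elements, every component of the first
is isomorphic to a component of the second. -/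
theorem exists_iso_component (hr : ∀ i, ∃ g, ∀ a, r i a g) (hs : ∀ j, ∃ g, ∀ a, s j a g)
    (h : Iso (DisjointUnion r) (DisjointUnion s)) (i : I) : ∃ j, Iso (r i) (s j) := by
  obtain ⟨f⟩ := h
  obtain ⟨g, hg⟩ := hr i
  refine ⟨(f ⟨i, g⟩).1, ?_⟩
  obtain ⟨g', hg'⟩ := hs (f ⟨i, g⟩).1
  have h1 : ∀ a, ∃ b, f ⟨i, a⟩ = ⟨(f ⟨i, g⟩).1, b⟩ := by
    intro a
    have hle : DisjointUnion s (f ⟨i, a⟩) (f ⟨i, g⟩) := f.map_rel_iff.2 (DisjointUnion.mk (hg a))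
    generalize f ⟨i, a⟩ = x at hle
    generalize f ⟨i, g⟩ = y at hle
    cases hle
    exact ⟨_, rfl⟩
  choose k hk using h1
  -- The inverse maps the target component below the image of its greatest element, hence into a
  -- single component. That component contains ⟨i, g⟩.
  have h2 : ∀ b, ∃ a, f ⟨i, a⟩ = ⟨(f ⟨i, g⟩).1, b⟩ := by
    have hle : ∀ b, DisjointUnion r (f.symm ⟨_, b⟩) (f.symm ⟨_, g'⟩) := fun b =>
      f.symm.map_rel_iff.2 (DisjointUnion.mk (hg' b))
    intro b
    have h3 : (f.symm ⟨(f ⟨i, g⟩).1, b⟩).1 = i := by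
      rw [(hle b).fst_eq, ← (hle (k g)).fst_eq, ← hk g, f.symm_apply_apply]
    obtain ⟨⟨i', a⟩, ha⟩ : ∃ y, f.symm ⟨(f ⟨i, g⟩).1, b⟩ = y := ⟨_, rfl⟩
    rw [ha] at h3
    obtain rfl : i' = i := h3
    exact ⟨a, by rw [← ha, f.apply_symm_apply]⟩
  refine ⟨⟨Equiv.ofBijective k ⟨fun a b hab => ?_, fun b => ?_⟩, ?_⟩⟩
  · refine sigma_mk_injective (f.injective ((hk a).trans ?_))
    rw [hab, hk b]
  · obtain ⟨a, ha⟩ := h2 b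
    exact ⟨a, sigma_mk_injective ((hk a).symm.trans ha)⟩
  · intro a b
    change s _ (k a) (k b) ↔ _
    rw [← mk_mk (r := s), ← hk, ← hk, f.map_rel_iff, mk_mk]

end DisjointUnion

end Sum

theorem iso_of_iso_addTop {r : V → V → Prop} {s : W → W → Prop} (h : Iso (AddTop r) (AddTop s)) :
    Iso r s := by
  obtain ⟨f⟩ := h
  have h1 : ∀ a : V, ∃ b : W, f (some a) = some b := by
    intro a
    refine Option.ne_none_iff_exists'.1 fun h => ?_
    rw [← AddTop.map_none f] at h
    simpa using f.injective h
  have h2 : ∀ b : W, ∃ a : V, f (some a) = some b := by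
    intro b
    obtain ⟨x, hx⟩ := f.surjective (some b)
    cases x with
    | none => rw [AddTop.map_none f] at hx; simp at hx
    | some a => exact ⟨a, hx⟩
  choose k hk using h1
  refine ⟨⟨Equiv.ofBijective k ⟨fun a b hab => ?_, fun b => ?_⟩, ?_⟩⟩
  · exact Option.some_injective _ (f.injective (by rw [hk, hk, hab]))
  · obtain ⟨a, ha⟩ := h2 b
    exact ⟨a, Option.some_injective _ ((hk a).symm.trans ha)⟩
  · intro a b
    change s (k a) (k b) ↔ _
    rw [← AddTop.some_some (r := s), ← hk, ← hk, f.map_rel_iff, AddTop.some_some]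

end OrderForest

/-! ### The two trees of height three -/

namespace TreeAutomatic

open OrderForest

instance : Countable (BinaryTree Unit) := treeCode_injective.countable

/-- The tree of height two in which, for every `n` in `countSet μ`, infinitely many children of the
root have exactly `n` children. -/
def heightTwoTree (μ : Option ℕ) :
    Option (Σ p : countSet μ × ℕ, Option (Fin p.1)) →
      Option (Σ p : countSet μ × ℕ, Option (Fin p.1)) → Prop :=
  AddTop (DisjointUnion fun p : countSet μ × ℕ => AddTop (@Eq (Fin p.1)))

/-- The tree of height three in which `heightTwoTree μ` occurs infinitely often below the root for
every `μ` in `M`, and no other tree occurs. -/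
def heightThreeTree (M : Set (Option ℕ)) :
    Option (Σ p : M × ℕ, Option (Σ q : countSet (p.1 : Option ℕ) × ℕ, Option (Fin q.1))) →
      Option (Σ p : M × ℕ, Option (Σ q : countSet (p.1 : Option ℕ) × ℕ, Option (Fin q.1))) → Prop :=
  AddTop (DisjointUnion fun p : M × ℕ => heightTwoTree p.1)

/-- This is the purpose of the `+ 1` in `countSet`: every node at level 2 has a leaf below it. -/
theorem pos_of_mem_countSet {μ : Option ℕ} {n : ℕ} (h : n ∈ countSet μ) : 0 < n := by
  obtain ⟨a, b, rfl, -⟩ := h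
  exact Nat.succ_pos _

theorem isForest_heightTwoTree_children (μ : Option ℕ) :
    IsForest (DisjointUnion fun p : countSet μ × ℕ => AddTop (@Eq (Fin p.1))) :=
  DisjointUnion.isForest fun _ => (AddTop.isTree isForest_eq).1

theorem isTree_heightTwoTree (μ : Option ℕ) : IsTree (heightTwoTree μ) :=
  AddTop.isTree (isForest_heightTwoTree_children μ)

theorem hasHeight_heightTwoTree (μ : Option ℕ) : HasHeight (heightTwoTree μ) 2 := by
  have : Nonempty (countSet μ × ℕ) := ⟨⟨_, 0, 1, rfl, Or.inl (by simp)⟩, 0⟩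
  refine AddTop.hasHeight (isForest_heightTwoTree_children μ) (DisjointUnion.hasHeight fun p => ?_)
  have : Nonempty (Fin p.1) := ⟨⟨0, pos_of_mem_countSet p.1.2⟩⟩
  exact AddTop.hasHeight isForest_eq hasHeight_eq

theorem isTree_heightThreeTree (M : Set (Option ℕ)) : IsTree (heightThreeTree M) :=
  AddTop.isTree (DisjointUnion.isForest fun p => (isTree_heightTwoTree p.1).1)

theorem hasHeight_heightThreeTree {M : Set (Option ℕ)} (hM : M.Nonempty) :
    HasHeight (heightThreeTree M) 3 := by
  have : Nonempty (M × ℕ) := ⟨⟨_, hM.some_mem⟩, 0⟩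
  exact AddTop.hasHeight (DisjointUnion.isForest fun p => (isTree_heightTwoTree p.1).1)
    (DisjointUnion.hasHeight fun p => hasHeight_heightTwoTree p.1)

/-- The numbers of leaves below the children of the root are invariants. The diagonal code `quadPair
k k + 1` occurs for the threshold k and never for `none`. -/
theorem eq_none_of_iso_heightTwoTree {μ : Option ℕ}
    (h : Iso (heightTwoTree none) (heightTwoTree μ)) : μ = none := by
  cases μ with
  | none => rfl
  | some k =>
    have hk : quadPair k k + 1 ∈ countSet (some k) := ⟨k, k, rfl, Or.inr ⟨k, rfl, le_rfl⟩⟩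
    obtain ⟨⟨⟨n, hn⟩, i⟩, hi⟩ := DisjointUnion.exists_iso_component
      (fun _ => ⟨none, AddTop.top⟩) (fun _ => ⟨none, AddTop.top⟩) (iso_of_iso_addTop h).symm
      (⟨_, hk⟩, 0)
    obtain ⟨f⟩ := iso_of_iso_addTop hi
    have hcard := Fintype.card_congr f.toEquiv
    simp only [Fintype.card_fin] at hcard
    obtain ⟨a, b, rfl, hab⟩ := hn
    obtain ⟨h1, h2⟩ := quadPair_injective (Nat.succ_injective hcard)
    rcases hab with hab | ⟨k, hk, -⟩
    · exact absurd (h1.symm.trans h2) hab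
    · simp at hk

theorem mem_of_iso_heightThreeTree {M M' : Set (Option ℕ)} (hM : none ∈ M)
    (h : Iso (heightThreeTree M) (heightThreeTree M')) : none ∈ M' := by
  obtain ⟨⟨⟨μ, hμ⟩, i⟩, hi⟩ := DisjointUnion.exists_iso_component
    (fun p => (isTree_heightTwoTree p.1).2) (fun p => (isTree_heightTwoTree p.1).2)
    (iso_of_iso_addTop h) (⟨none, hM⟩, 0)
  exact eq_none_of_iso_heightTwoTree hi ▸ hμ

/-- A tree of height three whose nodes at the first two levels below the root are indexed by trees
is determined by the types that occur. -/
theorem iso_heightThreeTree {M : Set (Option ℕ)} {K : BinaryTree Unit → BinaryTree Unit → Type}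
    {N : BinaryTree Unit → BinaryTree Unit → ℕ} {μ : BinaryTree Unit → Option ℕ}
    (hK : ∀ x w, Nat.card (K x w) = N x w) (hN : ∀ x w, N x w ∈ countSet (μ x))
    (hN' : ∀ x, ∀ n ∈ countSet (μ x), {w | N x w = n}.Infinite)
    (hμ : ∀ x, μ x ∈ M) (hμ' : ∀ m ∈ M, {x | μ x = m}.Infinite) :
    Iso (AddTop (DisjointUnion fun x : BinaryTree Unit =>
      AddTop (DisjointUnion fun w : BinaryTree Unit => AddTop (@Eq (K x w))))) (heightThreeTree M) := by
  refine AddTop.iso (DisjointUnion.iso_of_types (fun x => ⟨μ x, hμ x⟩) (fun m => ?_)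
    fun x p hp => AddTop.iso ?_)
  · refine (hμ' m.1 m.2).mono fun x hx => ?_
    exact Subtype.ext hx
  · obtain ⟨m, i⟩ := p
    obtain rfl : _ = m := hp
    refine DisjointUnion.iso_of_types (fun w => ⟨N x w, hN x w⟩) (fun n => ?_)
      fun w q hq => AddTop.iso ?_
    · exact (hN' x n.1 n.2).mono fun w hw => Subtype.ext hw
    · obtain ⟨n, j⟩ := q
      obtain rfl : _ = n := hq
      -- `Nat.card` is 0 on infinite types, so finiteness follows from a positive value.
      have hpos : 0 < Nat.card (K x w) := by
        rw [hK]
        exact pos_of_mem_countSet (hN x w)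
      have := Nat.finite_of_card_ne_zero hpos.ne'
      exact iso_eq (Finite.equivFinOfCardEq (hK x w))

end TreeAutomatic

/-! ### Operations on tree automata -/

namespace TreeAutomatic

open BinaryTree

namespace Automaton

variable {α β : Type}

/-- The disjoint union of two automata. -/
def union (A B : Automaton α) : Automaton α :=
  (A.1.map (fun τ => (2 * τ.1, τ.2.1, 2 * τ.2.2.1, 2 * τ.2.2.2)) ++
    B.1.map (fun τ => (2 * τ.1 + 1, τ.2.1, 2 * τ.2.2.1 + 1, 2 * τ.2.2.2 + 1)),
    A.2.1.map (fun q => 2 * q) ++ B.2.1.map (fun q => 2 * q + 1),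
    A.2.2.map (fun q => 2 * q) ++ B.2.2.map (fun q => 2 * q + 1))

theorem runFrom_union_left (A B : Automaton α) (t : BinaryTree α) (q : ℕ) :
    (union A B).RunFrom t (2 * q) ↔ A.RunFrom t q := by
  induction t generalizing q with
  | nil =>
    simp only [RunFrom, final, union, List.mem_append, List.mem_map]
    constructor
    · rintro (⟨p, hp, h⟩ | ⟨p, _, h⟩)
      · obtain rfl : p = q := by omega
        exact hp
      · omega
    · exact fun h => Or.inl ⟨q, h, rfl⟩
  | node a l r hl hr =>
    simp only [RunFrom, transitions, union, List.mem_append, List.mem_map, Prod.mk.injEq]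
    constructor
    · rintro ⟨i, j, ⟨τ, hτ, h1, rfl, rfl, rfl⟩ | ⟨τ, _, h, _⟩, h2, h3⟩
      · obtain rfl : τ.1 = q := by omega
        exact ⟨_, _, hτ, (hl _).1 h2, (hr _).1 h3⟩
      · omega
    · rintro ⟨i, j, h1, h2, h3⟩
      exact ⟨_, _, Or.inl ⟨_, h1, rfl, rfl, rfl, rfl⟩, (hl _).2 h2, (hr _).2 h3⟩

theorem runFrom_union_right (A B : Automaton α) (t : BinaryTree α) (q : ℕ) :
    (union A B).RunFrom t (2 * q + 1) ↔ B.RunFrom t q := by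
  induction t generalizing q with
  | nil =>
    simp only [RunFrom, final, union, List.mem_append, List.mem_map]
    constructor
    · rintro (⟨p, _, h⟩ | ⟨p, hp, h⟩)
      · omega
      · obtain rfl : p = q := by omega
        exact hp
    · exact fun h => Or.inr ⟨q, h, rfl⟩
  | node a l r hl hr =>
    simp only [RunFrom, transitions, union, List.mem_append, List.mem_map, Prod.mk.injEq]
    constructor
    · rintro ⟨i, j, ⟨τ, _, h, _⟩ | ⟨τ, hτ, h1, rfl, rfl, rfl⟩, h2, h3⟩
      · omega
      · obtain rfl : τ.1 = q := by omega
        exact ⟨_, _, hτ, (hl _).1 h2, (hr _).1 h3⟩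
    · rintro ⟨i, j, h1, h2, h3⟩
      exact ⟨_, _, Or.inr ⟨_, h1, rfl, rfl, rfl, rfl⟩, (hl _).2 h2, (hr _).2 h3⟩

theorem language_union (A B : Automaton α) :
    (union A B).language = A.language ∪ B.language := by
  ext t
  constructor
  · rintro ⟨h0, q, hq, h⟩
    simp only [initial, union, List.mem_append, List.mem_map] at hq
    rcases hq with ⟨p, hp, rfl⟩ | ⟨p, hp, rfl⟩
    · exact Or.inl ⟨h0, p, hp, (runFrom_union_left A B t p).1 h⟩
    · exact Or.inr ⟨h0, p, hp, (runFrom_union_right A B t p).1 h⟩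
  · rintro (⟨h0, q, hq, h⟩ | ⟨h0, q, hq, h⟩)
    · exact ⟨h0, 2 * q, List.mem_append_left _ (List.mem_map.2 ⟨q, hq, rfl⟩),
        (runFrom_union_left A B t q).2 h⟩
    · exact ⟨h0, 2 * q + 1, List.mem_append_right _ (List.mem_map.2 ⟨q, hq, rfl⟩),
        (runFrom_union_right A B t q).2 h⟩

/-- The automaton for the image of a language under a relabeling. -/
def relabel (g : α → β) (A : Automaton α) : Automaton β :=
  (A.1.map fun τ => (τ.1, g τ.2.1, τ.2.2.1, τ.2.2.2), A.2.1, A.2.2)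

theorem runFrom_relabel (g : α → β) (A : Automaton α) (u : BinaryTree β) (q : ℕ) :
    (relabel g A).RunFrom u q ↔ ∃ t, t.map g = u ∧ A.RunFrom t q := by
  induction u generalizing q with
  | nil =>
    constructor
    · exact fun h => ⟨nil, rfl, h⟩
    · rintro ⟨_ | ⟨a, l, r⟩, h1, h2⟩
      · exact h2
      · simp [BinaryTree.map] at h1
  | node b l r hl hr =>
    simp only [RunFrom, transitions, relabel, List.mem_map, Prod.mk.injEq]
    constructor
    · rintro ⟨i, j, ⟨τ, hτ, rfl, rfl, rfl, rfl⟩, h2, h3⟩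
      obtain ⟨l', hl', h2'⟩ := (hl _).1 h2
      obtain ⟨r', hr', h3'⟩ := (hr _).1 h3
      exact ⟨node τ.2.1 l' r', by rw [BinaryTree.map, hl', hr'], _, _, hτ, h2', h3'⟩
    · rintro ⟨_ | ⟨a, l', r'⟩, h1, h2⟩
      · simp [BinaryTree.map] at h1
      · simp only [BinaryTree.map, node.injEq] at h1
        obtain ⟨rfl, rfl, rfl⟩ := h1
        obtain ⟨i, j, h1, h2, h3⟩ := h2
        exact ⟨i, j, ⟨_, h1, rfl, rfl, rfl, rfl⟩, (hl _).2 ⟨_, rfl, h2⟩, (hr _).2 ⟨_, rfl, h3⟩⟩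

theorem language_relabel (g : α → β) (A : Automaton α) :
    (relabel g A).language = BinaryTree.map g '' A.language := by
  ext u
  constructor
  · rintro ⟨h0, q, hq, h⟩
    obtain ⟨t, ht, h'⟩ := (runFrom_relabel g A u q).1 h
    exact ⟨t, ⟨fun h1 => h0 (by rw [← ht, h1, BinaryTree.map]), q, hq, h'⟩, ht⟩
  · rintro ⟨t, ⟨h0, q, hq, h⟩, rfl⟩
    refine ⟨?_, q, hq, (runFrom_relabel g A _ q).2 ⟨t, rfl, h⟩⟩
    cases t with
    | nil => exact absurd rfl h0
    | node a l r => simp [BinaryTree.map]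

/-- The states that replace a state in `normalize`: final states may be replaced by `0`. -/
def variants (A : Automaton α) (q : ℕ) : List ℕ := if q ∈ A.2.2 then [q + 1, 0] else [q + 1]

/-- An equivalent automaton in which no transition starts in a final state. -/
def normalize (A : Automaton α) : Automaton α :=
  (A.1.flatMap fun τ => (variants A τ.2.2.1).flatMap fun i => (variants A τ.2.2.2).map fun j =>
    (τ.1 + 1, τ.2.1, i, j), A.2.1.map (· + 1), [0])

theorem mem_transitions_normalize {A : Automaton α} {q : ℕ} {a : α} {i j : ℕ} :
    (q, a, i, j) ∈ (normalize A).transitions ↔ ∃ τ ∈ A.transitions,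
      i ∈ variants A τ.2.2.1 ∧ j ∈ variants A τ.2.2.2 ∧ q = τ.1 + 1 ∧ a = τ.2.1 := by
  simp only [transitions, normalize, List.mem_flatMap, List.mem_map, Prod.mk.injEq]
  constructor
  · rintro ⟨τ, hτ, i, hi, j, hj, rfl, rfl, rfl, rfl⟩
    exact ⟨τ, hτ, hi, hj, rfl, rfl⟩
  · rintro ⟨τ, hτ, hi, hj, rfl, rfl⟩
    exact ⟨τ, hτ, i, hi, j, hj, rfl, rfl, rfl, rfl⟩

theorem wellFormed_normalize (A : Automaton α) : (normalize A).WellFormed := by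
  rintro ⟨q, a, i, j⟩ h
  obtain ⟨τ, _, _, _, rfl, _⟩ := mem_transitions_normalize.1 h
  simp [final, normalize]

/-- A final state may also have outgoing transitions. After normalization a run guesses where a
final state sits on the frontier and writes there the state 0, which starts no transition. -/
theorem exists_variant_runFrom (A : Automaton α) (t : BinaryTree α) (q : ℕ) :
    (∃ p ∈ variants A q, (normalize A).RunFrom t p) ↔ A.RunFrom t q := by
  induction t generalizing q with
  | nil =>
    simp only [RunFrom, final, normalize, variants, List.mem_singleton]
    split_ifs with h <;> simp [h]
  | node a l r hl hr =>
    constructor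
    · rintro ⟨p, hp, i, j, h1, h2, h3⟩
      obtain ⟨τ, hτ, hi, hj, rfl, rfl⟩ := mem_transitions_normalize.1 h1
      obtain rfl : τ.1 = q := by
        unfold variants at hp
        split_ifs at hp <;> simpa using hp
      exact ⟨_, _, hτ, (hl _).1 ⟨i, hi, h2⟩, (hr _).1 ⟨j, hj, h3⟩⟩
    · rintro ⟨i, j, h1, h2, h3⟩
      obtain ⟨i', hi, h2⟩ := (hl _).2 h2
      obtain ⟨j', hj, h3⟩ := (hr _).2 h3
      refine ⟨q + 1, ?_, i', j', mem_transitions_normalize.2 ⟨_, h1, hi, hj, rfl, rfl⟩, h2, h3⟩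
      unfold variants
      split_ifs <;> simp

theorem not_runFrom_node_zero (A : Automaton α) (a : α) (l r : BinaryTree α) :
    ¬ (normalize A).RunFrom (node a l r) 0 := by
  rintro ⟨i, j, h, _⟩
  obtain ⟨τ, _, _, _, h, _⟩ := mem_transitions_normalize.1 h
  omega

/-- Initial states are never replaced by 0. This loses nothing, because from 0 only the empty tree
is accepted and languages exclude it. -/
theorem language_normalize (A : Automaton α) : (normalize A).language = A.language := by
  ext t
  cases t with
  | nil => simp [language]
  | node a l r =>
    have hrun : ∀ q, (normalize A).RunFrom (node a l r) (q + 1) ↔ A.RunFrom (node a l r) q := by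
      intro q
      rw [← exists_variant_runFrom A]
      have h0 := not_runFrom_node_zero A a l r
      unfold variants
      split_ifs <;> simp [h0]
    simp only [language, initial]
    constructor
    · rintro ⟨h0, q, hq, h⟩
      obtain ⟨q, hq', rfl⟩ := List.mem_map.1 hq
      exact ⟨h0, q, hq', (hrun q).1 h⟩
    · rintro ⟨h0, q, hq, h⟩
      exact ⟨h0, q + 1, List.mem_map.2 ⟨q, hq, rfl⟩, (hrun q).2 h⟩

/-- The automaton for the trees whose labels are codes of pairs, such that the first components
form a tree accepted by `A`, and the second components a tree accepted by `B`. -/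
def prod (A B : Automaton ℕ) : Automaton ℕ :=
  (A.1.flatMap fun τ => B.1.map fun σ => (Nat.pair τ.1 σ.1, Nat.pair τ.2.1 σ.2.1,
    Nat.pair τ.2.2.1 σ.2.2.1, Nat.pair τ.2.2.2 σ.2.2.2),
    A.2.1.flatMap fun p => B.2.1.map fun q => Nat.pair p q,
    A.2.2.flatMap fun p => B.2.2.map fun q => Nat.pair p q)

theorem runFrom_prod (A B : Automaton ℕ) (t : BinaryTree ℕ) (p q : ℕ) :
    (prod A B).RunFrom t (Nat.pair p q) ↔
      A.RunFrom (t.map fun a => a.unpair.1) p ∧ B.RunFrom (t.map fun a => a.unpair.2) q := by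
  induction t generalizing p q with
  | nil =>
    simp only [RunFrom, BinaryTree.map, final, prod, List.mem_flatMap, List.mem_map, Nat.pair_eq_pair]
    constructor
    · rintro ⟨p, hp, q, hq, rfl, rfl⟩
      exact ⟨hp, hq⟩
    · rintro ⟨hp, hq⟩
      exact ⟨p, hp, q, hq, rfl, rfl⟩
  | node a l r hl hr =>
    simp only [RunFrom, BinaryTree.map, transitions, prod, List.mem_flatMap, List.mem_map,
      Prod.mk.injEq, Nat.pair_eq_pair]
    constructor
    · rintro ⟨i, j, ⟨τ, hτ, σ, hσ, ⟨rfl, rfl⟩, rfl, rfl, rfl⟩, h2, h3⟩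
      have h2' := (hl _ _).1 h2
      have h3' := (hr _ _).1 h3
      simp only [Nat.unpair_pair]
      exact ⟨⟨_, _, hτ, h2'.1, h3'.1⟩, _, _, hσ, h2'.2, h3'.2⟩
    · rintro ⟨⟨i, j, h1, h2, h3⟩, i', j', h1', h2', h3'⟩
      exact ⟨Nat.pair i i', Nat.pair j j', ⟨_, h1, _, h1', ⟨rfl, rfl⟩, Nat.pair_unpair a, rfl, rfl⟩,
        (hl _ _).2 ⟨h2, h2'⟩, (hr _ _).2 ⟨h3, h3'⟩⟩

/-! #### Computability of the operations -/

section Primrec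

variable {γ : Type} [Primcodable α] [Primcodable β] [Primcodable γ]

theorem primrec_union {A B : γ → Automaton α} (hA : Primrec A) (hB : Primrec B) :
    Primrec fun e => union (A e) (B e) := by
  have hmap : ∀ k : ℕ, Primrec fun q : ℕ => 2 * q + k := fun k =>
    Primrec.nat_add.comp (Primrec.nat_mul.comp (Primrec.const 2) Primrec.id) (Primrec.const k)
  have hτ : ∀ k : ℕ, Primrec fun τ : ℕ × α × ℕ × ℕ =>
      (2 * τ.1 + k, τ.2.1, 2 * τ.2.2.1 + k, 2 * τ.2.2.2 + k) := fun k =>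
    ((hmap k).comp Primrec.fst).pair ((Primrec.fst.comp Primrec.snd).pair
      (((hmap k).comp (Primrec.fst.comp (Primrec.snd.comp Primrec.snd))).pair
        ((hmap k).comp (Primrec.snd.comp (Primrec.snd.comp Primrec.snd)))))
  exact (Primrec.list_append.comp
    (Primrec.list_map (Primrec.fst.comp hA) ((hτ 0).comp Primrec.snd).to₂)
    (Primrec.list_map (Primrec.fst.comp hB) ((hτ 1).comp Primrec.snd).to₂)).pair
    ((Primrec.list_append.comp
      (Primrec.list_map (Primrec.fst.comp (Primrec.snd.comp hA)) ((hmap 0).comp Primrec.snd).to₂)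
      (Primrec.list_map (Primrec.fst.comp (Primrec.snd.comp hB))
        ((hmap 1).comp Primrec.snd).to₂)).pair
    (Primrec.list_append.comp
      (Primrec.list_map (Primrec.snd.comp (Primrec.snd.comp hA)) ((hmap 0).comp Primrec.snd).to₂)
      (Primrec.list_map (Primrec.snd.comp (Primrec.snd.comp hB))
        ((hmap 1).comp Primrec.snd).to₂)))

theorem primrec_relabel {A : γ → Automaton α} (hA : Primrec A) {g : α → β} (hg : Primrec g) :
    Primrec fun e => relabel g (A e) := by
  have hτ : Primrec fun τ : ℕ × α × ℕ × ℕ => (τ.1, g τ.2.1, τ.2.2.1, τ.2.2.2) :=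
    Primrec.fst.pair ((hg.comp (Primrec.fst.comp Primrec.snd)).pair
      (Primrec.snd.comp Primrec.snd))
  exact (Primrec.list_map (Primrec.fst.comp hA) (hτ.comp Primrec.snd).to₂).pair
    (Primrec.snd.comp hA)

theorem primrec_variants : Primrec₂ (variants (α := α)) := by
  have hmem : PrimrecRel fun (q : ℕ) (L : List ℕ) => q ∈ L := by
    have := (Primrec.eq (α := ℕ)).exists_mem_list
    exact (this.comp Primrec.snd Primrec.fst).of_eq fun p => by simp
  exact Primrec.ite (hmem.comp Primrec.snd (Primrec.snd.comp (Primrec.snd.comp Primrec.fst)))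
    (Primrec.list_cons.comp (Primrec.succ.comp Primrec.snd) (Primrec.const [0]))
    (Primrec.list_cons.comp (Primrec.succ.comp Primrec.snd) (Primrec.const []))

theorem primrec_normalize {A : γ → Automaton α} (hA : Primrec A) :
    Primrec fun e => normalize (A e) := by
  refine (Primrec.list_flatMap (Primrec.fst.comp hA) ?_).pair
    ((Primrec.list_map (Primrec.fst.comp (Primrec.snd.comp hA))
      (Primrec.succ.comp Primrec.snd).to₂).pair (Primrec.const [0]))
  refine Primrec.list_flatMap (primrec_variants.comp (hA.comp Primrec.fst)
    (Primrec.fst.comp (Primrec.snd.comp (Primrec.snd.comp Primrec.snd)))) ?_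
  refine Primrec.list_map (primrec_variants.comp (hA.comp (Primrec.fst.comp Primrec.fst))
    (Primrec.snd.comp (Primrec.snd.comp (Primrec.snd.comp (Primrec.snd.comp Primrec.fst))))) ?_
  have hτ : Primrec fun p : ((γ × (ℕ × α × ℕ × ℕ)) × ℕ) × ℕ => p.1.1.2 :=
    Primrec.snd.comp (Primrec.fst.comp Primrec.fst)
  exact (Primrec.succ.comp (Primrec.fst.comp hτ)).pair ((Primrec.fst.comp (Primrec.snd.comp hτ)).pair
    ((Primrec.snd.comp Primrec.fst).pair Primrec.snd))

theorem primrec_prod {A B : γ → Automaton ℕ} (hA : Primrec A) (hB : Primrec B) :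
    Primrec fun e => prod (A e) (B e) := by
  have hpair : ∀ {L M : γ → List ℕ}, Primrec L → Primrec M →
      Primrec fun e => (L e).flatMap fun p => (M e).map fun q => Nat.pair p q := fun hL hM =>
    Primrec.list_flatMap hL (Primrec.list_map (hM.comp Primrec.fst)
      (Primrec₂.natPair.comp (Primrec.snd.comp Primrec.fst) Primrec.snd))
  have hτ : Primrec fun p : (γ × (ℕ × ℕ × ℕ × ℕ)) × (ℕ × ℕ × ℕ × ℕ) => p.1.2 :=
    Primrec.snd.comp Primrec.fst
  have hσ : Primrec fun p : (γ × (ℕ × ℕ × ℕ × ℕ)) × (ℕ × ℕ × ℕ × ℕ) => p.2 := Primrec.snd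
  have htrans : Primrec₂ fun (p : γ × (ℕ × ℕ × ℕ × ℕ)) (σ : ℕ × ℕ × ℕ × ℕ) =>
      (Nat.pair p.2.1 σ.1, Nat.pair p.2.2.1 σ.2.1, Nat.pair p.2.2.2.1 σ.2.2.1,
        Nat.pair p.2.2.2.2 σ.2.2.2) :=
    (Primrec₂.natPair.comp (Primrec.fst.comp hτ) (Primrec.fst.comp hσ)).pair
      ((Primrec₂.natPair.comp (Primrec.fst.comp (Primrec.snd.comp hτ))
        (Primrec.fst.comp (Primrec.snd.comp hσ))).pair
      ((Primrec₂.natPair.comp (Primrec.fst.comp (Primrec.snd.comp (Primrec.snd.comp hτ)))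
        (Primrec.fst.comp (Primrec.snd.comp (Primrec.snd.comp hσ)))).pair
      (Primrec₂.natPair.comp (Primrec.snd.comp (Primrec.snd.comp (Primrec.snd.comp hτ)))
        (Primrec.snd.comp (Primrec.snd.comp (Primrec.snd.comp hσ))))))
  exact (Primrec.list_flatMap (Primrec.fst.comp hA)
    (Primrec.list_map (Primrec.fst.comp (hB.comp Primrec.fst)) htrans).to₂).pair
    ((hpair (Primrec.fst.comp (Primrec.snd.comp hA)) (Primrec.fst.comp (Primrec.snd.comp hB))).pair
      (hpair (Primrec.snd.comp (Primrec.snd.comp hA)) (Primrec.snd.comp (Primrec.snd.comp hB))))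

/-- The list of states is obtained by choice but does not depend on the parameter, so induction on
it suffices. -/
theorem primrec_flatMap_const {δ : Type} (L : List δ) {f : δ → γ → List β}
    (hf : ∀ d, Primrec (f d)) : Primrec fun e => L.flatMap fun d => f d e := by
  induction L with
  | nil => exact Primrec.const []
  | cons d L ih => exact Primrec.list_append.comp (hf d) ih

end Primrec

end Automaton

end TreeAutomatic

/-! ### Counting runs -/

namespace TreeAutomatic

open BinaryTree

/-- The first components of the labels of a tree, read as codes of pairs. -/
def mapFst (t : BinaryTree ℕ) : BinaryTree ℕ := t.map fun a => a.unpair.1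

/-- The second components of the labels of a tree, read as codes of pairs. -/
def mapSnd (t : BinaryTree ℕ) : BinaryTree ℕ := t.map fun a => a.unpair.2

/-- The tree obtained by forgetting the labels. -/
def shape {α : Type} (t : BinaryTree α) : BinaryTree Unit := t.map fun _ => ()

section RunAutomaton

variable {Q : Type} [Fintype Q] (num : Q → ℕ) (c : Q → Q → Q → ℕ) (fin : Q → Bool)

/-- The label that records a transition and a copy of it. -/
def runLabel (q i j m : ℕ) : ℕ := Nat.pair q (Nat.pair i (Nat.pair j m))

/-- The transitions of the automaton that accepts the runs of a weighted automaton; a transition of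
weight `n` is represented by `n` copies. -/
noncomputable def runTransitions : List (ℕ × ℕ × ℕ × ℕ) :=
  Finset.univ.toList.flatMap fun q : Q => Finset.univ.toList.flatMap fun i : Q =>
    Finset.univ.toList.flatMap fun j : Q => (List.range (c q i j)).map fun m =>
      (num q, runLabel (num q) (num i) (num j) m, num i, num j)

/-- The automaton that accepts the runs of a weighted automaton. -/
noncomputable def runAutomaton (q₀ : Q) : Automaton ℕ :=
  (runTransitions num c, [num q₀], (Finset.univ.toList.filter fin).map num)

variable {num c fin}

theorem mem_runTransitions {q a i j : ℕ} : (q, a, i, j) ∈ runTransitions num c ↔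
    ∃ q' i' j' m, m < c q' i' j' ∧ num q' = q ∧ runLabel q i j m = a ∧ num i' = i ∧ num j' = j := by
  simp only [runTransitions, List.mem_flatMap, Finset.mem_toList, Finset.mem_univ, true_and,
    List.mem_map, List.mem_range, Prod.mk.injEq]
  constructor
  · rintro ⟨q, i, j, m, hm, rfl, rfl, rfl, rfl⟩
    exact ⟨q, i, j, m, hm, rfl, rfl, rfl, rfl⟩
  · rintro ⟨q, i, j, m, hm, rfl, rfl, rfl, rfl⟩
    exact ⟨q, i, j, m, hm, rfl, rfl, rfl, rfl⟩

/-- The second components of the labels record the transition used at each node and the number of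
its copy, so a labeling is the same as a run with chosen copies. Splitting at the root gives the
recursion that defines X. Finiteness is part of the induction because the cardinality of a sigma
type is a sum only for finite fibers. -/
theorem card_runs (hnum : Function.Injective num) {X : Q → BinaryTree Unit → ℕ}
    (hn : ∀ q, X q nil = (fin q).toNat)
    (hs : ∀ q l r, X q (node () l r) = ∑ i, ∑ j, c q i j * (X i l * X j r)) (q₀ : Q)
    (d : BinaryTree ℕ) (q : Q) :
    Finite {s // mapFst s = d ∧ (runAutomaton num c fin q₀).RunFrom (mapSnd s) (num q)} ∧
      Nat.card {s // mapFst s = d ∧ (runAutomaton num c fin q₀).RunFrom (mapSnd s) (num q)} =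
        X q (shape d) := by
  induction d generalizing q with
  | nil =>
    have hnil : ∀ s, mapFst s = nil ↔ s = nil := by
      rintro (_ | ⟨a, l, r⟩) <;> simp [mapFst, BinaryTree.map]
    have hfin : (runAutomaton num c fin q₀).RunFrom (mapSnd nil) (num q) ↔ fin q = true := by
      simp [Automaton.RunFrom, Automaton.final, runAutomaton, mapSnd, BinaryTree.map,
        hnum.eq_iff]
    have hsub : Subsingleton
        {s // mapFst s = nil ∧ (runAutomaton num c fin q₀).RunFrom (mapSnd s) (num q)} :=
      ⟨fun s t => Subtype.ext (((hnil _).1 s.2.1).trans ((hnil _).1 t.2.1).symm)⟩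
    refine ⟨inferInstance, ?_⟩
    rw [shape, BinaryTree.map, hn]
    cases hq : fin q with
    | true =>
      have : Nonempty
          {s // mapFst s = nil ∧ (runAutomaton num c fin q₀).RunFrom (mapSnd s) (num q)} :=
        ⟨⟨nil, rfl, hfin.2 hq⟩⟩
      exact Nat.card_unique
    | false =>
      have : IsEmpty
          {s // mapFst s = nil ∧ (runAutomaton num c fin q₀).RunFrom (mapSnd s) (num q)} := by
        refine ⟨fun ⟨s, h1, h2⟩ => ?_⟩
        rw [(hnil s).1 h1, hfin, hq] at h2
        exact Bool.false_ne_true h2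
      exact Nat.card_of_isEmpty
  | node a l r hl hr =>
    let S : BinaryTree ℕ → Q → Type := fun d q =>
      {s // mapFst s = d ∧ (runAutomaton num c fin q₀).RunFrom (mapSnd s) (num q)}
    let f : (Σ i : Q, Σ j : Q, Fin (c q i j) × S l i × S r j) → S (node a l r) q := fun p =>
      ⟨node (Nat.pair a (runLabel (num q) (num p.1) (num p.2.1) p.2.2.1)) p.2.2.2.1.1 p.2.2.2.2.1, by
        refine ⟨?_, num p.1, num p.2.1, ?_, p.2.2.2.1.2.2, p.2.2.2.2.2.2⟩
        · have h1 := p.2.2.2.1.2.1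
          have h2 := p.2.2.2.2.2.1
          simp only [mapFst] at h1 h2 ⊢
          rw [BinaryTree.map, h1, h2, Nat.unpair_pair]
        · exact mem_runTransitions.2 ⟨q, p.1, p.2.1, _, p.2.2.1.2, rfl, by simp, rfl, rfl⟩⟩
    have hf : Function.Bijective f := by
      constructor
      · rintro ⟨i, j, m, ⟨s, hs⟩, ⟨t, ht⟩⟩ ⟨i', j', m', ⟨s', hs'⟩, ⟨t', ht'⟩⟩ h
        have h := Subtype.ext_iff.1 h
        simp only [f, node.injEq, Nat.pair_eq_pair, runLabel, true_and] at h
        obtain ⟨⟨h1, h2, h3⟩, rfl, rfl⟩ := h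
        obtain rfl := hnum h1
        obtain rfl := hnum h2
        obtain rfl := Fin.ext h3
        rfl
      · rintro ⟨_ | ⟨b, s, t⟩, h1, h2⟩
        · simp [mapFst, BinaryTree.map] at h1
        · simp only [mapFst, BinaryTree.map, node.injEq] at h1
          obtain ⟨rfl, rfl, rfl⟩ := h1
          obtain ⟨i, j, hτ, h2, h3⟩ := h2
          obtain ⟨q', i', j', m, hm, hq, hlab, rfl, rfl⟩ := mem_runTransitions.1 hτ
          obtain rfl := hnum hq
          refine ⟨⟨i', j', ⟨m, hm⟩, ⟨s, rfl, h2⟩, ⟨t, rfl, h3⟩⟩, Subtype.ext ?_⟩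
          simp only [f, hlab, Nat.pair_unpair]
    have hfinl : ∀ i, Finite (S l i) := fun i => (hl i).1
    have hfinr : ∀ i, Finite (S r i) := fun i => (hr i).1
    have hcl : ∀ i, Nat.card (S l i) = X i (shape l) := fun i => (hl i).2
    have hcr : ∀ i, Nat.card (S r i) = X i (shape r) := fun i => (hr i).2
    refine ⟨Finite.of_surjective f hf.2, ?_⟩
    have hsh : shape (node a l r) = node () (shape l) (shape r) := rfl
    change Nat.card (S (node a l r) q) = _
    rw [← Nat.card_congr (Equiv.ofBijective f hf), hsh, hs]
    simp only [Nat.card_sigma, Nat.card_prod, hcl, hcr, Nat.card_fin]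

end RunAutomaton

/-- A recognizable series counts the ways in which the labels of a nonempty tree can be extended to
an accepted run. -/
theorem Recognizable.exists_runAutomaton {F : ℕ → BinaryTree Unit → ℕ} (hF : Recognizable F) :
    ∃ (B : ℕ → Automaton ℕ) (q₀ : ℕ), Primrec B ∧ ∀ e, (B e).initial = [q₀] ∧
      ∀ d : BinaryTree ℕ, d ≠ nil →
        Nat.card {s // mapFst s = d ∧ (B e).RunFrom (mapSnd s) q₀} = F e (shape d) := by
  obtain ⟨Q, _, X, ι, c, fin, hι, hc, hn, hs, hF⟩ := hF
  let num : Option Q → ℕ := fun q => (Fintype.equivFin (Option Q) q : ℕ)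
  have hnum : Function.Injective num := fun a b h =>
    (Fintype.equivFin (Option Q)).injective (Fin.ext h)
  -- The extra state `none` becomes the only initial state, and its transitions absorb the initial
  -- weights. It is not final, so the count is right for nonempty trees only.
  let c' : Option Q → Option Q → Option Q → ℕ → ℕ := fun q i j => match q, i, j with
    | none, some i, some j => fun e => ∑ q, ι q e * c q i j e
    | some q, some i, some j => c q i j
    | _, _, _ => fun _ => 0
  let X' : ℕ → Option Q → BinaryTree Unit → ℕ := fun e q => match q with
    | none => fun t => if t = nil then 0 else F e t
    | some q => X e q
  let fin' : Option Q → Bool := fun q => match q with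
    | none => false
    | some q => fin q
  refine ⟨fun e => runAutomaton num (fun q i j => c' q i j e) fin' none, num none, ?_,
    fun e => ⟨rfl, fun d hd => ?_⟩⟩
  · refine Primrec.pair ?_ (Primrec.const _)
    refine Automaton.primrec_flatMap_const _ fun q => Automaton.primrec_flatMap_const _ fun i =>
      Automaton.primrec_flatMap_const _ fun j => ?_
    have hlab : Primrec₂ fun (_ m : ℕ) =>
        (num q, runLabel (num q) (num i) (num j) m, num i, num j) := by
      have : Primrec fun m : ℕ => runLabel (num q) (num i) (num j) m :=
        Primrec₂.natPair.comp (Primrec.const _) (Primrec₂.natPair.comp (Primrec.const _)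
          (Primrec₂.natPair.comp (Primrec.const _) Primrec.id))
      exact (Primrec.const _).pair ((this.comp Primrec.snd).pair (Primrec.const _))
    refine Primrec.list_map (Primrec.list_range.comp ?_) hlab
    rcases q with _ | q <;> rcases i with _ | i <;> rcases j with _ | j
    all_goals first
      | exact Primrec.const 0
      | exact hc q i j
      | exact primrec_finset_sum _ fun q => Primrec.nat_mul.comp (hι q) (hc q _ _)
  · refine (card_runs (X := X' e) hnum ?_ ?_ none d none).2.trans ?_
    · rintro (_ | q)
      exacts [rfl, hn e q]
    · rintro (_ | q) l r
      · simp only [X', c', Fintype.sum_option, reduceCtorEq, if_false, hF, hs, zero_mul, zero_add,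
          Finset.sum_const_zero, Finset.mul_sum, Finset.sum_mul]
        rw [Finset.sum_comm]
        refine Finset.sum_congr rfl fun i _ => ?_
        rw [Finset.sum_comm]
        refine Finset.sum_congr rfl fun j _ => ?_
        refine Finset.sum_congr rfl fun q _ => ?_
        ring
      · simp [X', c', hs]
    · cases d with
      | nil => exact absurd rfl hd
      | node a l r => simp [X', shape, BinaryTree.map]

/-! ### Pruning relabelings and convolution -/

section Prune

variable {α β γ : Type}

/-- Relabel a tree by `h`, and delete the subtrees at the nodes at which `h` is undefined. -/
def prune (h : α → Option β) : BinaryTree α → BinaryTree β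
  | nil => nil
  | node a l r =>
    match h a with
    | none => nil
    | some b => node b (prune h l) (prune h r)

/-- Below a node at which `h` is undefined, `h` is undefined. -/
def PruneClosed (h : α → Option β) : BinaryTree α → Prop
  | nil => True
  | node a l r => (h a = none → prune h l = nil ∧ prune h r = nil) ∧
      PruneClosed h l ∧ PruneClosed h r

theorem prune_map (f : α → β) (h : β → Option γ) (t : BinaryTree α) :
    prune h (t.map f) = prune (fun a => h (f a)) t := by
  induction t with
  | nil => rfl
  | node a l r hl hr => simp only [BinaryTree.map, prune, hl, hr]

theorem pruneClosed_map (f : α → β) (h : β → Option γ) (t : BinaryTree α) :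
    PruneClosed h (t.map f) ↔ PruneClosed (fun a => h (f a)) t := by
  induction t with
  | nil => exact Iff.rfl
  | node a l r hl hr => simp only [BinaryTree.map, PruneClosed, prune_map, hl, hr]

theorem prune_some_comp (f : α → β) (t : BinaryTree α) : prune (fun a => some (f a)) t = t.map f := by
  induction t with
  | nil => rfl
  | node a l r hl hr => simp only [BinaryTree.map, prune, hl, hr]

theorem pruneClosed_some (t : BinaryTree α) : PruneClosed (fun a => some a) t := by
  induction t with
  | nil => trivial
  | node a l r hl hr => exact ⟨by simp, hl, hr⟩

theorem prune_none (t : BinaryTree α) : prune (fun _ => (none : Option β)) t = nil := by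
  cases t <;> rfl

theorem prune_fst_conv (s : BinaryTree α) (t : BinaryTree β) : prune Prod.fst (conv s t) = s := by
  induction s generalizing t with
  | nil => rw [conv, prune_map]; exact prune_none t
  | node a l r hl hr =>
    cases t with
    | nil => rw [conv, prune_map]; exact (prune_some_comp id _).trans (id_map _)
    | node b l' r' => simp only [conv, prune, hl, hr]

theorem prune_snd_conv (s : BinaryTree α) (t : BinaryTree β) : prune Prod.snd (conv s t) = t := by
  induction s generalizing t with
  | nil => rw [conv, prune_map]; exact (prune_some_comp id _).trans (id_map _)
  | node a l r hl hr =>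
    cases t with
    | nil => rw [conv, prune_map]; exact prune_none _
    | node b l' r' => simp only [conv, prune, hl, hr]

theorem conv_nil_right (s : BinaryTree α) :
    conv s (nil : BinaryTree β) = s.map fun a => (some a, none) := by
  cases s <;> rfl

theorem map_of_prune_eq_nil {h : α → Option β} {t : BinaryTree α} (ht : PruneClosed h t)
    (h0 : prune h t = nil) : t.map (fun a => (some a, h a)) = t.map fun a => (some a, none) := by
  induction t with
  | nil => rfl
  | node a l r hl hr =>
    obtain ⟨h1, h2, h3⟩ := ht
    cases ha : h a with
    | none =>
      obtain ⟨h4, h5⟩ := h1 ha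
      simp only [BinaryTree.map, ha, hl h2 h4, hr h3 h5]
    | some b => simp [prune, ha] at h0

/-- If h stays undefined below the nodes where it is undefined, the deleted positions carry exactly
the padding symbol. So the convolution of a tree with its image is a mere relabeling, and an
automaton for the domain of the map yields one for its graph. -/
theorem conv_prune {h : α → Option β} {t : BinaryTree α} (ht : PruneClosed h t) :
    conv t (prune h t) = t.map fun a => (some a, h a) := by
  induction t with
  | nil => rfl
  | node a l r hl hr =>
    cases ha : h a with
    | none =>
      have : prune h (node a l r) = nil := by simp [prune, ha]
      rw [this, conv_nil_right, map_of_prune_eq_nil ht this]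
    | some b => simp only [prune, ha, conv, BinaryTree.map, hl ht.2.1, hr ht.2.2]

theorem conv_eq_map_iff {h : α → Option β} {s s' : BinaryTree α} {t : BinaryTree β}
    (hs : PruneClosed h s') :
    s'.map (fun a => (some a, h a)) = conv s t ↔ s' = s ∧ t = prune h s := by
  rw [← conv_prune hs]
  constructor
  · intro heq
    have h1 := congrArg (prune Prod.fst) heq
    have h2 := congrArg (prune Prod.snd) heq
    rw [prune_fst_conv, prune_fst_conv] at h1
    rw [prune_snd_conv, prune_snd_conv] at h2
    exact ⟨h1, by rw [← h1, h2]⟩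
  · rintro ⟨rfl, rfl⟩
    rfl

end Prune

end TreeAutomatic

/-! ### The presentation -/

namespace TreeAutomatic

open BinaryTree OrderForest

/-- The tree with all nodes labeled `a`. -/
def paint (a : ℕ) (t : BinaryTree Unit) : BinaryTree ℕ := t.map fun _ => a

theorem shape_paint (a : ℕ) (t : BinaryTree Unit) : shape (paint a t) = t := by
  induction t with
  | nil => rfl
  | node _ l r hl hr => exact congrArg₂ (node ()) hl hr

theorem paint_injective (a : ℕ) : Function.Injective (paint a) :=
  Function.LeftInverse.injective (shape_paint a)

theorem prune_paint_some {h : ℕ → Option ℕ} {a b : ℕ} (hab : h a = some b) (t : BinaryTree Unit) :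
    prune h (paint a t) = paint b t := by
  rw [paint, prune_map]
  simp only [hab]
  exact prune_some_comp _ t

theorem prune_paint_none {h : ℕ → Option ℕ} {a : ℕ} (ha : h a = none) (t : BinaryTree Unit) :
    prune h (paint a t) = nil := by
  rw [paint, prune_map]
  simp only [ha]
  exact prune_none t

theorem pruneClosed_paint (h : ℕ → Option ℕ) (a : ℕ) (t : BinaryTree Unit) :
    PruneClosed h (paint a t) := by
  induction t with
  | nil => trivial
  | node _ l r hl hr => exact ⟨fun ha => ⟨prune_paint_none ha l, prune_paint_none ha r⟩, hl, hr⟩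

/-- The node at level `0` given by `u`. -/
def nodeZero (u : BinaryTree Unit) : BinaryTree ℕ := node 0 (paint 0 u) nil

/-- The node at level `1` given by `u` and `x`. -/
def nodeOne (u x : BinaryTree Unit) : BinaryTree ℕ := node 1 (paint 0 u) (node 4 (paint 4 x) nil)

/-- The node at level `2` given by `u`, `x` and `w` for `ρ = 2`; for `ρ = 3` the tree of first
components of the nodes at level `3` below it. -/
def nodeTwo (ρ : ℕ) (u x w : BinaryTree Unit) : BinaryTree ℕ :=
  node ρ (paint 0 u) (node 4 (paint 4 x) (paint 5 w))

/-- The automaton that accepts the nodes at one of the levels up to `2`. -/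
def roleAutomaton (ρ m k : ℕ) : Automaton ℕ :=
  -- State 0 is the root, 1 a nonempty full tree with labels 0, 2 the empty tree, 3 the right child
  -- of the root, 4 and 5 arbitrary trees painted 4 and 5. The states m and k are those of the right
  -- subtrees at the root and at its right child: m = 2 stops at level 0, k = 2 at level 1, and k =
  -- 5 admits w.
  ([(0, ρ, 1, m), (1, 0, 1, 1), (1, 0, 2, 2), (3, 4, 4, k), (4, 4, 4, 4), (5, 5, 5, 5)],
    [0], [2, 4, 5])

section Role

variable {ρ m k : ℕ} {t : BinaryTree ℕ}

theorem runFrom_role_two : (roleAutomaton ρ m k).RunFrom t 2 ↔ t = nil := by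
  cases t <;> simp [Automaton.RunFrom, Automaton.final, Automaton.transitions, roleAutomaton]

theorem runFrom_role_paint {a : ℕ} (ha : a = 4 ∨ a = 5) :
    (roleAutomaton ρ m k).RunFrom t a ↔ ∃ x, t = paint a x := by
  induction t with
  | nil =>
    refine ⟨fun _ => ⟨nil, rfl⟩, fun _ => ?_⟩
    rcases ha with rfl | rfl <;> simp [Automaton.RunFrom, Automaton.final, roleAutomaton]
  | node b l r hl hr =>
    have htr : ∀ i j, (a, b, i, j) ∈ (roleAutomaton ρ m k).transitions ↔ b = a ∧ i = a ∧ j = a := by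
      intro i j
      rcases ha with rfl | rfl <;> simp [Automaton.transitions, roleAutomaton]
    simp only [Automaton.RunFrom, htr]
    constructor
    · rintro ⟨_, _, ⟨rfl, rfl, rfl⟩, h1, h2⟩
      obtain ⟨x, rfl⟩ := hl.1 h1
      obtain ⟨y, rfl⟩ := hr.1 h2
      exact ⟨node () x y, rfl⟩
    · rintro ⟨_ | ⟨_, x, y⟩, h⟩
      · simp [paint, BinaryTree.map] at h
      · simp only [paint, BinaryTree.map, node.injEq] at h
        obtain ⟨rfl, rfl, rfl⟩ := h
        exact ⟨_, _, ⟨rfl, rfl, rfl⟩, hl.2 ⟨x, rfl⟩, hr.2 ⟨y, rfl⟩⟩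

theorem paint_eq_nil_iff {a : ℕ} {x : BinaryTree Unit} : paint a x = nil ↔ x = nil := by
  cases x <;> simp [paint, BinaryTree.map]

theorem runFrom_role_full : (roleAutomaton ρ m k).RunFrom t 1 ↔ ∃ u ∈ Tbin, t = paint 0 u := by
  induction t with
  | nil =>
    simp only [Automaton.RunFrom, Automaton.final, roleAutomaton, List.mem_cons, OfNat.one_ne_ofNat,
      List.not_mem_nil, or_self, false_iff, not_exists, not_and]
    exact fun u hu h => hu.1 (paint_eq_nil_iff.1 h.symm)
  | node b l r hl hr =>
    have htr : ∀ i j, (1, b, i, j) ∈ (roleAutomaton ρ m k).transitions ↔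
        b = 0 ∧ (i = 1 ∧ j = 1 ∨ i = 2 ∧ j = 2) := by
      intro i j
      simp [Automaton.transitions, roleAutomaton]
      tauto
    simp only [Automaton.RunFrom, htr]
    constructor
    · rintro ⟨_, _, ⟨rfl, ⟨rfl, rfl⟩ | ⟨rfl, rfl⟩⟩, h1, h2⟩
      · obtain ⟨x, hx, rfl⟩ := hl.1 h1
        obtain ⟨y, hy, rfl⟩ := hr.1 h2
        exact ⟨node () x y, ⟨by simp, by simp [hx.1, hy.1], hx.2, hy.2⟩, rfl⟩
      · rw [runFrom_role_two] at h1 h2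
        subst h1 h2
        exact ⟨node () nil nil, ⟨by simp, Iff.rfl, trivial, trivial⟩, rfl⟩
    · rintro ⟨_ | ⟨_, x, y⟩, ⟨hu, hf⟩, h⟩
      · exact absurd rfl hu
      · simp only [paint, BinaryTree.map, node.injEq] at h
        obtain ⟨rfl, rfl, rfl⟩ := h
        obtain ⟨h1, h2, h3⟩ := hf
        by_cases hx : x = nil
        · obtain rfl := h1.1 hx
          subst hx
          exact ⟨2, 2, ⟨rfl, Or.inr ⟨rfl, rfl⟩⟩, runFrom_role_two.2 rfl, runFrom_role_two.2 rfl⟩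
        · exact ⟨1, 1, ⟨rfl, Or.inl ⟨rfl, rfl⟩⟩, hl.2 ⟨x, ⟨hx, h2⟩, rfl⟩,
            hr.2 ⟨y, ⟨fun hy => hx (h1.2 hy), h3⟩, rfl⟩⟩

theorem runFrom_role_middle : (roleAutomaton ρ m k).RunFrom t 3 ↔
    ∃ x s, t = node 4 (paint 4 x) s ∧ (roleAutomaton ρ m k).RunFrom s k := by
  cases t with
  | nil => simp [Automaton.RunFrom, Automaton.final, roleAutomaton]
  | node b l r =>
    have htr : ∀ i j, (3, b, i, j) ∈ (roleAutomaton ρ m k).transitions ↔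
        b = 4 ∧ i = 4 ∧ j = k := by
      intro i j
      simp [Automaton.transitions, roleAutomaton]
    simp only [Automaton.RunFrom, htr]
    constructor
    · rintro ⟨_, _, ⟨rfl, rfl, rfl⟩, h1, h2⟩
      obtain ⟨x, rfl⟩ := (runFrom_role_paint (Or.inl rfl)).1 h1
      exact ⟨x, r, rfl, h2⟩
    · rintro ⟨x, s, h, h2⟩
      simp only [node.injEq] at h
      obtain ⟨rfl, rfl, rfl⟩ := h
      exact ⟨_, _, ⟨rfl, rfl, rfl⟩, (runFrom_role_paint (Or.inl rfl)).2 ⟨x, rfl⟩, h2⟩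

theorem runFrom_role_root : (roleAutomaton ρ m k).RunFrom t 0 ↔
    ∃ u ∈ Tbin, ∃ s, t = node ρ (paint 0 u) s ∧ (roleAutomaton ρ m k).RunFrom s m := by
  cases t with
  | nil => simp [Automaton.RunFrom, Automaton.final, roleAutomaton]
  | node b l r =>
    have htr : ∀ i j, (0, b, i, j) ∈ (roleAutomaton ρ m k).transitions ↔
        b = ρ ∧ i = 1 ∧ j = m := by
      intro i j
      simp [Automaton.transitions, roleAutomaton]
    simp only [Automaton.RunFrom, htr]
    constructor
    · rintro ⟨_, _, ⟨rfl, rfl, rfl⟩, h1, h2⟩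
      obtain ⟨u, hu, rfl⟩ := runFrom_role_full.1 h1
      exact ⟨u, hu, r, rfl, h2⟩
    · rintro ⟨u, hu, s, h, h2⟩
      simp only [node.injEq] at h
      obtain ⟨rfl, rfl, rfl⟩ := h
      exact ⟨_, _, ⟨rfl, rfl, rfl⟩, runFrom_role_full.2 ⟨u, hu, rfl⟩, h2⟩

theorem runFrom_nodeZero : (roleAutomaton 0 2 2).RunFrom t 0 ↔ ∃ u ∈ Tbin, t = nodeZero u := by
  rw [runFrom_role_root]
  simp [runFrom_role_two, nodeZero]

theorem runFrom_nodeOne :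
    (roleAutomaton 1 3 2).RunFrom t 0 ↔ ∃ u ∈ Tbin, ∃ x, t = nodeOne u x := by
  rw [runFrom_role_root]
  simp [runFrom_role_middle, runFrom_role_two, nodeOne]

theorem runFrom_nodeTwo :
    (roleAutomaton ρ 3 5).RunFrom t 0 ↔ ∃ u ∈ Tbin, ∃ x w, t = nodeTwo ρ u x w := by
  rw [runFrom_role_root]
  simp only [runFrom_role_middle, runFrom_role_paint (Or.inr rfl), nodeTwo]
  constructor
  · rintro ⟨u, hu, _, rfl, x, _, rfl, w, rfl⟩
    exact ⟨u, hu, x, w, rfl⟩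
  · rintro ⟨u, hu, x, w, rfl⟩
    exact ⟨u, hu, _, rfl, x, _, rfl, w, rfl⟩

theorem mem_language_role : t ∈ (roleAutomaton ρ m k).language ↔
    (roleAutomaton ρ m k).RunFrom t 0 := by
  simp only [Automaton.language, Automaton.initial, roleAutomaton, List.mem_singleton,
    exists_eq_left, Set.mem_ofPred_eq, and_iff_right_iff_imp]
  rintro h rfl
  simp [Automaton.RunFrom, Automaton.final] at h

end Role

/-- The label map of the projection to level `0`. -/
def toZero (a : ℕ) : Option ℕ := [0, 0, 0, 0][a]?

/-- The label map of the projection to level `1`. -/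
def toOne (a : ℕ) : Option ℕ := [0, 1, 1, 1, 4][a]?

/-- The label map of the projection to level `2`. -/
def toTwo (a : ℕ) : Option ℕ := [0, 1, 2, 2, 4, 5][a]?

section Presentation

variable (B : Automaton ℕ)

/-- The automaton for the nodes at level `3`. -/
def leafAutomaton : Automaton ℕ := Automaton.prod (roleAutomaton 3 3 5) B

/-- The automata for the levels, with the label maps of the projections to the levels above. -/
def projections : List (Automaton ℕ × (ℕ → Option ℕ)) :=
  [(roleAutomaton 0 2 2, fun a => some a),
    (roleAutomaton 1 3 2, toZero), (roleAutomaton 1 3 2, fun a => some a),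
    (roleAutomaton 2 3 5, toZero), (roleAutomaton 2 3 5, toOne),
    (roleAutomaton 2 3 5, fun a => some a),
    (leafAutomaton B, fun a => toZero a.unpair.1), (leafAutomaton B, fun a => toOne a.unpair.1),
    (leafAutomaton B, fun a => toTwo a.unpair.1), (leafAutomaton B, fun a => some a)]

/-- The union of the automata for the graphs of the given projections. -/
def graphAutomaton : List (Automaton ℕ × (ℕ → Option ℕ)) → Automaton (Option ℕ × Option ℕ)
  | [] => ([], [], [])
  | p :: L => Automaton.union (Automaton.relabel (fun a => (some a, p.2 a)) p.1) (graphAutomaton L)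

/-- The presentation of the forest. -/
def forestPresentation : Presentation :=
  (Automaton.normalize (Automaton.union (roleAutomaton 0 2 2) (Automaton.union
    (roleAutomaton 1 3 2) (Automaton.union (roleAutomaton 2 3 5) (leafAutomaton B)))),
    Automaton.normalize (graphAutomaton (projections B)))

theorem primrec_forestPresentation {B : ℕ → Automaton ℕ} (hB : Primrec B) :
    Primrec fun e => forestPresentation (B e) := by
  have hleaf : Primrec fun e => leafAutomaton (B e) :=
    Automaton.primrec_prod (Primrec.const (roleAutomaton 3 3 5)) hB
  have hrole : ∀ ρ m k, Primrec fun _ : ℕ => roleAutomaton ρ m k := fun ρ m k => Primrec.const _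
  have hpair : ∀ {h : ℕ → Option ℕ}, Primrec h → Primrec fun a : ℕ => (some a, h a) := fun h =>
    Primrec.option_some.pair h
  have hcons : ∀ {A : ℕ → Automaton ℕ} {h : ℕ → Option ℕ}
      {L : ℕ → List (Automaton ℕ × (ℕ → Option ℕ))}, Primrec A → Primrec h →
      Primrec (fun e => graphAutomaton (L e)) →
      Primrec fun e => graphAutomaton ((A e, h) :: L e) := fun hA hh hL =>
    Automaton.primrec_union (Automaton.primrec_relabel hA (hpair hh)) hL
  have h0 : Primrec toZero := Primrec.list_getElem?₁ _
  have h1 : Primrec toOne := Primrec.list_getElem?₁ _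
  have h2 : Primrec toTwo := Primrec.list_getElem?₁ _
  have hu : Primrec fun a : ℕ => a.unpair.1 := Primrec.fst.comp Primrec.unpair
  have hid : Primrec fun a : ℕ => some a := Primrec.option_some
  refine (Automaton.primrec_normalize (Automaton.primrec_union (hrole 0 2 2)
    (Automaton.primrec_union (hrole 1 3 2) (Automaton.primrec_union (hrole 2 3 5) hleaf)))).pair
    (Automaton.primrec_normalize ?_)
  exact hcons (hrole 0 2 2) hid (hcons (hrole 1 3 2) h0 (hcons (hrole 1 3 2) hid
    (hcons (hrole 2 3 5) h0 (hcons (hrole 2 3 5) h1 (hcons (hrole 2 3 5) hid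
    (hcons hleaf (h0.comp hu) (hcons hleaf (h1.comp hu) (hcons hleaf (h2.comp hu)
    (hcons hleaf hid (L := fun _ => []) (Primrec.const _))))))))))

theorem language_graphAutomaton (L : List (Automaton ℕ × (ℕ → Option ℕ))) :
    (graphAutomaton L).language =
      {u | ∃ p ∈ L, ∃ s ∈ p.1.language, s.map (fun a => (some a, p.2 a)) = u} := by
  induction L with
  | nil =>
    ext u
    simp [graphAutomaton, Automaton.language, Automaton.initial]
  | cons p L ih =>
    ext u
    rw [graphAutomaton, Automaton.language_union, ih, Automaton.language_relabel]
    simp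

theorem domain_forestPresentation : (forestPresentation B).domain =
    (roleAutomaton 0 2 2).language ∪ ((roleAutomaton 1 3 2).language ∪
      ((roleAutomaton 2 3 5).language ∪ (leafAutomaton B).language)) := by
  rw [Presentation.domain, forestPresentation, Automaton.language_normalize,
    Automaton.language_union, Automaton.language_union, Automaton.language_union]

variable {B} {q₀ : ℕ}

/-- The leaves below the node at level `2` given by `u`, `x` and `w`. -/
def Leaf (B : Automaton ℕ) (q₀ : ℕ) (u x w : BinaryTree Unit) : Type :=
  {s // mapFst s = nodeTwo 3 u x w ∧ B.RunFrom (mapSnd s) q₀}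

theorem mem_language_leafAutomaton (hB : B.initial = [q₀]) {s : BinaryTree ℕ} :
    s ∈ (leafAutomaton B).language ↔
      ∃ u ∈ Tbin, ∃ x w, mapFst s = nodeTwo 3 u x w ∧ B.RunFrom (mapSnd s) q₀ := by
  have hinit : (leafAutomaton B).initial = [Nat.pair 0 q₀] := by
    have hB' : B.2.1 = [q₀] := hB
    simp [leafAutomaton, Automaton.initial, Automaton.prod, roleAutomaton, hB']
  have hrun : (leafAutomaton B).RunFrom s (Nat.pair 0 q₀) ↔
      ∃ u ∈ Tbin, ∃ x w, mapFst s = nodeTwo 3 u x w ∧ B.RunFrom (mapSnd s) q₀ := by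
    rw [leafAutomaton, Automaton.runFrom_prod, runFrom_nodeTwo]
    constructor
    · rintro ⟨⟨u, hu, x, w, h⟩, h'⟩
      exact ⟨u, hu, x, w, h, h'⟩
    · rintro ⟨u, hu, x, w, h, h'⟩
      exact ⟨⟨u, hu, x, w, h⟩, h'⟩
  simp only [Automaton.language, hinit, List.mem_singleton, exists_eq_left, hrun, Set.mem_ofPred_eq,
    and_iff_right_iff_imp]
  rintro ⟨u, hu, x, w, h, -⟩ rfl
  simp [mapFst, BinaryTree.map, nodeTwo] at h

theorem mem_language_zero {t : BinaryTree ℕ} :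
    t ∈ (roleAutomaton 0 2 2).language ↔ ∃ u ∈ Tbin, t = nodeZero u :=
  mem_language_role.trans runFrom_nodeZero

theorem mem_language_one {t : BinaryTree ℕ} :
    t ∈ (roleAutomaton 1 3 2).language ↔ ∃ u ∈ Tbin, ∃ x, t = nodeOne u x :=
  mem_language_role.trans runFrom_nodeOne

theorem mem_language_two {t : BinaryTree ℕ} :
    t ∈ (roleAutomaton 2 3 5).language ↔ ∃ u ∈ Tbin, ∃ x w, t = nodeTwo 2 u x w :=
  mem_language_role.trans runFrom_nodeTwo

/-! #### Projections of the nodes -/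

/-- The labels mark the parts: 0 for u, 4 for x and 5 for w. A label map that is undefined at 4 or 5
thus deletes the parts that a higher level lacks, and it resets the root label, which tells the
level. -/
theorem prune_toZero_nodeOne (u x : BinaryTree Unit) : prune toZero (nodeOne u x) = nodeZero u := by
  simp [nodeOne, nodeZero, prune, toZero, prune_paint_some (h := toZero) (a := 0) (b := 0) rfl]

theorem prune_toZero_nodeTwo {ρ : ℕ} (hρ : ρ = 2 ∨ ρ = 3) (u x w : BinaryTree Unit) :
    prune toZero (nodeTwo ρ u x w) = nodeZero u := by
  rcases hρ with rfl | rfl <;>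
    simp [nodeTwo, nodeZero, prune, toZero, prune_paint_some (h := toZero) (a := 0) (b := 0) rfl]

theorem prune_toOne_nodeTwo {ρ : ℕ} (hρ : ρ = 2 ∨ ρ = 3) (u x w : BinaryTree Unit) :
    prune toOne (nodeTwo ρ u x w) = nodeOne u x := by
  rcases hρ with rfl | rfl <;>
    simp [nodeTwo, nodeOne, prune, toOne, prune_paint_some (h := toOne) (a := 0) (b := 0) rfl,
      prune_paint_some (h := toOne) (a := 4) (b := 4) rfl,
      prune_paint_none (h := toOne) (a := 5) rfl]

theorem prune_toTwo_nodeTwo (u x w : BinaryTree Unit) :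
    prune toTwo (nodeTwo 3 u x w) = nodeTwo 2 u x w := by
  simp [nodeTwo, prune, toTwo, prune_paint_some (h := toTwo) (a := 0) (b := 0) rfl,
    prune_paint_some (h := toTwo) (a := 4) (b := 4) rfl,
    prune_paint_some (h := toTwo) (a := 5) (b := 5) rfl]

theorem prune_some (t : BinaryTree ℕ) : prune (fun a => some a) t = t :=
  (prune_some_comp id t).trans (BinaryTree.id_map t)

theorem pruneClosed_nodeOne (u x : BinaryTree Unit) : PruneClosed toZero (nodeOne u x) := by
  refine ⟨fun h => by simp [toZero] at h, pruneClosed_paint _ _ _, fun _ => ⟨?_, rfl⟩,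
    pruneClosed_paint _ _ _, trivial⟩
  exact prune_paint_none rfl x

theorem pruneClosed_nodeTwo {h : ℕ → Option ℕ} (hh : h = toZero ∨ h = toOne ∨ h = toTwo) {ρ : ℕ}
    (hρ : ρ = 2 ∨ ρ = 3) (u x w : BinaryTree Unit) : PruneClosed h (nodeTwo ρ u x w) := by
  refine ⟨fun h0 => ?_, pruneClosed_paint _ _ _, fun h0 => ?_,
    pruneClosed_paint _ _ _, pruneClosed_paint _ _ _⟩
  · rcases hh with rfl | rfl | rfl <;> rcases hρ with rfl | rfl <;>
      simp [toZero, toOne, toTwo] at h0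
  · rcases hh with rfl | rfl | rfl
    · exact ⟨prune_paint_none rfl x, prune_paint_none rfl w⟩
    · simp [toOne] at h0
    · simp [toTwo] at h0

theorem prune_unpair_fst (h : ℕ → Option ℕ) (s : BinaryTree ℕ) :
    prune (fun a => h a.unpair.1) s = prune h (mapFst s) := (prune_map _ _ _).symm

theorem pruneClosed_unpair_fst (h : ℕ → Option ℕ) (s : BinaryTree ℕ) :
    PruneClosed (fun a => h a.unpair.1) s ↔ PruneClosed h (mapFst s) := (pruneClosed_map _ _ _).symm

theorem pruneClosed_projections (hB : B.initial = [q₀]) {p : Automaton ℕ × (ℕ → Option ℕ)}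
    (hp : p ∈ projections B) {s : BinaryTree ℕ} (hs : s ∈ p.1.language) :
    PruneClosed p.2 s ∧ prune p.2 s ∈ (forestPresentation B).domain := by
  rw [domain_forestPresentation]
  simp only [projections, List.mem_cons, List.not_mem_nil, or_false] at hp
  rcases hp with rfl | rfl | rfl | rfl | rfl | rfl | rfl | rfl | rfl | rfl
  · exact ⟨pruneClosed_some s, Or.inl (by rwa [prune_some])⟩
  · obtain ⟨u, hu, x, rfl⟩ := mem_language_one.1 hs
    exact ⟨pruneClosed_nodeOne u x, Or.inl (mem_language_zero.2 ⟨u, hu, prune_toZero_nodeOne u x⟩)⟩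
  · exact ⟨pruneClosed_some s, Or.inr (Or.inl (by rwa [prune_some]))⟩
  · obtain ⟨u, hu, x, w, rfl⟩ := mem_language_two.1 hs
    exact ⟨pruneClosed_nodeTwo (by simp) (by simp) u x w,
      Or.inl (mem_language_zero.2 ⟨u, hu, prune_toZero_nodeTwo (by simp) u x w⟩)⟩
  · obtain ⟨u, hu, x, w, rfl⟩ := mem_language_two.1 hs
    exact ⟨pruneClosed_nodeTwo (by simp) (by simp) u x w,
      Or.inr (Or.inl (mem_language_one.2 ⟨u, hu, x, prune_toOne_nodeTwo (by simp) u x w⟩))⟩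
  · exact ⟨pruneClosed_some s, Or.inr (Or.inr (Or.inl (by rwa [prune_some])))⟩
  · obtain ⟨u, hu, x, w, h, -⟩ := (mem_language_leafAutomaton hB).1 hs
    dsimp only
    rw [prune_unpair_fst, pruneClosed_unpair_fst, h]
    exact ⟨pruneClosed_nodeTwo (by simp) (by simp) u x w,
      Or.inl (mem_language_zero.2 ⟨u, hu, prune_toZero_nodeTwo (by simp) u x w⟩)⟩
  · obtain ⟨u, hu, x, w, h, -⟩ := (mem_language_leafAutomaton hB).1 hs
    dsimp only
    rw [prune_unpair_fst, pruneClosed_unpair_fst, h]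
    exact ⟨pruneClosed_nodeTwo (by simp) (by simp) u x w,
      Or.inr (Or.inl (mem_language_one.2 ⟨u, hu, x, prune_toOne_nodeTwo (by simp) u x w⟩))⟩
  · obtain ⟨u, hu, x, w, h, -⟩ := (mem_language_leafAutomaton hB).1 hs
    dsimp only
    rw [prune_unpair_fst, pruneClosed_unpair_fst, h]
    exact ⟨pruneClosed_nodeTwo (by simp) (by simp) u x w,
      Or.inr (Or.inr (Or.inl (mem_language_two.2 ⟨u, hu, x, w, prune_toTwo_nodeTwo u x w⟩)))⟩
  · exact ⟨pruneClosed_some s, Or.inr (Or.inr (Or.inr (by rwa [prune_some])))⟩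

theorem language_order : (forestPresentation B).2.language =
    {u | ∃ p ∈ projections B, ∃ s ∈ p.1.language, s.map (fun a => (some a, p.2 a)) = u} := by
  rw [forestPresentation, Automaton.language_normalize, language_graphAutomaton]

theorem mem_domain_of_mem_language {p : Automaton ℕ × (ℕ → Option ℕ)} (hp : p ∈ projections B)
    {s : BinaryTree ℕ} (hs : s ∈ p.1.language) : s ∈ (forestPresentation B).domain := by
  rw [domain_forestPresentation]
  simp only [projections, List.mem_cons, List.not_mem_nil, or_false] at hp
  rcases hp with rfl | rfl | rfl | rfl | rfl | rfl | rfl | rfl | rfl | rfl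
  all_goals simp only [Set.mem_union]; tauto

theorem isPresentation_forestPresentation (hB : B.initial = [q₀]) :
    (forestPresentation B).IsPresentation := by
  refine ⟨Automaton.wellFormed_normalize _, Automaton.wellFormed_normalize _, ?_⟩
  intro u hu
  rw [language_order] at hu
  obtain ⟨p, hp, s, hs, rfl⟩ := hu
  obtain ⟨h1, h2⟩ := pruneClosed_projections hB hp hs
  exact ⟨s, mem_domain_of_mem_language hp hs, _, h2, (conv_prune h1).symm⟩

/-- The order is the union of the graphs of ten partial maps; each is the identity on a level or a
projection from a level to a higher one in the order. -/
theorem conv_mem_language_iff (hB : B.initial = [q₀]) {s t : BinaryTree ℕ} :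
    conv s t ∈ (forestPresentation B).2.language ↔
      ∃ p ∈ projections B, s ∈ p.1.language ∧ t = prune p.2 s := by
  rw [language_order]
  constructor
  · rintro ⟨p, hp, s', hs', h⟩
    obtain ⟨rfl, rfl⟩ := (conv_eq_map_iff (pruneClosed_projections hB hp hs').1).1 h
    exact ⟨p, hp, hs', rfl⟩
  · rintro ⟨p, hp, hs, rfl⟩
    exact ⟨p, hp, s, hs, (conv_prune (pruneClosed_projections hB hp hs).1).symm⟩

end Presentation

end TreeAutomatic

/-! ### The presented forest -/

namespace OrderForest

theorem iso_subtree_of_iso {V W : Type} {r : V → V → Prop} {s : W → W → Prop} (f : r ≃r s) (p : V) :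
    Iso (subtree r p) (subtree s (f p)) :=
  ⟨⟨f.toEquiv.subtypeEquiv fun _ => f.map_rel_iff.symm, f.map_rel_iff⟩⟩

end OrderForest

namespace TreeAutomatic

open BinaryTree OrderForest

variable {B : Automaton ℕ} {q₀ : ℕ}

/-- The nodes of the forest. -/
abbrev ForestNode (B : Automaton ℕ) (q₀ : ℕ) : Type :=
  Σ u : Tbin, Option (Σ x : BinaryTree Unit, Option (Σ w : BinaryTree Unit,
    Option (Leaf B q₀ u x w)))

/-- The tree of the nodes of the forest below the root given by `u`. -/
def componentOrder (B : Automaton ℕ) (q₀ : ℕ) (u : BinaryTree Unit) :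
    Option (Σ x : BinaryTree Unit, Option (Σ w : BinaryTree Unit, Option (Leaf B q₀ u x w))) →
    Option (Σ x : BinaryTree Unit, Option (Σ w : BinaryTree Unit, Option (Leaf B q₀ u x w))) →
      Prop :=
  AddTop (DisjointUnion fun x => AddTop (DisjointUnion fun w => AddTop (@Eq (Leaf B q₀ u x w))))

/-- The order of the forest. -/
def forestOrder (B : Automaton ℕ) (q₀ : ℕ) : ForestNode B q₀ → ForestNode B q₀ → Prop :=
  DisjointUnion fun u : Tbin => componentOrder B q₀ u

/-- The tree that represents a node of the forest. -/
def encodeNode : ForestNode B q₀ → BinaryTree ℕ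
  | ⟨u, none⟩ => nodeZero u
  | ⟨u, some ⟨x, none⟩⟩ => nodeOne u x
  | ⟨u, some ⟨x, some ⟨w, none⟩⟩⟩ => nodeTwo 2 u x w
  | ⟨_, some ⟨_, some ⟨_, some s⟩⟩⟩ => s.1

/-- The label of the root. -/
def rootLabel : BinaryTree ℕ → ℕ
  | nil => 0
  | node a _ _ => a

/-- The root label of a leaf codes a pair with first component 3 and so is at least 3. Thus leaves
never collide with the nodes at levels 0, 1 and 2, whose labels are not paired. -/
theorem rootLabel_leaf {s : BinaryTree ℕ} {u x w : BinaryTree Unit}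
    (h : mapFst s = nodeTwo 3 u x w) : 3 ≤ rootLabel s := by
  cases s with
  | nil => simp [mapFst, BinaryTree.map, nodeTwo] at h
  | node a l r =>
    simp only [mapFst, BinaryTree.map, nodeTwo, node.injEq] at h
    exact h.1 ▸ Nat.unpair_left_le a

theorem nodeTwo_injective {ρ : ℕ} {u x w u' x' w' : BinaryTree Unit}
    (h : nodeTwo ρ u x w = nodeTwo ρ u' x' w') : u = u' ∧ x = x' ∧ w = w' := by
  simpa [nodeTwo, (paint_injective _).eq_iff] using h

theorem encodeNode_injective : Function.Injective (encodeNode (B := B) (q₀ := q₀)) := by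
  rintro ⟨⟨u, hu⟩, _ | ⟨x, _ | ⟨w, _ | s⟩⟩⟩ ⟨⟨u', hu'⟩, _ | ⟨x', _ | ⟨w', _ | s'⟩⟩⟩ h
  case some.some.some.some.some.some =>
    have h1 := s.2.1
    rw [show s.1 = s'.1 from h, s'.2.1] at h1
    obtain ⟨rfl, rfl, rfl⟩ := nodeTwo_injective h1
    obtain rfl : s = s' := Subtype.ext h
    rfl
  case some.some.none.some.some.none =>
    obtain ⟨rfl, rfl, rfl⟩ := nodeTwo_injective h
    rfl
  case some.none.some.none =>
    simp only [encodeNode, nodeOne, node.injEq, (paint_injective _).eq_iff, true_and, and_true] at h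
    obtain ⟨rfl, rfl⟩ := h
    rfl
  case none.none =>
    simp only [encodeNode, nodeZero, node.injEq, (paint_injective _).eq_iff, true_and, and_true] at h
    obtain rfl := h
    rfl
  all_goals
    exfalso
    have h1 := congrArg rootLabel h
    first
      | exact absurd ((rootLabel_leaf s.2.1).trans_eq h1)
          (by simp [encodeNode, nodeZero, nodeOne, nodeTwo, rootLabel])
      | exact absurd ((rootLabel_leaf s'.2.1).trans_eq h1.symm)
          (by simp [encodeNode, nodeZero, nodeOne, nodeTwo, rootLabel])
      | exact absurd h1 (by simp [encodeNode, nodeZero, nodeOne, nodeTwo, rootLabel])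

theorem range_encodeNode (hB : B.initial = [q₀]) :
    Set.range (encodeNode (B := B) (q₀ := q₀)) = (forestPresentation B).domain := by
  rw [domain_forestPresentation]
  ext t
  simp only [Set.mem_union, mem_language_zero, mem_language_one, mem_language_two,
    mem_language_leafAutomaton hB]
  constructor
  · rintro ⟨⟨⟨u, hu⟩, _ | ⟨x, _ | ⟨w, _ | s⟩⟩⟩, rfl⟩
    · exact Or.inl ⟨u, hu, rfl⟩
    · exact Or.inr (Or.inl ⟨u, hu, x, rfl⟩)
    · exact Or.inr (Or.inr (Or.inl ⟨u, hu, x, w, rfl⟩))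
    · exact Or.inr (Or.inr (Or.inr ⟨u, hu, x, w, s.2⟩))
  · rintro (⟨u, hu, rfl⟩ | ⟨u, hu, x, rfl⟩ | ⟨u, hu, x, w, rfl⟩ | ⟨u, hu, x, w, h⟩)
    · exact ⟨⟨⟨u, hu⟩, none⟩, rfl⟩
    · exact ⟨⟨⟨u, hu⟩, some ⟨x, none⟩⟩, rfl⟩
    · exact ⟨⟨⟨u, hu⟩, some ⟨x, some ⟨w, none⟩⟩⟩, rfl⟩
    · exact ⟨⟨⟨u, hu⟩, some ⟨x, some ⟨w, some ⟨t, h⟩⟩⟩⟩, rfl⟩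

theorem rootLabel_of_mem {t : BinaryTree ℕ} (hB : B.initial = [q₀]) :
    (t ∈ (roleAutomaton 0 2 2).language → rootLabel t = 0) ∧
    (t ∈ (roleAutomaton 1 3 2).language → rootLabel t = 1) ∧
    (t ∈ (roleAutomaton 2 3 5).language → rootLabel t = 2) ∧
    (t ∈ (leafAutomaton B).language → 3 ≤ rootLabel t) := by
  rw [mem_language_zero, mem_language_one, mem_language_two, mem_language_leafAutomaton hB]
  refine ⟨?_, ?_, ?_, ?_⟩
  · rintro ⟨u, _, rfl⟩
    rfl
  · rintro ⟨u, _, x, rfl⟩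
    rfl
  · rintro ⟨u, _, x, w, rfl⟩
    rfl
  · rintro ⟨u, _, x, w, h, -⟩
    exact rootLabel_leaf h

/-- The nodes above a node, including itself. -/
def ancestors : ForestNode B q₀ → List (ForestNode B q₀)
  | ⟨u, none⟩ => [⟨u, none⟩]
  | ⟨u, some ⟨x, none⟩⟩ => [⟨u, none⟩, ⟨u, some ⟨x, none⟩⟩]
  | ⟨u, some ⟨x, some ⟨w, none⟩⟩⟩ =>
    [⟨u, none⟩, ⟨u, some ⟨x, none⟩⟩, ⟨u, some ⟨x, some ⟨w, none⟩⟩⟩]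
  | ⟨u, some ⟨x, some ⟨w, some s⟩⟩⟩ =>
    [⟨u, none⟩, ⟨u, some ⟨x, none⟩⟩, ⟨u, some ⟨x, some ⟨w, none⟩⟩⟩,
      ⟨u, some ⟨x, some ⟨w, some s⟩⟩⟩]

theorem forestOrder_iff_mem_ancestors {m m' : ForestNode B q₀} :
    forestOrder B q₀ m m' ↔ m' ∈ ancestors m := by
  constructor
  · intro h
    obtain ⟨u, m⟩ := m
    obtain ⟨u', m'⟩ := m'
    obtain rfl : u = u' := DisjointUnion.fst_eq h
    rcases m' with _ | ⟨x', m'⟩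
    · rcases m with _ | ⟨x, _ | ⟨w, _ | s⟩⟩ <;> simp [ancestors]
    rcases m with _ | ⟨x, m⟩
    · simp [forestOrder, componentOrder] at h
    simp only [forestOrder, componentOrder, DisjointUnion.mk_mk, AddTop.some_some] at h
    obtain rfl : x = x' := DisjointUnion.fst_eq h
    rcases m' with _ | ⟨w', m'⟩
    · rcases m with _ | ⟨w, _ | s⟩ <;> simp [ancestors]
    rcases m with _ | ⟨w, m⟩
    · simp at h
    simp only [DisjointUnion.mk_mk, AddTop.some_some] at h
    obtain rfl : w = w' := DisjointUnion.fst_eq h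
    rcases m' with _ | s'
    · rcases m with _ | s <;> simp [ancestors]
    rcases m with _ | s
    · simp at h
    simp only [DisjointUnion.mk_mk, AddTop.some_some] at h
    subst h
    simp [ancestors]
  · obtain ⟨u, _ | ⟨x, _ | ⟨w, _ | s⟩⟩⟩ := m <;>
      simp only [ancestors, List.mem_cons, List.not_mem_nil, or_false]
    · rintro rfl
      simp [forestOrder, componentOrder]
    · rintro (rfl | rfl) <;>
        simp [forestOrder, componentOrder]
    · rintro (rfl | rfl | rfl) <;>
        simp [forestOrder, componentOrder]
    · rintro (rfl | rfl | rfl | rfl) <;>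
        simp [forestOrder, componentOrder]

/-- The root label shows that only the automaton of the node's own level accepts it. The projections
listed with that automaton produce exactly its ancestors. -/
theorem conv_encodeNode_mem_iff (hB : B.initial = [q₀]) {m : ForestNode B q₀} {t : BinaryTree ℕ} :
    conv (encodeNode m) t ∈ (forestPresentation B).2.language ↔
      ∃ m' ∈ ancestors m, t = encodeNode m' := by
  rw [conv_mem_language_iff hB]
  obtain ⟨l0, l1, l2, l3⟩ := rootLabel_of_mem hB (t := encodeNode m)
  obtain ⟨⟨u, hu⟩, _ | ⟨x, _ | ⟨w, _ | s⟩⟩⟩ := m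
  · have h0 : nodeZero u ∈ (roleAutomaton 0 2 2).language := mem_language_zero.2 ⟨u, hu, rfl⟩
    have h1 : nodeZero u ∉ (roleAutomaton 1 3 2).language := fun h =>
      absurd (show 0 = 1 from l1 h) (by decide)
    have h2 : nodeZero u ∉ (roleAutomaton 2 3 5).language := fun h =>
      absurd (show 0 = 2 from l2 h) (by decide)
    have h3 : nodeZero u ∉ (leafAutomaton B).language := fun h =>
      absurd (show 3 ≤ 0 from l3 h) (by decide)
    simp [encodeNode, ancestors, projections, h0, h1, h2, h3, prune_some]
  · have h0 : nodeOne u x ∉ (roleAutomaton 0 2 2).language := fun h =>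
      absurd (show 1 = 0 from l0 h) (by decide)
    have h1 : nodeOne u x ∈ (roleAutomaton 1 3 2).language := mem_language_one.2 ⟨u, hu, x, rfl⟩
    have h2 : nodeOne u x ∉ (roleAutomaton 2 3 5).language := fun h =>
      absurd (show 1 = 2 from l2 h) (by decide)
    have h3 : nodeOne u x ∉ (leafAutomaton B).language := fun h =>
      absurd (show 3 ≤ 1 from l3 h) (by decide)
    simp [encodeNode, ancestors, projections, h0, h1, h2, h3, prune_some, prune_toZero_nodeOne]
  · have h0 : nodeTwo 2 u x w ∉ (roleAutomaton 0 2 2).language := fun h =>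
      absurd (show 2 = 0 from l0 h) (by decide)
    have h1 : nodeTwo 2 u x w ∉ (roleAutomaton 1 3 2).language := fun h =>
      absurd (show 2 = 1 from l1 h) (by decide)
    have h2 : nodeTwo 2 u x w ∈ (roleAutomaton 2 3 5).language :=
      mem_language_two.2 ⟨u, hu, x, w, rfl⟩
    have h3 : nodeTwo 2 u x w ∉ (leafAutomaton B).language := fun h =>
      absurd (show 3 ≤ 2 from l3 h) (by decide)
    simp [encodeNode, ancestors, projections, h0, h1, h2, h3, prune_some, prune_toZero_nodeTwo,
      prune_toOne_nodeTwo]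
  · have hs := rootLabel_leaf s.2.1
    have h0 : s.1 ∉ (roleAutomaton 0 2 2).language := fun h => by
      have := l0 h
      simp only [encodeNode] at this
      omega
    have h1 : s.1 ∉ (roleAutomaton 1 3 2).language := fun h => by
      have := l1 h
      simp only [encodeNode] at this
      omega
    have h2 : s.1 ∉ (roleAutomaton 2 3 5).language := fun h => by
      have := l2 h
      simp only [encodeNode] at this
      omega
    have h3 : s.1 ∈ (leafAutomaton B).language :=
      (mem_language_leafAutomaton hB).2 ⟨u, hu, x, w, s.2⟩
    simp [encodeNode, ancestors, projections, h0, h1, h2, h3, prune_some, prune_unpair_fst, s.2.1,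
      prune_toZero_nodeTwo, prune_toOne_nodeTwo, prune_toTwo_nodeTwo]

/-- The forest is presented by `forestPresentation B`. -/
noncomputable def forestRelIso (hB : B.initial = [q₀]) :
    forestOrder B q₀ ≃r (forestPresentation B).rel where
  toEquiv := (Equiv.ofInjective encodeNode encodeNode_injective).trans
    (Equiv.setCongr (range_encodeNode hB))
  map_rel_iff' {m m'} := by
    refine (conv_encodeNode_mem_iff hB).trans ?_
    rw [forestOrder_iff_mem_ancestors]
    constructor
    · rintro ⟨m'', h, h'⟩
      rwa [encodeNode_injective h']
    · exact fun h => ⟨m', h, rfl⟩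

theorem isRoot_forestOrder_iff {m : ForestNode B q₀} :
    IsRoot (forestOrder B q₀) m ↔ m = ⟨m.1, none⟩ := by
  simp only [IsRoot, forestOrder_iff_mem_ancestors]
  obtain ⟨u, _ | ⟨x, _ | ⟨w, _ | s⟩⟩⟩ := m
  · simp [ancestors]
  all_goals
    refine ⟨fun h => (h ⟨u, none⟩ (by simp [ancestors])).symm, fun h => ?_⟩
    simp at h

theorem roots_forestPresentation (hB : B.initial = [q₀]) :
    {x | ∃ h : x ∈ (forestPresentation B).domain, IsRoot (forestPresentation B).rel ⟨x, h⟩} =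
      labelSharp '' Tlef := by
  have hroot : ∀ m : ForestNode B q₀,
      IsRoot (forestPresentation B).rel (forestRelIso hB m) ↔ IsRoot (forestOrder B q₀) m := by
    intro m
    constructor
    · intro h y hy
      exact (forestRelIso hB).injective (h _ ((forestRelIso hB).map_rel_iff.2 hy))
    · intro h y hy
      obtain ⟨y, rfl⟩ := (forestRelIso hB).surjective y
      rw [h y ((forestRelIso hB).map_rel_iff.1 hy)]
  ext t
  constructor
  · rintro ⟨h, h'⟩
    obtain ⟨m, hm⟩ := (forestRelIso hB).surjective ⟨t, h⟩
    rw [← hm, hroot, isRoot_forestOrder_iff] at h'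
    rw [h'] at hm
    exact ⟨node () m.1 nil, ⟨m.1, m.1.2, rfl⟩, congrArg Subtype.val hm⟩
  · rintro ⟨_, ⟨u, hu, rfl⟩, rfl⟩
    let m : ForestNode B q₀ := ⟨⟨u, hu⟩, none⟩
    exact ⟨(forestRelIso hB m).2, (hroot m).2 (isRoot_forestOrder_iff.2 rfl)⟩

theorem iso_subtree_forestPresentation (hB : B.initial = [q₀]) {u : BinaryTree Unit} (hu : u ∈ Tbin)
    (h : labelSharp (node () u nil) ∈ (forestPresentation B).domain) :
    Iso (subtree (forestPresentation B).rel ⟨_, h⟩) (componentOrder B q₀ u) := by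
  let m : ForestNode B q₀ := ⟨⟨u, hu⟩, none⟩
  exact (iso_subtree_of_iso (forestRelIso hB) m).symm.trans
    (DisjointUnion.iso_subtree AddTop.top)

end TreeAutomatic

/-! ### The main theorem -/

open TreeAutomatic OrderForest BinaryTree

theorem mainTheorem10 :
    ∃ (V₀ V₁ : Type) (U₀ : V₀ → V₀ → Prop) (U₁ : V₁ → V₁ → Prop),
      OrderForest.IsTree U₀ ∧ OrderForest.HasHeight U₀ 3 ∧
      OrderForest.IsTree U₁ ∧ OrderForest.HasHeight U₁ 3 ∧
      ¬ OrderForest.Iso U₀ U₁ ∧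
      ∃ F : ℕ → TreeAutomatic.Presentation, Computable F ∧
        ∀ (e : ℕ) (B : Set (BinaryTree Unit)), B ⊆ TreeAutomatic.Tlef →
          TreeAutomatic.treeCode '' B = TreeAutomatic.sigmaTwo e →
            (F e).IsPresentation ∧
            OrderForest.IsForest (F e).rel ∧ OrderForest.HasHeight (F e).rel 3 ∧
            {x : BinaryTree ℕ | ∃ h : x ∈ (F e).domain, OrderForest.IsRoot (F e).rel ⟨x, h⟩} =
              TreeAutomatic.labelSharp '' TreeAutomatic.Tlef ∧
            ∀ t ∈ TreeAutomatic.Tlef, ∀ h : TreeAutomatic.labelSharp t ∈ (F e).domain,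
              (t ∈ B → OrderForest.Iso
                (OrderForest.subtree (F e).rel ⟨TreeAutomatic.labelSharp t, h⟩) U₀) ∧
              (t ∉ B → OrderForest.Iso
                (OrderForest.subtree (F e).rel ⟨TreeAutomatic.labelSharp t, h⟩) U₁) := by
  obtain ⟨N, μ, hN, hmem, hinf, hsome, hnone, hnot⟩ := exists_count_series
  obtain ⟨A, q₀, hA, hrun⟩ := hN.exists_runAutomaton
  have hcard : ∀ e u x w, Nat.card (Leaf (A e) q₀ u x w) = N e (node () u (node () x w)) := by
    intro e u x w
    refine ((hrun e).2 _ (by simp [nodeTwo])).trans ?_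
    rw [show shape (nodeTwo 3 u x w) = node () (shape (paint 0 u))
      (node () (shape (paint 4 x)) (shape (paint 5 w))) from rfl, shape_paint, shape_paint,
      shape_paint]
  -- Finite thresholds always occur infinitely often. Inside the set `none` does too, outside it
  -- never occurs; hence the threshold sets `Set.univ` and the complement of `none`.
  have hin : ∀ e u, treeCode (node () u nil) ∈ sigmaTwo e →
      Iso (componentOrder (A e) q₀ u) (heightThreeTree Set.univ) := fun e u h =>
    iso_heightThreeTree (hcard e u) (hmem e u) (hinf e u) (fun _ => Set.mem_univ _)
      fun m _ => match m with
        | none => hnone e u h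
        | some k => hsome e u k
  have hout : ∀ e u, treeCode (node () u nil) ∉ sigmaTwo e →
      Iso (componentOrder (A e) q₀ u) (heightThreeTree {none}ᶜ) := fun e u h =>
    iso_heightThreeTree (hcard e u) (hmem e u) (hinf e u) (hnot e u h)
      fun m hm => match m, hm with
        | none, hm => absurd rfl hm
        | some k, _ => hsome e u k
  have hheight : HasHeight (heightThreeTree {none}ᶜ) 3 :=
    hasHeight_heightThreeTree ⟨some 0, by simp⟩
  have hcomp : ∀ e u, IsForest (componentOrder (A e) q₀ u) ∧
      HasHeight (componentOrder (A e) q₀ u) 3 := by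
    intro e u
    by_cases h : treeCode (node () u nil) ∈ sigmaTwo e
    · obtain ⟨f⟩ := (hin e u h).symm
      exact ⟨(isTree_heightThreeTree _).1.of_iso f,
        (hasHeight_heightThreeTree Set.univ_nonempty).of_iso f⟩
    · obtain ⟨f⟩ := (hout e u h).symm
      exact ⟨(isTree_heightThreeTree _).1.of_iso f, hheight.of_iso f⟩
  refine ⟨_, _, heightThreeTree Set.univ, heightThreeTree {none}ᶜ, isTree_heightThreeTree _,
    hasHeight_heightThreeTree Set.univ_nonempty, isTree_heightThreeTree _, hheight,
    fun h => mem_of_iso_heightThreeTree (Set.mem_univ none) h rfl,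
    fun e => forestPresentation (A e), (primrec_forestPresentation hA).to_comp, ?_⟩
  intro e S hS hcode
  have hB := (hrun e).1
  -- The height is attained, so at least one component is needed.
  have : Nonempty Tbin := ⟨⟨node () nil nil, by simp, Iff.rfl, trivial, trivial⟩⟩
  refine ⟨isPresentation_forestPresentation hB,
    (DisjointUnion.isForest fun u : Tbin => (hcomp e u).1).of_iso (forestRelIso hB),
    (DisjointUnion.hasHeight fun u : Tbin => (hcomp e u).2).of_iso (forestRelIso hB),
    roots_forestPresentation hB, ?_⟩
  rintro _ ⟨u, hu, rfl⟩ h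
  have hmemS : node () u nil ∈ S ↔ treeCode (node () u nil) ∈ sigmaTwo e := by
    rw [← hcode, treeCode_injective.mem_set_image]
  have hsub := iso_subtree_forestPresentation hB hu h
  exact ⟨fun ht => hsub.trans (hin e u (hmemS.1 ht)),
    fun ht => hsub.trans (hout e u (mt hmemS.2 ht))⟩
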